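/- Let $K$ be a field of characteristic zero and write $f_t(x)=x^2+t$. For $N\ge1$ let $\Phi_N(x,t)=\prod_{n\mid N}(f_t^n(x)-x)^{\mu(N/n)}\in\mathbb Z[x,t]$, let $\Phi_{0,N}=\Phi_N$, and for $M\ge1$ let $\Phi_{M,N}(x,t)=\Phi_N(f_t^M(x),t)/\Phi_N(f_t^{M-1}(x),t)\in\mathbb Z[x,t]$. Put $R(N)=\frac1N\sum_{n\mid N}\mu(N/n)2^n$. A finite directed graph $G$ is admissible if every vertex has out-degree $1$ and in-degree $0$ or $2$, and for each $N\ge2$ it has at most $R(N)$ cycles of length $N$. For such $G$ let $\boldsymbol f$ be the self-map of the vertex set given by the edges, let $-P$ be the vertex different from $P$ with $\boldsymbol f(-P)=\boldsymbol f(P)$, and let $\overline{\mathcal O}(P)=\{\pm\boldsymbol f^k(P):k\ge0\}$. Vertices $P_1,\dots,P_n$ generate $G$ if every vertex lies in some $\overline{\mathcal O}(P_i)$; a generating set is minimal if no generating set has fewer elements. The portrait of $P$ is the pair (preperiod, eventual period). Let $P_1,\dots,P_n$ be a minimal generating set of $G$, let $(M_i,N_i)$ be the portrait of $P_i$, let $G_{(i)}=\bigcup_{j\le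 i}\overline{\mathcal O}(P_j)$, and let $\mathcal D$ be the set of $i$ such that the orbit $\{\boldsymbol f^k(P_i):k\ge0\}$ is disjoint from $G_{(i-1)}$. For $i\in\mathcal D$ put $\Psi_i=\Phi_{M_i,N_i}(x_i,t)$. For $i\notin\mathcal D$ let $\kappa_i$ be the least $k$ with $\boldsymbol f^{k}(P_i)\in G_{(i-1)}$, let $j_i$ be the index $j$ with $\boldsymbol f^{\kappa_i}(P_i)\in G_{(j)}\setminus G_{(j-1)}$, let $\lambda_i$ be the least $\ell$ with $\boldsymbol f^{\ell}(P_{j_i})=-\boldsymbol f^{\kappa_i}(P_i)$, and put $\Psi_i=f_t^{\kappa_i}(x_i)+f_t^{\lambda_i}(x_{j_i})$. Let $Y_1(G)\subset\mathbb A^{n+1}_K$ be the closure, with its reduced structure, of the locus where $\Psi_1=\dots=\Psi_n=0$ and $f_t^{M_i}(x_i)\ne f_t^{M_j+k}(x_j)$ for all $i>j$ in $\mathcal D$ with $N_i=N_j$ and all $0\le k\le N_i-1$. Let $X_1(G)$ be the normalization of the closure of $Y_1(G)$ in $\mathbb P^{n+1}_K$, and let $\pi_G\colon X_1(G)\to\mathbb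 P^1_K$ be the morphism that is $(\mathbf x,t)\mapsto t$ on the preimage of $Y_1(G)$. Let $G$ be an admissible graph, written as a disjoint union $G=\bigsqcup_{i=1}^m G_i$ of admissible subgraphs such that $G_i$ and $G_j$ have no common cycle length whenever $i\ne j$, and form the curves from any (ordered) minimal generating sets of $G,G_1,\dots,G_m$. Then the morphisms $\pi_G,\pi_{G_1},\dots,\pi_{G_m}$ exist and are unique, and $X_1(G)$ is birational, over $\mathbb P^1_K$, to the fiber product $X_1(G_1)\times_{\mathbb P^1_K}\cdots\times_{\mathbb P^1_K}X_1(G_m)$ taken relative to the $\pi_{G_i}$; that is, there are dense open subschemes of the two that are isomorphic by an isomorphism compatible with the maps to $\mathbb P^1_K$. -/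

import Mathlib

open AlgebraicGeometry CategoryTheory CategoryTheory.Limits

attribute [local instance] MvPolynomial.gradedAlgebra

noncomputable section

namespace DynMod

universe u v

/-! ### Dynatomic polynomials -/

/-- The iterate `f_c^k(x)` of the quadratic polynomial `f_c(x) = x ^ 2 + c`. -/
def quadIter {A : Type*} [CommRing A] (c x : A) (k : ℕ) : A :=
  (fun y : A => y ^ 2 + c)^[k] x

open Polynomial in
/-- The polynomial `f_t^k(x)`, as an element of `ℤ[t][x]` (`t` is the inner variable and `x` the
outer one). -/
def genIter (k : ℕ) : ℤ[X][X] := quadIter (C X) X k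

open Polynomial in
/-- The dynatomic polynomial `Φ_N(x, t) = ∏_{n ∣ N} (f_t^n(x) - x) ^ μ(N / n)`, as an element of
`ℤ[t][x]`. The factors with exponent `-1` are monic in `x`, and the division by their product
is exact. -/
def dynatomic (N : ℕ) : ℤ[X][X] :=
  (∏ n ∈ N.divisors with ArithmeticFunction.moebius (N / n) = 1, (genIter n - X)) /ₘ
    (∏ n ∈ N.divisors with ArithmeticFunction.moebius (N / n) = -1, (genIter n - X))

open Polynomial in
/-- The generalized dynatomic polynomial: `Φ_{0,N} = Φ_N`, and
`Φ_{M,N}(x, t) = Φ_N(f_t^M(x), t) / Φ_N(f_t^{M-1}(x), t)` for `M ≥ 1` (an exact division by a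
polynomial that is monic in `x`). -/
def genDynatomic : ℕ → ℕ → ℤ[X][X]
  | 0, N => dynatomic N
  | M + 1, N =>
    (dynatomic N).comp (genIter (M + 1)) /ₘ (dynatomic N).comp (genIter M)

/-- The value `Φ_{M,N}(x, t)` at elements `x, t` of a commutative ring. -/
def evalDynatomic {A : Type*} [CommRing A] (M N : ℕ) (x t : A) : A :=
  (genDynatomic M N).eval₂ (Polynomial.eval₂RingHom (Int.castRingHom A) t) x

/-- `D(N) = ∑_{n ∣ N} μ(N / n) 2 ^ n`. -/
def numPoints (N : ℕ) : ℤ :=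
  ∑ n ∈ N.divisors, ArithmeticFunction.moebius (N / n) * 2 ^ n

/-- `R(N) = D(N) / N`. -/
def numCycles (N : ℕ) : ℚ := numPoints N / N

/-! ### Admissible graphs -/

section Graph

variable {V : Type v} (G : Digraph V)

open Classical in
/-- The self-map `f` of the vertices with `f P = Q` iff `P → Q` is an edge
(for graphs in which every vertex has out-degree one). -/
def next (P : V) : V := if h : ∃ Q, G.Adj P Q then h.choose else P

/-- The set of `N`-cycles of `G`. -/
def cyclesOfLength (N : ℕ) : Set (Cycle V) :=
  {C | ∃ P ∈ Function.periodicPts (next G), Function.minimalPeriod (next G) P = N ∧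
    C = Function.periodicOrbit (next G) P}

/-- The set of lengths of cycles of `G`. -/
def cycleLengths : Set ℕ := {N | (cyclesOfLength G N).Nonempty}

/-- Admissible directed graphs. -/
structure IsAdmissible : Prop where
  finite : Finite V
  outDegree : ∀ P, ∃! Q, G.Adj P Q
  inDegree : ∀ Q, {P | G.Adj P Q}.ncard = 0 ∨ {P | G.Adj P Q}.ncard = 2
  cycles : ∀ N, 2 ≤ N → ((cyclesOfLength G N).ncard : ℚ) ≤ numCycles N

/-- `Q = -P`, i.e. `Q` is the vertex different from `P` with `f Q = f P`. -/
def IsNeg (P Q : V) : Prop := Q ≠ P ∧ next G Q = next G P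

/-- The preperiod of a vertex. -/
def preperiod (P : V) : ℕ := sInf {m | (next G)^[m] P ∈ Function.periodicPts (next G)}

/-- The eventual period of a vertex. -/
def eventualPeriod (P : V) : ℕ :=
  Function.minimalPeriod (next G) ((next G)^[preperiod G P] P)

/-- The set `{± f^k(P) : k ≥ 0}`. -/
def fullOrbit (P : V) : Set V :=
  {Q | ∃ k, Q = (next G)^[k] P ∨ IsNeg G ((next G)^[k] P) Q}

/-- `P₁, …, Pₙ` generate `G`. -/
def Generates {n : ℕ} (P : Fin n → V) : Prop := ∀ Q, ∃ i, Q ∈ fullOrbit G (P i)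

/-- `P₁, …, Pₙ` is a minimal generating set of `G`, i.e. it has the least possible
number of elements. -/
def MinGenerates {n : ℕ} (P : Fin n → V) : Prop :=
  Generates G P ∧ ∀ (m : ℕ) (Q : Fin m → V), Generates G Q → n ≤ m

variable {n : ℕ} (P : Fin n → V)

/-- The vertex set of `G_{i-1}`, the subgraph generated by the `P_j` with `j < i`. -/
def before (i : Fin n) : Set V := {Q | ∃ j < i, Q ∈ fullOrbit G (P j)}

/-- The set `H_i` of vertices of `G_i` that are not in `G_{i-1}`. -/
def newVertices (i : Fin n) : Set V := fullOrbit G (P i) \ before G P i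

/-- The set `𝒟` of indices `i` for which the orbit of `P_i` is disjoint from `G_{i-1}`. -/
def disjointIdx : Set (Fin n) := {i | ∀ k, (next G)^[k] (P i) ∉ before G P i}

/-- The least `k` with `f^k(P_i) ∈ G_{i-1}`. -/
def kappa (i : Fin n) : ℕ := sInf {k | (next G)^[k] (P i) ∈ before G P i}

/-- The least `ℓ` with `f^ℓ(P_j) = -f^{κ_i}(P_i)`. -/
def lam (i j : Fin n) : ℕ :=
  sInf {l | IsNeg G ((next G)^[kappa G P i] (P i)) ((next G)^[l] (P j))}

end Graph

/-! ### Affine and projective space -/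

section Space

variable (σ : Type) (K : Type u) [Field K]

/-- The affine space over `K` with coordinates indexed by `σ`. -/
abbrev AffSpace : Scheme.{u} := Spec (.of (MvPolynomial σ K))

/-- The projective space over `K` with homogeneous coordinates indexed by `Option σ`;
the coordinate of index `none` is the homogenizing one. -/
abbrev PrSpace : Scheme.{u} := Proj (MvPolynomial.homogeneousSubmodule (Option σ) K)

/-- The evaluation `X_none ↦ 1`, `X_i ↦ x_i` of homogeneous coordinates. -/
def dehomPoly : MvPolynomial (Option σ) K →+* MvPolynomial σ K :=
  (MvPolynomial.aeval (R := K) fun o : Option σ => o.elim 1 MvPolynomial.X :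
    MvPolynomial (Option σ) K →ₐ[K] MvPolynomial σ K)

theorem isUnit_dehomPoly : IsUnit (dehomPoly σ K (MvPolynomial.X none)) := by
  simp [dehomPoly]

/-- Dehomogenization: the ring map from the degree zero part of `K[X][1 / X_none]` to `K[x]`
that sends `X_i / X_none` to `x_i`. -/
def dehom : HomogeneousLocalization.Away (MvPolynomial.homogeneousSubmodule (Option σ) K)
    (MvPolynomial.X none) →+* MvPolynomial σ K :=
  (IsLocalization.Away.lift (S := Localization.Away (MvPolynomial.X (R := K) (none : Option σ)))
    (MvPolynomial.X none) (isUnit_dehomPoly σ K)).comp (algebraMap _ _)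

/-- The standard open embedding of affine space into projective space,
`(x_i) ↦ [1 : (x_i)]`. -/
def chart : AffSpace σ K ⟶ PrSpace σ K :=
  Spec.map (CommRingCat.ofHom (dehom σ K)) ≫
    Proj.awayι (MvPolynomial.homogeneousSubmodule (Option σ) K) (MvPolynomial.X none)
      (MvPolynomial.isHomogeneous_X K none) Nat.one_pos

/-- The projective line over `K`, with affine coordinate `t`. -/
abbrev PrLine : Scheme.{u} := PrSpace Unit K

end Space

/-! ### Dynamical modular curves -/

section Curves

variable (K : Type u) [Field K] {V : Type v} (G : Digraph V) {n : ℕ} (P : Fin n → V)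

/-- The coordinate ring `K[x₁, …, xₙ, t]` of affine `(n+1)`-space; the index `none` is that
of `t`. -/
abbrev CoordRing (n : ℕ) : Type u := MvPolynomial (Option (Fin n)) K

/-- The coordinate `x_i`. -/
abbrev xvar (i : Fin n) : CoordRing K n := MvPolynomial.X (some i)

/-- The coordinate `t`. -/
abbrev tvar (n : ℕ) : CoordRing K n := MvPolynomial.X none

/-- The set of polynomials `Ψ₁, …, Ψₙ`: for `i ∈ 𝒟`, `Ψ_i = Φ_{M_i,N_i}(x_i, t)`; for `i ∉ 𝒟`,
`Ψ_i = f_t^{κ_i}(x_i) + f_t^{λ_i}(x_j)`, where `j` is the unique index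
with `f^{κ_i}(P_i) ∈ H_j`. -/
def equations : Set (CoordRing K n) :=
  {q | ∃ i ∈ disjointIdx G P,
      q = evalDynatomic (preperiod G (P i)) (eventualPeriod G (P i)) (xvar K i) (tvar K n)} ∪
  {q | ∃ i ∉ disjointIdx G P, ∃ j, (next G)^[kappa G P i] (P i) ∈ newVertices G P j ∧
      q = quadIter (tvar K n) (xvar K i) (kappa G P i) +
        quadIter (tvar K n) (xvar K j) (lam G P i j)}

/-- The polynomials `f_t^{M_i}(x_i) - f_t^{M_j + k}(x_j)`, for `i > j` in `𝒟` with `N_i = N_j`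
and `0 ≤ k ≤ N_i - 1`, that are required not to vanish. -/
def inequations : Set (CoordRing K n) :=
  {q | ∃ i ∈ disjointIdx G P, ∃ j ∈ disjointIdx G P, j < i ∧
    eventualPeriod G (P i) = eventualPeriod G (P j) ∧ ∃ k < eventualPeriod G (P i),
      q = quadIter (tvar K n) (xvar K i) (preperiod G (P i)) -
        quadIter (tvar K n) (xvar K j) (preperiod G (P j) + k)}

/-- The locus in affine `(n+1)`-space on which the `Ψ_i` vanish and none of the polynomials in
`inequations` does. -/
def openLocus : Set (PrimeSpectrum (CoordRing K n)) :=
  PrimeSpectrum.zeroLocus (equations K G P) ∩ {p | ∀ q ∈ inequations K G P, q ∉ p.asIdeal}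

/-- The coordinate ring of `Y_1(G)`, the closure of `openLocus` with its reduced structure. -/
abbrev Y1Ring : Type u :=
  CoordRing K n ⧸ PrimeSpectrum.vanishingIdeal (closure (openLocus K G P))

/-- The affine curve `Y_1(G)`. -/
abbrev Y1 : Scheme.{u} := Spec (.of (Y1Ring K G P))

/-- The closed immersion of `Y_1(G)` into affine `(n+1)`-space. -/
def Y1ι : Y1 K G P ⟶ AffSpace (Option (Fin n)) K :=
  Spec.map (CommRingCat.ofHom (Ideal.Quotient.mk _))

/-- The inclusion of `Y_1(G)` into projective `(n+1)`-space. -/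
abbrev Y1toPr : Y1 K G P ⟶ PrSpace (Option (Fin n)) K :=
  Y1ι K G P ≫ chart (Option (Fin n)) K

/-- The projective closure of `Y_1(G)`: the scheme-theoretic image of the reduced scheme `Y_1(G)`
in projective space, i.e. the closure of `Y_1(G)` with its reduced structure. -/
abbrev projClosure : Scheme.{u} := (Y1toPr K G P).image

/-- The open immersion of `Y_1(G)` into its projective closure. -/
abbrev Y1toClosure : Y1 K G P ⟶ projClosure K G P := (Y1toPr K G P).toImage

/-- The generic points of the projective closure: the spectrum of its ring of rational functions,
which is the total ring of fractions of the coordinate ring of its dense open subscheme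
`Y_1(G)`. -/
abbrev genericPoints : Spec (.of (FractionRing (Y1Ring K G P))) ⟶ projClosure K G P :=
  Spec.map (CommRingCat.ofHom (algebraMap (Y1Ring K G P) (FractionRing (Y1Ring K G P)))) ≫
    Y1toClosure K G P

/-- The curve `X_1(G)`: the normalization of the projective closure of `Y_1(G)`, i.e. its
integral closure in its ring of rational functions. -/
def X1 : Scheme.{u} := (genericPoints K G P).normalization

/-- The normalization morphism from `X_1(G)` to the projective closure of `Y_1(G)`. -/
def X1toClosure : X1 K G P ⟶ projClosure K G P := (genericPoints K G P).fromNormalization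

/-- The morphism `Y_1(G) ⟶ ℙ¹`, `(x, t) ↦ t`. -/
def Y1toPrLine : Y1 K G P ⟶ PrLine K :=
  Y1ι K G P ≫
    Spec.map (CommRingCat.ofHom (MvPolynomial.rename (R := K)
      (fun _ : Unit => (none : Option (Fin n)))).toRingHom) ≫ chart Unit K

/-- `π` is the projection `π_G : X_1(G) ⟶ ℙ¹`, `(x, t) ↦ t`: on the preimage
`X_1(G) ×_{projClosure} Y_1(G)` of `Y_1(G)` it is the projection to the `t`-coordinate. -/
def IsProjection (π : X1 K G P ⟶ PrLine K) : Prop :=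
  pullback.fst (X1toClosure K G P) (Y1toClosure K G P) ≫ π =
    pullback.snd (X1toClosure K G P) (Y1toClosure K G P) ≫ Y1toPrLine K G P

end Curves

/-- The subgraph of `G` induced on a set of vertices. -/
def inducedSubgraph {V : Type v} (G : Digraph V) (S : Set V) : Digraph S where
  Adj P Q := G.Adj P Q

/-- `G` is the disjoint union of its induced subgraphs on the vertex sets `S i`: these sets
partition the vertices, and no edge joins two different ones. -/
structure IsDisjointUnion {V : Type v} (G : Digraph V) {ι : Type*} (S : ι → Set V) : Prop where
  disjoint : Pairwise fun i j => Disjoint (S i) (S j)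
  cover : ⋃ i, S i = Set.univ
  noEdge : ∀ i P Q, P ∈ S i → G.Adj P Q → Q ∈ S i

end DynMod

end

noncomputable section

namespace DynMod

/-! ### Iteration of `y ↦ y ^ 2 + c` -/

section QuadIter

variable {A A' : Type*} [CommRing A] [CommRing A']

/-! The first half is arithmetic: a point of `Y1` with transcendental parameter `t` is the same
thing as an embedding (`IsEmb`) of the graph into the functional graph of `y ↦ y ^ 2 + t` on a
field. For such `t` no cycle has multiplier one, since otherwise `2` would be a unit in an integral
extension of `ℤ[t]`. So `f^n(x) - x` is separable and the zeros of `dynatomic N` are exactly the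
points of period `N`. The critical point `0` is not preperiodic either, so `z` and `-z` differ along
every preperiodic orbit. Given these two facts, the equations and inequations attached to a minimal
generating set force all coincidences among the iterates of the coordinates to be those of the graph
(`IsSolution.iterate_eq_iff`), and the solution extends to an embedding. The equations form a
triangular monic system, hence are flat over `K[t]`, and by going-down every point of the open locus
generizes to one that dominates the parameter line. Therefore the ideal of `Y1` consists of the
polynomials that vanish at all embeddings (`mem_Y1Ideal_iff`).

The combinatorial core is `exists_isEmb_of_forall`: embeddings of the parts with the same `t` glue
to an embedding of the union. Only injectivity across different parts is at stake, and the value of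
a vertex determines its eventual period, which different parts never share.

The second half turns this bijection on generic points into an isomorphism of open subschemes. The
coordinate rings are finite and reduced over `K[t]`, so in characteristic zero they all become étale
after inverting one `g ≠ 0`. Over `D(g)` the comparison map from the curve of the union to the fiber
product is étale and integral, a monomorphism because the vertices generate the coordinate ring, and
surjective because generic points lift; so it is an isomorphism (`isIso_specLift`). An algebra étale
over the normal ring `K[t]` is already integrally closed in its fractions, so these affine pieces
are the preimages of `D(g)` in the normalizations (`exists_isPullback_basicY1`). The preimage is
dense in the fiber product because each projection is flat over `ℙ¹`.

The projections exist because the relations `f^b(x_i) = f^a(x_i)` with `a < b` keep the projective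
closure away from the center of the linear projection; they are unique because the generic points
are dense. -/

@[simp] lemma quadIter_zero (c x : A) : quadIter c x 0 = x := rfl

lemma quadIter_succ (c x : A) (k : ℕ) : quadIter c x (k + 1) = quadIter c x k ^ 2 + c := by
  rw [quadIter, Function.iterate_succ_apply', quadIter]

lemma quadIter_succ' (c x : A) (k : ℕ) : quadIter c x (k + 1) = quadIter c (x ^ 2 + c) k := by
  rw [quadIter, Function.iterate_succ_apply, quadIter]

lemma quadIter_add (c x : A) (a b : ℕ) : quadIter c x (a + b) = quadIter c (quadIter c x b) a := by
  simp only [quadIter, Function.iterate_add_apply]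

lemma map_quadIter (f : A →+* A') (c x : A) (k : ℕ) :
    f (quadIter c x k) = quadIter (f c) (f x) k := by
  induction k with
  | zero => rfl
  | succ k ih => simp [quadIter_succ, ih]

lemma quadIter_neg (c x : A) {k : ℕ} (hk : k ≠ 0) : quadIter c (-x) k = quadIter c x k := by
  obtain ⟨k, rfl⟩ := Nat.exists_eq_succ_of_ne_zero hk
  rw [Nat.succ_eq_add_one, quadIter_succ', quadIter_succ', neg_sq]

open Polynomial

lemma quadIter_C_X_monic_natDegree [Nontrivial A] (c : A) (k : ℕ) :
    (quadIter (C c) X k).Monic ∧ (quadIter (C c) (X : A[X]) k).natDegree = 2 ^ k := by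
  induction k with
  | zero => simp [monic_X]
  | succ k ih =>
    have h1 : (quadIter (C c) (X : A[X]) k ^ 2).natDegree = 2 ^ (k + 1) := by
      rw [ih.1.natDegree_pow, ih.2]; ring
    rw [quadIter_succ]
    have h2 : (C c).natDegree < (quadIter (C c) (X : A[X]) k ^ 2).natDegree := by
      rw [h1, natDegree_C]; positivity
    refine ⟨(ih.1.pow 2).add_of_left (degree_lt_degree h2), ?_⟩
    rw [natDegree_add_eq_left_of_natDegree_lt h2, h1]

lemma quadIter_C_X_monic (c : A) (k : ℕ) : (quadIter (C c) X k).Monic := by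
  nontriviality A
  exact (quadIter_C_X_monic_natDegree c k).1

lemma natDegree_quadIter_C_X [Nontrivial A] (c : A) (k : ℕ) :
    (quadIter (C c) (X : A[X]) k).natDegree = 2 ^ k :=
  (quadIter_C_X_monic_natDegree c k).2

lemma quadIter_sub_X_monic (c : A) {k : ℕ} (hk : k ≠ 0) : (quadIter (C c) X k - X).Monic := by
  nontriviality A
  refine (quadIter_C_X_monic c k).sub_of_left (degree_lt_degree ?_)
  rw [natDegree_X, natDegree_quadIter_C_X]
  exact Nat.one_lt_two_pow hk

lemma eval_quadIter_C_X (c x : A) (k : ℕ) : (quadIter (C c) X k).eval x = quadIter c x k := by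
  rw [← coe_evalRingHom, map_quadIter]
  simp

/-- Chain rule. At a point of period `k` the right-hand side is the multiplier of its cycle, which
links multiple roots of `f^k(x) - x` to multiplier one. -/
lemma derivative_quadIter_C_X (c : A) (k : ℕ) : derivative (quadIter (C c) (X : A[X]) k) =
    2 ^ k * ∏ i ∈ Finset.range k, quadIter (C c) X i := by
  induction k with
  | zero => simp
  | succ k ih =>
    rw [quadIter_succ, derivative_add, derivative_C, derivative_pow, ih, Finset.prod_range_succ]
    push_cast
    simp only [map_ofNat]
    ring

lemma natDegree_quadIter_X_zero [Nontrivial A] (k : ℕ) :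
    (quadIter (X : A[X]) 0 (k + 1)).natDegree = 2 ^ k := by
  have key : ∀ k, (quadIter (X : A[X]) 0 (k + 1)).Monic ∧
      (quadIter (X : A[X]) 0 (k + 1)).natDegree = 2 ^ k := by
    intro k
    induction k with
    | zero => simp [quadIter_succ, monic_X]
    | succ k ih =>
      have h1 : (quadIter (X : A[X]) 0 (k + 1) ^ 2).natDegree = 2 ^ (k + 1) := by
        rw [ih.1.natDegree_pow, ih.2]; ring
      rw [quadIter_succ]
      have h2 : (X : A[X]).natDegree < (quadIter (X : A[X]) 0 (k + 1) ^ 2).natDegree := by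
        rw [h1, natDegree_X]; exact Nat.one_lt_two_pow (by simp)
      refine ⟨(ih.1.pow 2).add_of_left (degree_lt_degree h2), ?_⟩
      rw [natDegree_add_eq_left_of_natDegree_lt h2, h1]
  exact (key k).2

/-- The iterates of `0` are told apart by their degrees in the parameter: `0` for the zeroth, then
`2 ^ k` for the `k + 1`-st. -/
lemma quadIter_X_zero_injective [Nontrivial A] :
    Function.Injective fun k => quadIter (X : A[X]) 0 k := by
  intro a b h
  have h' := congrArg natDegree h
  rcases a with _ | a <;> rcases b with _ | b
  · rfl
  · simp only [natDegree_quadIter_X_zero, quadIter_zero, natDegree_zero] at h'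
    exact absurd h'.symm (by positivity)
  · simp only [natDegree_quadIter_X_zero, quadIter_zero, natDegree_zero] at h'
    exact absurd h' (by positivity)
  · simp only [natDegree_quadIter_X_zero] at h'
    rw [Nat.pow_right_injective le_rfl h']

/-- The critical point is not preperiodic when the parameter is transcendental. -/
lemma quadIter_zero_injective [Nontrivial A] {c : A} (hc : Transcendental ℤ c) :
    Function.Injective fun k => quadIter c 0 k := by
  have hinj := transcendental_iff_injective.mp hc
  intro a b h
  apply quadIter_X_zero_injective (A := ℤ)
  apply hinj
  have := fun k => map_quadIter (aeval (R := ℤ) c).toRingHom X 0 k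
  simp only [AlgHom.toRingHom_eq_coe, RingHom.coe_coe, aeval_X, map_zero] at this
  simpa [this] using h

end QuadIter

/-! ### Periodic points of the generic quadratic polynomial -/

section Periodic

open Polynomial Function

variable {L : Type*} [Field L] {t : L}

/-- A periodic point of `y ↦ y ^ 2 + t`, for `t` transcendental, does not have multiplier one. -/
lemma multiplier_ne_one (ht : Transcendental ℤ t) {n : ℕ} (hn : n ≠ 0) {x : L}
    (hx : quadIter t x n = x) : (2 : L) ^ n * ∏ i ∈ Finset.range n, quadIter t x i ≠ 1 := by
  intro h
  have hinj := transcendental_iff_injective.mp ht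
  algebraize [(aeval (R := ℤ) t).toRingHom]
  have hamap : ∀ p : ℤ[X], algebraMap ℤ[X] L p = aeval t p := fun _ => rfl
  have hxi : IsIntegral ℤ[X] x := by
    refine ⟨genIter n - X, quadIter_sub_X_monic (X : ℤ[X]) hn, ?_⟩
    rw [genIter, eval₂_sub, eval₂_X, ← coe_eval₂RingHom, map_quadIter]
    simp [hamap, hx]
  have hxi' : ∀ i, IsIntegral ℤ[X] (quadIter t x i) := by
    intro i
    induction i with
    | zero => exact hxi
    | succ i ih =>
      rw [quadIter_succ]
      refine (ih.pow 2).add ?_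
      have : t = algebraMap ℤ[X] L X := by simp [hamap]
      rw [this]
      exact isIntegral_algebraMap
  -- One factor `2` is left out of the multiplier. If the multiplier is `1`, this integral element
  -- is an inverse of `2`.
  have hprod : IsIntegral ℤ[X] (2 ^ (n - 1) * ∏ i ∈ Finset.range n, quadIter t x i) := by
    refine IsIntegral.mul ?_ (IsIntegral.prod _ fun i _ => hxi' i)
    have : (2 : L) ^ (n - 1) = algebraMap ℤ[X] L (2 ^ (n - 1)) := by
      rw [map_pow, map_ofNat (algebraMap ℤ[X] L) 2]
    rw [this]
    exact isIntegral_algebraMap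
  have : FaithfulSMul ℤ[X] (integralClosure ℤ[X] L) := by
    rw [faithfulSMul_iff_algebraMap_injective]
    refine Function.Injective.of_comp (f := algebraMap (integralClosure ℤ[X] L) L) ?_
    rw [← RingHom.coe_comp, ← IsScalarTower.algebraMap_eq]
    exact hinj
  have h2 : IsUnit (algebraMap ℤ[X] (integralClosure ℤ[X] L) 2) := by
    refine IsUnit.of_mul_eq_one ⟨_, hprod⟩ (Subtype.ext ?_)
    simp only [map_ofNat, MulMemClass.coe_mul, OneMemClass.coe_one]
    rw [← h]
    obtain ⟨m, rfl⟩ := Nat.exists_eq_succ_of_ne_zero hn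
    simp only [Nat.succ_eq_add_one, Nat.add_sub_cancel]
    change (2 : L) * _ = _
    ring
  -- Units descend along an injective integral extension; evaluating at `0` would then make `2` a
  -- unit of `ℤ`.
  have h3 : IsUnit (2 : ℤ[X]) := (isUnit_map_iff _ _).mp h2
  have h4 := h3.map (evalRingHom (0 : ℤ))
  simp [Int.isUnit_iff] at h4

/-- The period of a point, in terms of iterates. -/
lemma quadIter_eq_self_iff {x : L} {n : ℕ} :
    quadIter t x n = x ↔ minimalPeriod (fun y : L => y ^ 2 + t) x ∣ n :=
  isPeriodicPt_iff_minimalPeriod_dvd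

variable (t) in
/-- The monic polynomial whose roots are the points of exact period `n`. -/
def exactPoly [DecidableEq L] (n : ℕ) : L[X] :=
  ∏ α ∈ (quadIter (C t) X n - X : L[X]).roots.toFinset with
    minimalPeriod (fun y : L => y ^ 2 + t) α = n, (X - C α)

variable [DecidableEq L]

lemma mem_roots_quadIter_sub_X {n : ℕ} (hn : n ≠ 0) {α : L} :
    α ∈ (quadIter (C t) X n - X : L[X]).roots.toFinset ↔ quadIter t α n = α := by
  rw [Multiset.mem_toFinset, mem_roots (quadIter_sub_X_monic t hn).ne_zero, IsRoot, eval_sub,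
    eval_quadIter_C_X, eval_X, sub_eq_zero]

lemma mem_exactPoints {n : ℕ} (hn : n ≠ 0) {α : L} :
    α ∈ (quadIter (C t) X n - X : L[X]).roots.toFinset.filter
      (fun α => minimalPeriod (fun y : L => y ^ 2 + t) α = n) ↔
      minimalPeriod (fun y : L => y ^ 2 + t) α = n := by
  rw [Finset.mem_filter, mem_roots_quadIter_sub_X hn, quadIter_eq_self_iff]
  exact ⟨fun h => h.2, fun h => ⟨h.dvd, h⟩⟩

lemma exactPoly_monic (n : ℕ) : (exactPoly t n).Monic :=
  monic_prod_of_monic _ _ fun α _ => monic_X_sub_C α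

lemma exactPoly_eval_eq_zero_iff {n : ℕ} (hn : n ≠ 0) {x : L} :
    (exactPoly t n).eval x = 0 ↔ minimalPeriod (fun y : L => y ^ 2 + t) x = n := by
  rw [exactPoly, eval_prod, Finset.prod_eq_zero_iff]
  simp only [mem_exactPoints hn, eval_sub, eval_X, eval_C, sub_eq_zero]
  exact ⟨fun ⟨α, h, h'⟩ => h' ▸ h, fun h => ⟨x, h, rfl⟩⟩

/-- A multiple root would be a periodic point at which the derivative of `f^n(x) - x` vanishes, that
is, one of multiplier one. -/
lemma roots_quadIter_sub_X_nodup (ht : Transcendental ℤ t) {n : ℕ} (hn : n ≠ 0) :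
    (quadIter (C t) X n - X : L[X]).roots.Nodup := by
  rw [Multiset.nodup_iff_count_le_one]
  intro α
  rw [count_roots]
  by_contra! h
  rw [one_lt_rootMultiplicity_iff_isRoot (quadIter_sub_X_monic t hn).ne_zero] at h
  obtain ⟨h1, h2⟩ := h
  rw [IsRoot, eval_sub, eval_quadIter_C_X, eval_X, sub_eq_zero] at h1
  rw [IsRoot, derivative_sub, derivative_X, derivative_quadIter_C_X, eval_sub, eval_one,
    sub_eq_zero, eval_mul, eval_prod] at h2
  simp only [eval_pow, eval_quadIter_C_X, eval_ofNat] at h2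
  exact multiplier_ne_one ht hn h1 h2

variable [IsAlgClosed L]

/-- All roots of `f^n(x) - x` are simple, so sorting the linear factors by the exact period of the
root loses no multiplicity. -/
lemma prod_exactPoly (ht : Transcendental ℤ t) {n : ℕ} (hn : n ≠ 0) :
    ∏ d ∈ n.divisors, exactPoly t d = quadIter (C t) X n - X := by
  have h0 := (quadIter_sub_X_monic t hn)
  have h1 := (IsAlgClosed.splits (quadIter (C t) X n - X : L[X])).eq_prod_roots
  rw [h0.leadingCoeff, C_1, one_mul] at h1
  rw [h1]
  conv_rhs => rw [← (roots_quadIter_sub_X_nodup ht hn).dedup]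
  change _ = ∏ α ∈ (quadIter (C t) X n - X : L[X]).roots.toFinset, (X - C α)
  rw [← Finset.prod_fiberwise_of_maps_to
    (g := fun α : L => minimalPeriod (fun y : L => y ^ 2 + t) α) (t := n.divisors)]
  · refine Finset.prod_congr rfl fun d hd => ?_
    have hd' := (Nat.mem_divisors.mp hd).1
    have hd0 : d ≠ 0 := fun h => hn (by simpa [h] using hd')
    refine Finset.prod_congr ?_ fun _ _ => rfl
    ext α
    rw [mem_exactPoints hd0, Finset.mem_filter, mem_roots_quadIter_sub_X hn, quadIter_eq_self_iff]
    exact ⟨fun h => ⟨h ▸ hd', h⟩, fun h => h.2⟩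
  · intro α hα
    rw [mem_roots_quadIter_sub_X hn, quadIter_eq_self_iff] at hα
    exact Nat.mem_divisors.mpr ⟨hα, hn⟩

end Periodic

end DynMod
end

noncomputable section

namespace DynMod

/-! ### Dynatomic polynomials and exact periods -/

section Dynatomic

open Polynomial Function

/-- The Möbius function takes only the values `0` and `±1`, so a Möbius product is one plain product
divided by another. This matches the multiplicative inversion formula with the division that defines
`dynatomic`. -/
lemma prod_moebius_split {F : Type*} [CommGroupWithZero F] (g : ℕ → F) {N : ℕ}
    (hg : ∀ n ∈ N.divisors, g n ≠ 0) :
    (∏ x ∈ N.divisorsAntidiagonal, g x.2 ^ ArithmeticFunction.moebius x.1) *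
      ∏ n ∈ N.divisors with ArithmeticFunction.moebius (N / n) = -1, g n =
    ∏ n ∈ N.divisors with ArithmeticFunction.moebius (N / n) = 1, g n := by
  rw [Nat.prod_divisorsAntidiagonal' (fun a b => g b ^ ArithmeticFunction.moebius a),
    Finset.prod_filter, Finset.prod_filter, ← Finset.prod_mul_distrib]
  refine Finset.prod_congr rfl fun n hn => ?_
  have h0 := hg n hn
  have hcases : ArithmeticFunction.moebius (N / n) = 0 ∨ ArithmeticFunction.moebius (N / n) = 1 ∨
      ArithmeticFunction.moebius (N / n) = -1 := by
    by_cases hs : Squarefree (N / n)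
    · exact Or.inr (ArithmeticFunction.moebius_ne_zero_iff_eq_or.mp
        (ArithmeticFunction.moebius_ne_zero_iff_squarefree.mpr hs))
    · exact Or.inl (ArithmeticFunction.moebius_eq_zero_of_not_squarefree hs)
  rcases hcases with h | h | h <;> simp [h, h0]

lemma genIter_sub_X_monic {n : ℕ} (hn : n ≠ 0) : (genIter n - X).Monic :=
  quadIter_sub_X_monic _ hn

lemma prod_genIter_sub_X_monic (N : ℕ) (k : ℤ) :
    (∏ n ∈ N.divisors with ArithmeticFunction.moebius (N / n) = k, (genIter n - X)).Monic := by
  refine monic_prod_of_monic _ _ fun n hn => genIter_sub_X_monic ?_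
  rintro rfl
  simp at hn

variable {L : Type*} [Field L] {t : L}

variable (t) in
/-- The specialization `ℤ[t] → L` of the parameter. -/
abbrev specialize : ℤ[X] →+* L := eval₂RingHom (Int.castRingHom L) t

lemma map_genIter (n : ℕ) : (genIter n).map (specialize t) = quadIter (C t) X n := by
  rw [genIter, ← coe_mapRingHom, map_quadIter]
  simp

section AlgClosed

variable [DecidableEq L] [IsAlgClosed L]

/-- Möbius inversion of `prod_exactPoly` in the fraction field of `L[X]`, with the denominator
cleared. -/
lemma exactPoly_mul_prod (ht : Transcendental ℤ t) {N : ℕ} (hN : N ≠ 0) :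
    exactPoly t N * ∏ n ∈ N.divisors with ArithmeticFunction.moebius (N / n) = -1,
      (quadIter (C t) X n - X) =
    ∏ n ∈ N.divisors with ArithmeticFunction.moebius (N / n) = 1,
      (quadIter (C t) X n - X : L[X]) := by
  apply IsFractionRing.injective L[X] (FractionRing L[X])
  have h := (ArithmeticFunction.prod_eq_iff_prod_pow_moebius_eq_of_nonzero
    (f := fun n => algebraMap L[X] (FractionRing L[X]) (exactPoly t n))
    (g := fun n => algebraMap L[X] (FractionRing L[X]) (quadIter (C t) X n - X))
    (fun n _ => ?_) (fun n hn => ?_)).mp (fun n hn => ?_) N (Nat.pos_of_ne_zero hN)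
  · rw [map_mul, map_prod, map_prod, ← h]
    refine prod_moebius_split _ fun n hn => ?_
    have hn0 : n ≠ 0 := by rintro rfl; simp at hn
    exact (map_ne_zero_iff _ (IsFractionRing.injective L[X] (FractionRing L[X]))).mpr
      (quadIter_sub_X_monic t hn0).ne_zero
  · simpa using (exactPoly_monic (t := t) n).ne_zero
  · exact (map_ne_zero_iff _ (IsFractionRing.injective L[X] (FractionRing L[X]))).mpr
      (quadIter_sub_X_monic t hn.ne').ne_zero
  · rw [← map_prod, prod_exactPoly ht hn.ne']

lemma map_dynatomic (ht : Transcendental ℤ t) {N : ℕ} (hN : N ≠ 0) :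
    (dynatomic N).map (specialize t) = exactPoly t N := by
  rw [dynatomic, map_divByMonic _ (prod_genIter_sub_X_monic N (-1)), Polynomial.map_prod,
    Polynomial.map_prod]
  simp only [Polynomial.map_sub, map_genIter, map_X]
  rw [← exactPoly_mul_prod ht hN, mul_comm]
  refine mul_divByMonic_cancel_left _ (monic_prod_of_monic _ _ fun n hn => ?_)
  refine quadIter_sub_X_monic t ?_
  rintro rfl
  simp at hn

end AlgClosed

/-- One transcendental specialization is enough to see that the division defining `dynatomic` has a
nonzero quotient. -/
lemma exists_transcendental_complex : ∃ t : ℂ, Transcendental ℤ t :=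
  ⟨algebraMap ℝ ℂ (liouvilleNumber (2 : ℕ)), (transcendental_algebraMap_iff
    (algebraMap ℝ ℂ).injective).mpr (transcendental_liouvilleNumber le_rfl)⟩

lemma dynatomic_monic {N : ℕ} (hN : N ≠ 0) : (dynatomic N).Monic := by
  classical
  have h1 := prod_genIter_sub_X_monic N 1
  have h2 := prod_genIter_sub_X_monic N (-1)
  rw [dynatomic, Monic]
  rw [leadingCoeff_divByMonic_of_monic h2]
  · exact h1
  -- If the divisor had the larger degree, the quotient would be zero, yet it specializes to the
  -- monic `exactPoly`.
  · by_contra! hlt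
    obtain ⟨t, ht⟩ := exists_transcendental_complex
    have h3 := map_dynatomic ht hN
    rw [dynatomic, (divByMonic_eq_zero_iff h2).mpr hlt, Polynomial.map_zero] at h3
    exact (exactPoly_monic _).ne_zero h3.symm

lemma dynatomic_comp_genIter_monic {N : ℕ} (hN : N ≠ 0) (M : ℕ) :
    ((dynatomic N).comp (genIter M)).Monic := by
  refine (dynatomic_monic hN).comp (quadIter_C_X_monic _ M) ?_
  rw [genIter, natDegree_quadIter_C_X]
  positivity

lemma genDynatomic_monic {N : ℕ} (hN : N ≠ 0) (M : ℕ) : (genDynatomic M N).Monic := by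
  cases M with
  | zero => exact dynatomic_monic hN
  | succ M =>
    rw [genDynatomic, Monic, leadingCoeff_divByMonic_of_monic (dynatomic_comp_genIter_monic hN M)]
    · exact dynatomic_comp_genIter_monic hN (M + 1)
    · rw [degree_eq_natDegree (dynatomic_comp_genIter_monic hN M).ne_zero,
        degree_eq_natDegree (dynatomic_comp_genIter_monic hN (M + 1)).ne_zero, Nat.cast_le]
      simp only [natDegree_comp, genIter, natDegree_quadIter_C_X]
      gcongr <;> simp

section AlgClosed

variable [DecidableEq L]

/-- The quadratic map permutes the points `α` of exact period `N`, so the roots may be reindexed as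
`α ^ 2 + t`, and `x ^ 2 - α ^ 2` splits as `(x - α) (x + α)`. The power of `-1` comes from writing
`x + α` as `-(-x - α)`. -/
lemma exactPoly_comp_quad {N : ℕ} (hN : N ≠ 0) :
    (exactPoly t N).comp (X ^ 2 + C t) = exactPoly t N * (exactPoly t N).comp (-X) *
      (-1) ^ (exactPoly t N).natDegree := by
  have hdeg : (exactPoly t N).natDegree = ((quadIter (C t) X N - X : L[X]).roots.toFinset.filter
      (fun α => minimalPeriod (fun y : L => y ^ 2 + t) α = N)).card := by
    rw [exactPoly, natDegree_prod_of_monic _ _ fun α _ => monic_X_sub_C α]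
    simp
  rw [hdeg, ← Finset.prod_const, exactPoly, Polynomial.prod_comp, Polynomial.prod_comp,
    ← Finset.prod_mul_distrib, ← Finset.prod_mul_distrib]
  symm
  refine Finset.prod_bij (fun α _ => α ^ 2 + t) (fun α hα => ?_) (fun α hα β hβ h => ?_)
    (fun β hβ => ?_) (fun α hα => ?_)
  · rw [mem_exactPoints hN] at hα ⊢
    rw [← hα]
    refine minimalPeriod_apply (f := fun y : L => y ^ 2 + t) ?_
    rw [← minimalPeriod_pos_iff_mem_periodicPts]
    omega
  · rw [mem_exactPoints hN] at hα hβ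
    refine (bijOn_ptsOfPeriod (fun y : L => y ^ 2 + t) (Nat.pos_of_ne_zero hN)).injOn
      ?_ ?_ h
    · exact hα ▸ isPeriodicPt_minimalPeriod _ _
    · exact hβ ▸ isPeriodicPt_minimalPeriod _ _
  · rw [mem_exactPoints hN] at hβ
    refine ⟨(fun y : L => y ^ 2 + t)^[N - 1] β, ?_, ?_⟩
    · rw [mem_exactPoints hN, ← hβ]
      refine minimalPeriod_apply_iterate ?_ _
      rw [← minimalPeriod_pos_iff_mem_periodicPts]
      omega
    · refine (iterate_succ_apply' (fun y : L => y ^ 2 + t) (N - 1) β).symm.trans ?_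
      rw [Nat.succ_eq_add_one, Nat.sub_add_cancel (Nat.pos_of_ne_zero hN)]
      exact hβ ▸ isPeriodicPt_minimalPeriod _ _
  · simp only [sub_comp, X_comp, C_comp]
    rw [C_add, C_pow]
    ring

/-- In the factorization of `exactPoly_comp_quad` at `f^M(x)`, the first factor is the divisor in
the definition of `genDynatomic`. What remains is, up to sign, the exact-period polynomial at
`-f^M(x)`. -/
lemma map_genDynatomic_succ [IsAlgClosed L] (ht : Transcendental ℤ t) {N : ℕ} (hN : N ≠ 0) (M : ℕ) :
    (genDynatomic (M + 1) N).map (specialize t) =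
      ((exactPoly t N).comp (-X) * (-1) ^ (exactPoly t N).natDegree).comp (quadIter (C t) X M) := by
  rw [genDynatomic, map_divByMonic _ (dynatomic_comp_genIter_monic hN M), Polynomial.map_comp,
    Polynomial.map_comp, map_dynatomic ht hN, map_genIter, map_genIter, quadIter_succ]
  have h : (exactPoly t N).comp (quadIter (C t) X M ^ 2 + C t) =
      ((exactPoly t N).comp (X ^ 2 + C t)).comp (quadIter (C t) X M) := by
    rw [Polynomial.comp_assoc]; simp
  rw [h, exactPoly_comp_quad hN, mul_assoc, mul_comp]
  refine mul_divByMonic_cancel_left _ ((exactPoly_monic N).comp (quadIter_C_X_monic _ M) ?_)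
  rw [natDegree_quadIter_C_X]
  positivity

end AlgClosed

lemma evalDynatomic_eq_eval (M N : ℕ) (x : L) :
    evalDynatomic M N x t = ((genDynatomic M N).map (specialize t)).eval x := by
  rw [Polynomial.eval_map, evalDynatomic]

lemma map_evalDynatomic {A A' : Type*} [CommRing A] [CommRing A'] (f : A →+* A') (M N : ℕ)
    (x c : A) : f (evalDynatomic M N x c) = evalDynatomic M N (f x) (f c) := by
  rw [evalDynatomic, evalDynatomic, hom_eval₂]
  congr 1
  ext <;> simp

lemma minimalPeriod_quad_map {L' : Type*} [Field L'] (f : L →+* L') (x : L) :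
    minimalPeriod (fun y : L' => y ^ 2 + f t) (f x) = minimalPeriod (fun y : L => y ^ 2 + t) x := by
  refine minimalPeriod_eq_minimalPeriod_iff.mpr fun n => ?_
  change quadIter (f t) (f x) n = f x ↔ quadIter t x n = x
  rw [← map_quadIter, f.injective.eq_iff]

lemma transcendental_algebraicClosure (ht : Transcendental ℤ t) :
    Transcendental ℤ (algebraMap L (AlgebraicClosure L) t) :=
  (transcendental_algebraMap_iff (FaithfulSMul.algebraMap_injective L _)).mpr ht

/-- The zeros of the dynatomic polynomial are the points of exact period `N`. -/
lemma evalDynatomic_zero_eq_zero_iff (ht : Transcendental ℤ t) {N : ℕ} (hN : N ≠ 0) (x : L) :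
    evalDynatomic 0 N x t = 0 ↔ minimalPeriod (fun y : L => y ^ 2 + t) x = N := by
  classical
  rw [← minimalPeriod_quad_map (algebraMap L (AlgebraicClosure L)) x,
    ← map_eq_zero (algebraMap L (AlgebraicClosure L)), map_evalDynatomic, evalDynatomic_eq_eval,
    ← exactPoly_eval_eq_zero_iff hN]
  rw [genDynatomic, map_dynatomic (transcendental_algebraicClosure ht) hN]

/-- The zeros of the generalized dynatomic polynomial with positive preperiod. -/
lemma evalDynatomic_succ_eq_zero_iff (ht : Transcendental ℤ t) {N : ℕ} (hN : N ≠ 0) (M : ℕ)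
    (x : L) : evalDynatomic (M + 1) N x t = 0 ↔
      minimalPeriod (fun y : L => y ^ 2 + t) (-quadIter t x M) = N := by
  classical
  rw [← minimalPeriod_quad_map (algebraMap L (AlgebraicClosure L)),
    ← map_eq_zero (algebraMap L (AlgebraicClosure L)), map_evalDynatomic, evalDynatomic_eq_eval,
    ← exactPoly_eval_eq_zero_iff hN,
    map_genDynatomic_succ (transcendental_algebraicClosure ht) hN, eval_comp, eval_quadIter_C_X,
    map_neg, map_quadIter]
  simp

end Dynatomic

end DynMod
end

noncomputable section

namespace DynMod

open Function

universe v

/-! ### Combinatorics of admissible graphs -/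

section Combinatorics

variable {V : Type v} {G : Digraph V}

lemma IsAdmissible.adj_next (hG : IsAdmissible G) (p : V) : G.Adj p (next G p) := by
  have h : ∃ q, G.Adj p q := (hG.outDegree p).exists
  rw [next, dif_pos h]
  exact h.choose_spec

lemma IsAdmissible.adj_iff (hG : IsAdmissible G) {p q : V} : G.Adj p q ↔ next G p = q :=
  ⟨fun h => (hG.outDegree p).unique (hG.adj_next p) h, fun h => h ▸ hG.adj_next p⟩

lemma IsAdmissible.ncard_fiber (hG : IsAdmissible G) (p : V) :
    {r | next G r = next G p}.ncard = 2 := by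
  have hfin := hG.finite
  have h := hG.inDegree (next G p)
  simp only [hG.adj_iff] at h
  refine h.resolve_left fun h0 => ?_
  rw [Set.ncard_eq_zero] at h0
  exact Set.eq_empty_iff_forall_notMem.mp h0 p rfl

lemma IsAdmissible.exists_isNeg (hG : IsAdmissible G) (p : V) : ∃ q, IsNeg G p q := by
  obtain ⟨q, hq, hqp⟩ := Set.exists_ne_of_one_lt_ncard
    (by rw [hG.ncard_fiber p]; exact one_lt_two : 1 < {r | next G r = next G p}.ncard) p
  exact ⟨q, hqp, hq⟩

lemma IsNeg.symm {p q : V} (h : IsNeg G p q) : IsNeg G q p := ⟨h.1.symm, h.2.symm⟩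

lemma IsAdmissible.eq_or_eq (hG : IsAdmissible G) {p q r : V} (h : IsNeg G p q)
    (hr : next G r = next G p) : r = p ∨ r = q := by
  obtain ⟨a, b, -, hab⟩ := Set.ncard_eq_two.mp (hG.ncard_fiber p)
  have key : ∀ s, next G s = next G p → s = a ∨ s = b := fun s hs => by
    have : s ∈ ({a, b} : Set V) := hab ▸ hs
    simpa using this
  have h1 := h.1
  rcases key p rfl with rfl | rfl <;> rcases key q h.2 with rfl | rfl <;>
    rcases key r hr with rfl | rfl <;> simp_all

lemma IsAdmissible.isNeg_unique (hG : IsAdmissible G) {p q r : V} (h : IsNeg G p q)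
    (h' : IsNeg G p r) : q = r :=
  ((hG.eq_or_eq h h'.2).resolve_left h'.1).symm

lemma IsAdmissible.isNeg_left_iff (hG : IsAdmissible G) {p q r : V} (h : IsNeg G p q) :
    IsNeg G q r ↔ r = p :=
  ⟨fun h' => hG.isNeg_unique h' h.symm, fun h' => h' ▸ h.symm⟩

lemma isNeg_iff {p q : V} : IsNeg G p q ↔ next G p = next G q ∧ p ≠ q :=
  ⟨fun h => ⟨h.2.symm, h.1.symm⟩, fun h => ⟨h.2.symm, h.1.symm⟩⟩

lemma IsAdmissible.exists_iterate_mem_periodicPts (hG : IsAdmissible G) (p : V) :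
    ∃ k, (next G)^[k] p ∈ periodicPts (next G) := by
  have := hG.finite
  obtain ⟨a, b, hab, h⟩ := Finite.exists_ne_map_eq_of_infinite fun k => (next G)^[k] p
  wlog hlt : a < b generalizing a b
  · exact this b a hab.symm h.symm (by omega)
  refine ⟨a, b - a, by omega, ?_⟩
  rw [IsPeriodicPt, IsFixedPt, ← iterate_add_apply, Nat.sub_add_cancel hlt.le]
  exact h.symm

lemma IsAdmissible.iterate_preperiod_mem (hG : IsAdmissible G) (p : V) :
    (next G)^[preperiod G p] p ∈ periodicPts (next G) :=
  Nat.sInf_mem (s := {m | (next G)^[m] p ∈ periodicPts (next G)})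
    (hG.exists_iterate_mem_periodicPts p)

lemma iterate_notMem_of_lt_preperiod {p : V} {k : ℕ} (hk : k < preperiod G p) :
    (next G)^[k] p ∉ periodicPts (next G) :=
  Nat.notMem_of_lt_sInf (s := {m | (next G)^[m] p ∈ periodicPts (next G)}) hk

lemma IsAdmissible.eventualPeriod_pos (hG : IsAdmissible G) (p : V) : 0 < eventualPeriod G p :=
  minimalPeriod_pos_of_mem_periodicPts (hG.iterate_preperiod_mem p)

lemma iterate_mem_fullOrbit (p : V) (k : ℕ) : (next G)^[k] p ∈ fullOrbit G p := ⟨k, Or.inl rfl⟩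

lemma next_mem_fullOrbit {p q : V} (h : q ∈ fullOrbit G p) : next G q ∈ fullOrbit G p := by
  obtain ⟨k, rfl | h⟩ := h
  · exact ⟨k + 1, Or.inl (iterate_succ_apply' _ _ _).symm⟩
  · exact ⟨k + 1, Or.inl (h.2.trans (iterate_succ_apply' _ _ _).symm)⟩

lemma IsAdmissible.mem_fullOrbit_of_next_eq (hG : IsAdmissible G) {p q r : V}
    (h : q ∈ fullOrbit G p) (hr : next G r = next G q) : r ∈ fullOrbit G p := by
  by_cases hrq : r = q
  · exact hrq ▸ h
  obtain ⟨k, rfl | hk⟩ := h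
  · exact ⟨k, Or.inr ⟨hrq, hr⟩⟩
  · rcases hG.eq_or_eq hk (hr.trans hk.2) with rfl | rfl
    · exact ⟨k, Or.inl rfl⟩
    · exact absurd rfl hrq

lemma IsAdmissible.fullOrbit_subset (hG : IsAdmissible G) {p q : V} (h : q ∈ fullOrbit G p) :
    fullOrbit G q ⊆ fullOrbit G p := by
  have hit : ∀ k, (next G)^[k] q ∈ fullOrbit G p := by
    intro k
    induction k with
    | zero => exact h
    | succ k ih => rw [iterate_succ_apply']; exact next_mem_fullOrbit ih
  rintro r ⟨k, rfl | hk⟩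
  · exact hit k
  · exact hG.mem_fullOrbit_of_next_eq (hit k) hk.2

variable {n : ℕ} {P : Fin n → V}

lemma iterate_mem_before {i : Fin n} {q : V} (h : q ∈ before G P i) (k : ℕ) :
    (next G)^[k] q ∈ before G P i := by
  induction k with
  | zero => exact h
  | succ k ih =>
    obtain ⟨j, hj, hk⟩ := ih
    rw [iterate_succ_apply']
    exact ⟨j, hj, next_mem_fullOrbit hk⟩

lemma IsAdmissible.mem_before_of_next_eq (hG : IsAdmissible G) {i : Fin n} {q r : V}
    (h : q ∈ before G P i) (hr : next G r = next G q) : r ∈ before G P i := by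
  obtain ⟨j, hj, hk⟩ := h
  exact ⟨j, hj, hG.mem_fullOrbit_of_next_eq hk hr⟩

lemma exists_mem_newVertices {i : Fin n} {q : V} (h : q ∈ before G P i) :
    ∃ j < i, q ∈ newVertices G P j := by
  induction i using WellFoundedLT.induction with
  | ind i ih =>
    obtain ⟨j, hj, hq⟩ := h
    by_cases hb : q ∈ before G P j
    · obtain ⟨l, hl, hq'⟩ := ih j hj hb
      exact ⟨l, hl.trans hj, hq'⟩
    · exact ⟨j, hj, hq, hb⟩

lemma eq_of_mem_newVertices {i j : Fin n} {q : V} (hi : q ∈ newVertices G P i)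
    (hj : q ∈ newVertices G P j) : i = j := by
  rcases lt_trichotomy i j with h | h | h
  · exact absurd ⟨i, h, hi.1⟩ hj.2
  · exact h
  · exact absurd ⟨j, h, hj.1⟩ hi.2

lemma lt_of_mem_newVertices {i j : Fin n} {q : V} (hi : q ∈ before G P i)
    (hj : q ∈ newVertices G P j) : j < i := by
  obtain ⟨l, hl, hq⟩ := exists_mem_newVertices hi
  rwa [eq_of_mem_newVertices hj hq]

/-- Otherwise the generator `P i` could be dropped: everything it generates is already reached from
`P j`. -/
lemma MinGenerates.notMem_fullOrbit (hP : MinGenerates G P) (hG : IsAdmissible G) {i j : Fin n}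
    (hij : i ≠ j) : P i ∉ fullOrbit G (P j) := by
  intro h
  obtain _ | k := n
  · exact i.elim0
  have := hP.2 k (P ∘ i.succAbove) fun q => ?_
  · omega
  · obtain ⟨l, hl⟩ := hP.1 q
    by_cases hli : l = i
    · obtain ⟨j', rfl⟩ := Fin.exists_succAbove_eq hij.symm
      exact ⟨j', hG.fullOrbit_subset h (hli ▸ hl)⟩
    · obtain ⟨l', rfl⟩ := Fin.exists_succAbove_eq hli
      exact ⟨l', hl⟩

lemma kappa_mem {i : Fin n} (hi : i ∉ disjointIdx G P) :
    (next G)^[kappa G P i] (P i) ∈ before G P i := by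
  have : {k | (next G)^[k] (P i) ∈ before G P i}.Nonempty := by
    simpa [disjointIdx, Set.Nonempty] using hi
  exact Nat.sInf_mem this

lemma notMem_before_of_lt_kappa {i : Fin n} {k : ℕ} (hk : k < kappa G P i) :
    (next G)^[k] (P i) ∉ before G P i :=
  Nat.notMem_of_lt_sInf (s := {k | (next G)^[k] (P i) ∈ before G P i}) hk

lemma MinGenerates.kappa_pos (hP : MinGenerates G P) (hG : IsAdmissible G) {i : Fin n}
    (hi : i ∉ disjointIdx G P) : 0 < kappa G P i := by
  by_contra! h
  have := kappa_mem hi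
  rw [Nat.le_zero.mp h] at this
  obtain ⟨j, hj, h⟩ := this
  exact hP.notMem_fullOrbit hG hj.ne' h

/-- The infimum defining `lam` is attained because the orbit of `P i` enters the earlier vertices at
the negative of an iterate of `P j`. If it entered at `f^l(P j)` itself, then for `l = 0` the
generator `P j` would be redundant, and for `l > 0` the vertex just before entry would share its
image with an earlier vertex, so the orbit would have entered sooner. -/
lemma MinGenerates.lam_spec (hP : MinGenerates G P) (hG : IsAdmissible G) {i j : Fin n}
    (hi : i ∉ disjointIdx G P) (hj : (next G)^[kappa G P i] (P i) ∈ newVertices G P j) :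
    IsNeg G ((next G)^[kappa G P i] (P i)) ((next G)^[lam G P i j] (P j)) := by
  refine Nat.sInf_mem
    (s := {l | IsNeg G ((next G)^[kappa G P i] (P i)) ((next G)^[l] (P j))}) ?_
  have hlt := lt_of_mem_newVertices (kappa_mem hi) hj
  obtain ⟨l, h | h⟩ := hj.1
  · exfalso
    obtain _ | l := l
    · exact hP.notMem_fullOrbit hG hlt.ne 
        ((show (next G)^[kappa G P i] (P i) = P j from h) ▸ iterate_mem_fullOrbit (P i) _)
    · obtain ⟨k, hk⟩ := Nat.exists_eq_succ_of_ne_zero (hP.kappa_pos hG hi).ne'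
      rw [hk, iterate_succ_apply', iterate_succ_apply'] at h
      exact notMem_before_of_lt_kappa (hk ▸ Nat.lt_succ_self k)
        (hG.mem_before_of_next_eq ⟨j, hlt, iterate_mem_fullOrbit (P j) l⟩ h)
  · exact ⟨l, h.symm⟩

/-- Every vertex flows into the orbit of a generator of index in `𝒟`. -/
lemma MinGenerates.exists_root (hP : MinGenerates G P) (hG : IsAdmissible G) (j : Fin n) :
    ∃ i ∈ disjointIdx G P, i ≤ j ∧ ∃ a b, (next G)^[a] (P j) = (next G)^[b] (P i) := by
  induction j using WellFoundedLT.induction with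
  | ind j ih =>
    by_cases hj : j ∈ disjointIdx G P
    · exact ⟨j, hj, le_rfl, 0, 0, rfl⟩
    obtain ⟨l, hl, hnew⟩ := exists_mem_newVertices (kappa_mem hj)
    obtain ⟨i, hi, hil, a, b, hab⟩ := ih l hl
    refine ⟨i, hi, hil.trans hl.le, a + (kappa G P j + 1), lam G P j l + 1 + b, ?_⟩
    have h : (next G)^[kappa G P j + 1] (P j) = (next G)^[lam G P j l + 1] (P l) := by
      rw [iterate_succ_apply', iterate_succ_apply', (hP.lam_spec hG hj hnew).2]
    rw [iterate_add_apply, h, ← iterate_add_apply, add_comm a, iterate_add_apply, hab,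
      ← iterate_add_apply]

/-- Coincidences in the orbit of a point of given portrait. -/
lemma iterate_eq_iterate_iff_of_portrait {X : Type*} {g : X → X} {x : X} {M N : ℕ} (hN : 0 < N)
    (hper : minimalPeriod g (g^[M] x) = N) (hpre : ∀ k < M, g^[k] x ∉ periodicPts g) (a b : ℕ) :
    g^[a] x = g^[b] x ↔ a = b ∨ (M ≤ a ∧ M ≤ b ∧ a ≡ b [MOD N]) := by
  wlog hab : a ≤ b generalizing a b
  · rw [eq_comm, this b a (by omega), Nat.ModEq.comm]
    tauto
  have hmp : ∀ c, M ≤ c → minimalPeriod g (g^[c] x) = N := by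
    intro c hc
    rw [← Nat.sub_add_cancel hc, iterate_add_apply, minimalPeriod_apply_iterate, hper]
    exact minimalPeriod_pos_iff_mem_periodicPts.mp (hper ▸ hN)
  have hb : g^[b] x = g^[b - a] (g^[a] x) := by
    rw [← iterate_add_apply, Nat.sub_add_cancel hab]
  constructor
  · intro h
    rcases hab.eq_or_lt with rfl | hlt
    · exact Or.inl rfl
    have hMa : M ≤ a := by
      by_contra! hlt'
      exact hpre a hlt' ⟨b - a, by omega, (hb ▸ h).symm⟩
    refine Or.inr ⟨hMa, hMa.trans hab, ?_⟩
    rw [Nat.modEq_iff_dvd' hab, ← hmp a hMa]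
    exact IsPeriodicPt.minimalPeriod_dvd (hb ▸ h).symm
  · rintro (rfl | ⟨hMa, hMb, h⟩)
    · rfl
    rw [Nat.modEq_iff_dvd' hab, ← hmp a hMa] at h
    rw [hb]
    exact (isPeriodicPt_iff_minimalPeriod_dvd.mpr h).symm

end Combinatorics

end DynMod
end

noncomputable section

namespace DynMod

open Function

universe v

/-! ### Embeddings of a graph into the dynamical system of a field -/

section Embeddings

variable {V : Type v} {L : Type*} [Field L]

/-- An embedding of the graph `G` into the functional graph of `y ↦ y ^ 2 + t` on `L`. -/
structure IsEmb (G : Digraph V) (t : L) (φ : V → L) : Prop where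
  injective : Injective φ
  map_next : ∀ p, φ (next G p) = φ p ^ 2 + t

/-- The points `(y, t)` where the equations hold and the inequations do not vanish. -/
structure IsSolution (G : Digraph V) {n : ℕ} (P : Fin n → V) (t : L) (y : Fin n → L) : Prop where
  dynatomic_eq : ∀ i ∈ disjointIdx G P,
    evalDynatomic (preperiod G (P i)) (eventualPeriod G (P i)) (y i) t = 0
  attach_eq : ∀ i ∉ disjointIdx G P, ∀ j, (next G)^[kappa G P i] (P i) ∈ newVertices G P j →
    quadIter t (y i) (kappa G P i) + quadIter t (y j) (lam G P i j) = 0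
  cycle_ne : ∀ i ∈ disjointIdx G P, ∀ j ∈ disjointIdx G P, j < i →
    eventualPeriod G (P i) = eventualPeriod G (P j) → ∀ k < eventualPeriod G (P i),
      quadIter t (y i) (preperiod G (P i)) - quadIter t (y j) (preperiod G (P j) + k) ≠ 0

variable {G : Digraph V} {n : ℕ} {P : Fin n → V} {t : L} {y : Fin n → L} {φ : V → L}

lemma IsEmb.map_iterate (h : IsEmb G t φ) (p : V) (k : ℕ) :
    φ ((next G)^[k] p) = quadIter t (φ p) k := by
  induction k with
  | zero => rfl
  | succ k ih => rw [iterate_succ_apply', h.map_next, ih, quadIter_succ]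

lemma IsEmb.map_isNeg (h : IsEmb G t φ) {p q : V} (hpq : IsNeg G p q) : φ q = -φ p := by
  have h1 := congrArg φ hpq.2
  rw [h.map_next, h.map_next, add_left_inj, sq_eq_sq_iff_eq_or_eq_neg] at h1
  exact h1.resolve_left fun h2 => hpq.1 (h.injective h2)

lemma IsEmb.minimalPeriod_map (h : IsEmb G t φ) (p : V) :
    minimalPeriod (fun y : L => y ^ 2 + t) (φ p) = minimalPeriod (next G) p := by
  refine minimalPeriod_eq_minimalPeriod_iff.mpr fun k => ?_
  change quadIter t (φ p) k = φ p ↔ (next G)^[k] p = p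
  rw [← h.map_iterate, h.injective.eq_iff]

lemma IsEmb.isSolution (h : IsEmb G t φ) (ht : Transcendental ℤ t) (hG : IsAdmissible G)
    (hP : MinGenerates G P) : IsSolution G P t (φ ∘ P) where
  dynatomic_eq i _ := by
    have hN := (hG.eventualPeriod_pos (P i)).ne'
    have hper := hG.iterate_preperiod_mem (P i)
    have hev : eventualPeriod G (P i) =
      minimalPeriod (next G) ((next G)^[preperiod G (P i)] (P i)) := rfl
    cases hM : preperiod G (P i) with
    | zero =>
      rw [evalDynatomic_zero_eq_zero_iff ht hN, comp_apply, h.minimalPeriod_map, hev, hM]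
      rfl
    | succ M =>
      rw [hM] at hev hper
      rw [evalDynatomic_succ_eq_zero_iff ht hN, comp_apply, ← h.map_iterate]
      obtain ⟨q, hq⟩ := hG.exists_isNeg ((next G)^[M] (P i))
      rw [← h.map_isNeg hq, h.minimalPeriod_map, hev, iterate_succ_apply', ← hq.2,
        minimalPeriod_apply]
      have hnext : next G q ∈ periodicPts (next G) := by
        rw [hq.2, ← iterate_succ_apply' (next G)]; exact hper
      -- The cycle through `next G q` supplies a periodic preimage. It is `q` or `f^M(P i)`, and the
      -- latter comes too early in the orbit to be periodic.
      obtain ⟨r, hr, hrq⟩ := (bijOn_periodicPts (next G)).surjOn hnext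
      rcases hG.eq_or_eq hq (hrq.trans hq.2) with rfl | rfl
      · exact absurd hr (iterate_notMem_of_lt_preperiod (by omega))
      · exact hr
  attach_eq i hi j hj := by
    rw [comp_apply, comp_apply, ← h.map_iterate, ← h.map_iterate,
      h.map_isNeg (hP.lam_spec hG hi hj), add_neg_cancel]
  cycle_ne i hi j _ hji _ k _ := by
    rw [comp_apply, comp_apply, ← h.map_iterate, ← h.map_iterate, sub_ne_zero, h.injective.ne_iff]
    intro heq
    exact hi _ ⟨j, hji, heq ▸ iterate_mem_fullOrbit (P j) _⟩

lemma two_ne_zero_of_transcendental (ht : Transcendental ℤ t) : (2 : L) ≠ 0 := by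
  intro h
  have := transcendental_iff.mp ht (Polynomial.C 2) (by
    rw [Polynomial.aeval_C]; simpa using h)
  simp at this

/-- An orbit with a repetition that passes through `0` would make the critical point preperiodic. -/
lemma quadIter_ne_zero_of_eq (ht : Transcendental ℤ t) {x : L} {a b : ℕ} (hab : a < b)
    (h : quadIter t x a = quadIter t x b) (c : ℕ) : quadIter t x c ≠ 0 := by
  intro hc
  have h1 : quadIter t 0 a = quadIter t 0 b := by
    rw [← hc, ← quadIter_add, ← quadIter_add, add_comm a, add_comm b, quadIter_add, h,
      ← quadIter_add]
  exact hab.ne (quadIter_zero_injective ht h1)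

/-- A zero of a generalized dynatomic polynomial has the corresponding portrait. -/
lemma portrait_of_evalDynatomic_eq_zero (ht : Transcendental ℤ t) {M N : ℕ} (hN : 0 < N) {x : L}
    (hx : evalDynatomic M N x t = 0) :
    minimalPeriod (fun y : L => y ^ 2 + t) ((fun y : L => y ^ 2 + t)^[M] x) = N ∧
      ∀ k < M, (fun y : L => y ^ 2 + t)^[k] x ∉ periodicPts (fun y : L => y ^ 2 + t) := by
  cases M with
  | zero => simpa [evalDynatomic_zero_eq_zero_iff ht hN.ne'] using hx
  | succ M =>
    rw [evalDynatomic_succ_eq_zero_iff ht hN.ne'] at hx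
    have hmem : -quadIter t x M ∈ periodicPts (fun y : L => y ^ 2 + t) :=
      minimalPeriod_pos_iff_mem_periodicPts.mp (hx ▸ hN)
    have hstep : (fun y : L => y ^ 2 + t)^[M + 1] x =
        (fun y : L => y ^ 2 + t) (-quadIter t x M) := by
      change quadIter t x (M + 1) = _
      simp only [quadIter_succ, neg_sq]
    refine ⟨by rw [hstep, minimalPeriod_apply hmem, hx], fun k hk hper => ?_⟩
    have hper' : quadIter t x M ∈ periodicPts (fun y : L => y ^ 2 + t) := by
      obtain ⟨d, rfl⟩ := Nat.exists_eq_add_of_le (Nat.lt_succ_iff.mp hk)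
      rw [add_comm, quadIter_add]
      exact (bijOn_periodicPts (fun y : L => y ^ 2 + t)).mapsTo.iterate d hper
    -- The map is injective on periodic points and identifies `z` with `-z`; so both being periodic
    -- forces `z = 0`, a periodic critical point.
    have heq : -quadIter t x M = quadIter t x M :=
      (bijOn_periodicPts (fun y : L => y ^ 2 + t)).injOn hmem hper' (by simp)
    have h0 : quadIter t x M = 0 := by
      have : 2 * quadIter t x M = 0 := by linear_combination -heq
      exact (mul_eq_zero.mp this).resolve_left (two_ne_zero_of_transcendental ht)
    rw [h0] at hper'
    obtain ⟨d, hd, hd'⟩ := hper'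
    exact hd.ne (quadIter_zero_injective ht (a₁ := 0) (a₂ := d) hd'.symm)

/-! ### Recovering the graph from a solution of the equations -/

section Solution

/-- The coincidences within a single orbit depend only on its preperiod and eventual period, and the
dynatomic equation gives `y i` those of `P i`. -/
lemma IsSolution.iterate_eq_iff_self (hy : IsSolution G P t y) (ht : Transcendental ℤ t)
    (hG : IsAdmissible G) {i : Fin n} (hi : i ∈ disjointIdx G P) (a b : ℕ) :
    (next G)^[a] (P i) = (next G)^[b] (P i) ↔ quadIter t (y i) a = quadIter t (y i) b := by
  have h := portrait_of_evalDynatomic_eq_zero ht (hG.eventualPeriod_pos (P i))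
    (hy.dynatomic_eq i hi)
  rw [iterate_eq_iterate_iff_of_portrait (hG.eventualPeriod_pos (P i)) rfl
    (fun k hk => iterate_notMem_of_lt_preperiod hk)]
  exact (iterate_eq_iterate_iff_of_portrait (hG.eventualPeriod_pos (P i)) h.1 h.2 a b).symm

lemma IsSolution.attach (hy : IsSolution G P t y) (hG : IsAdmissible G)
    (hP : MinGenerates G P) {i : Fin n} (hi : i ∉ disjointIdx G P) : ∃ j < i, ∃ l,
    IsNeg G ((next G)^[kappa G P i] (P i)) ((next G)^[l] (P j)) ∧
      quadIter t (y i) (kappa G P i) = -quadIter t (y j) l := by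
  obtain ⟨j, hj, hnew⟩ := exists_mem_newVertices (kappa_mem hi)
  exact ⟨j, hj, lam G P i j, hP.lam_spec hG hi hnew,
    eq_neg_of_add_eq_zero_left (hy.attach_eq i hi j hnew)⟩

/-- Each coordinate is preperiodic, directly or through the earlier coordinate it is attached to, so
its orbit avoids the critical point. This keeps `z` and `-z` distinct, as
`isNeg_iff_quadIter_eq_neg` needs. -/
lemma IsSolution.quadIter_ne_zero (hy : IsSolution G P t y) (ht : Transcendental ℤ t)
    (hG : IsAdmissible G) (hP : MinGenerates G P) (i : Fin n) (c : ℕ) : quadIter t (y i) c ≠ 0 := by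
  suffices ∃ a b, a < b ∧ quadIter t (y i) a = quadIter t (y i) b by
    obtain ⟨a, b, hab, h⟩ := this
    exact quadIter_ne_zero_of_eq ht hab h c
  induction i using WellFoundedLT.induction with
  | ind i ih =>
    by_cases hi : i ∈ disjointIdx G P
    · obtain ⟨d, hd, h⟩ := hG.iterate_preperiod_mem (P i)
      refine ⟨preperiod G (P i), d + preperiod G (P i), by omega, ?_⟩
      rw [← hy.iterate_eq_iff_self ht hG hi, iterate_add_apply]
      exact h.symm
    · obtain ⟨j, hj, l, -, hl⟩ := hy.attach hG hP hi
      obtain ⟨a, b, hab, h⟩ := ih j hj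
      have hs : ∀ a, quadIter t (y i) (a + 1 + kappa G P i) = quadIter t (y j) (l + 1 + a) := by
        intro a
        rw [quadIter_add, hl, quadIter_neg _ _ (by simp), ← quadIter_add]
        congr 1; ring
      refine ⟨a + 1 + kappa G P i, b + 1 + kappa G P i, by omega, ?_⟩
      rw [hs, hs, quadIter_add, h, ← quadIter_add]

/-- Compatibility of signs, given compatibility of coincidences. -/
lemma isNeg_iff_quadIter_eq_neg (ht : Transcendental ℤ t) {i j : Fin n} {a b : ℕ}
    (h : (next G)^[a] (P i) = (next G)^[b] (P j) ↔ quadIter t (y i) a = quadIter t (y j) b)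
    (h' : (next G)^[a + 1] (P i) = (next G)^[b + 1] (P j) ↔
      quadIter t (y i) (a + 1) = quadIter t (y j) (b + 1))
    (h0 : quadIter t (y i) a ≠ 0) :
    IsNeg G ((next G)^[a] (P i)) ((next G)^[b] (P j)) ↔
      quadIter t (y j) b = -quadIter t (y i) a := by
  rw [isNeg_iff, ← iterate_succ_apply' (next G), ← iterate_succ_apply' (next G), Ne, h, h',
    quadIter_succ, quadIter_succ, add_left_inj, sq_eq_sq_iff_eq_or_eq_neg]
  constructor
  · rintro ⟨h1, h2⟩
    rw [h1.resolve_left h2, neg_neg]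
  · intro h1
    rw [h1, neg_neg]
    refine ⟨Or.inr rfl, fun h2 => h0 ?_⟩
    have : 2 * quadIter t (y i) a = 0 := by linear_combination h2
    exact (mul_eq_zero.mp this).resolve_left (two_ne_zero_of_transcendental ht)

/-- The forward orbits of two generators of index in `𝒟` stay disjoint in a solution. -/
lemma IsSolution.quadIter_ne_of_mem (hy : IsSolution G P t y) (ht : Transcendental ℤ t)
    (hG : IsAdmissible G) {i j : Fin n} (hi : i ∈ disjointIdx G P) (hj : j ∈ disjointIdx G P)
    (hji : j < i) (a b : ℕ) : quadIter t (y i) a ≠ quadIter t (y j) b := by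
  intro h
  have hpi := (portrait_of_evalDynatomic_eq_zero ht (hG.eventualPeriod_pos (P i))
    (hy.dynatomic_eq i hi)).1
  have hpj := (portrait_of_evalDynatomic_eq_zero ht (hG.eventualPeriod_pos (P j))
    (hy.dynatomic_eq j hj)).1
  have hNi := hG.eventualPeriod_pos (P i)
  have hNj := hG.eventualPeriod_pos (P j)
  have hs : ∀ m, quadIter t (y i) (m + a) = quadIter t (y j) (m + b) := fun m => by
    rw [quadIter_add, h, ← quadIter_add]
  have hmpi : ∀ c, preperiod G (P i) ≤ c → minimalPeriod (fun y : L => y ^ 2 + t)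
      (quadIter t (y i) c) = eventualPeriod G (P i) := by
    intro c hc
    rw [← hpi, ← Nat.sub_add_cancel hc, quadIter_add]
    exact minimalPeriod_apply_iterate (minimalPeriod_pos_iff_mem_periodicPts.mp (hpi ▸ hNi)) _
  have hmpj : ∀ c, preperiod G (P j) ≤ c → minimalPeriod (fun y : L => y ^ 2 + t)
      (quadIter t (y j) c) = eventualPeriod G (P j) := by
    intro c hc
    rw [← hpj, ← Nat.sub_add_cancel hc, quadIter_add]
    exact minimalPeriod_apply_iterate (minimalPeriod_pos_iff_mem_periodicPts.mp (hpj ▸ hNj)) _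
  have hNN : eventualPeriod G (P i) = eventualPeriod G (P j) := by
    rw [← hmpi (preperiod G (P i) + preperiod G (P j) + a) (by omega), hs, hmpj _ (by omega)]
  set N := eventualPeriod G (P i) with hN
  have hle : a + preperiod G (P j) ≤ N * (a + preperiod G (P j)) := Nat.le_mul_of_pos_left _ hNi
  -- Chosen so that `m + a` is `preperiod G (P i)` plus a multiple of `N`, and `m + b` is at least
  -- `preperiod G (P j)`: the meeting point is pushed forward to an instance of an inequation.
  set m := preperiod G (P i) + (N * (a + preperiod G (P j)) - a) with hm
  have h1 : quadIter t (y i) (m + a) = quadIter t (y i) (preperiod G (P i)) := by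
    have : m + a = N * (a + preperiod G (P j)) + preperiod G (P i) := by omega
    rw [this, quadIter_add, quadIter_eq_self_iff, hmpi _ le_rfl]
    exact dvd_mul_right _ _
  have h2 : quadIter t (y j) (m + b) =
      quadIter t (y j) (preperiod G (P j) + (m + b - preperiod G (P j)) % N) := by
    have hdm := Nat.mod_add_div (m + b - preperiod G (P j)) N
    have : m + b = N * ((m + b - preperiod G (P j)) / N) +
        (preperiod G (P j) + (m + b - preperiod G (P j)) % N) := by omega
    conv_lhs => rw [this]
    rw [quadIter_add, quadIter_eq_self_iff, hmpj _ (by omega), ← hNN]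
    exact dvd_mul_right _ _
  exact hy.cycle_ne i hi j hj hji hNN _ (Nat.mod_lt _ hNi)
    (sub_eq_zero.mpr (h1.symm.trans ((hs m).trans h2)))

/-- In a solution, coincidences between iterates of the coordinates are those of the graph. -/
lemma IsSolution.iterate_eq_iff (hy : IsSolution G P t y) (ht : Transcendental ℤ t)
    (hG : IsAdmissible G) (hP : MinGenerates G P) (i j : Fin n) (a b : ℕ) :
    (next G)^[a] (P i) = (next G)^[b] (P j) ↔ quadIter t (y i) a = quadIter t (y j) b := by
  suffices H : ∀ i : Fin n, ∀ j ≤ i, ∀ a b,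
      (next G)^[a] (P i) = (next G)^[b] (P j) ↔ quadIter t (y i) a = quadIter t (y j) b by
    rcases le_total j i with h | h
    · exact H i j h a b
    · rw [eq_comm, H j i h b a, eq_comm]
  clear a b i j
  intro i
  induction i using WellFoundedLT.induction with
  | ind i ih =>
    have ih' : ∀ j < i, ∀ l < i, ∀ a b,
        (next G)^[a] (P j) = (next G)^[b] (P l) ↔ quadIter t (y j) a = quadIter t (y l) b := by
      intro j hj l hl a b
      rcases le_total l j with h | h
      · exact ih j hj l h a b
      · rw [eq_comm, ih l hl j h b a, eq_comm]
    by_cases hi : i ∈ disjointIdx G P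
    · intro j hji a b
      rcases hji.eq_or_lt with rfl | hji
      · exact hy.iterate_eq_iff_self ht hG hi a b
      refine iff_of_false (fun h => hi a ⟨j, hji, h ▸ iterate_mem_fullOrbit (P j) b⟩) fun h => ?_
      -- The inequations only compare generators in `𝒟`, so `j` is replaced by the root `r ≤ j` into
      -- whose orbit it flows.
      obtain ⟨r, hr, hrj, c, d, hcd⟩ := hP.exists_root hG j
      rw [ih' j hji r (hrj.trans_lt hji)] at hcd
      refine hy.quadIter_ne_of_mem ht hG hi hr (hrj.trans_lt hji) (c + a) (b + d) ?_
      rw [quadIter_add, h, ← quadIter_add, add_comm, quadIter_add, hcd, ← quadIter_add]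
    · obtain ⟨j', hj', l, hneg, hl⟩ := hy.attach hG hP hi
      have hκ := hP.kappa_pos hG hi
      have hκmem := kappa_mem hi
      set κ := kappa G P i with hκdef
      have tv : ∀ s, (next G)^[s + 1 + κ] (P i) = (next G)^[s + 1 + l] (P j') := by
        intro s
        rw [iterate_add_apply, iterate_succ_apply, ← hneg.2, ← iterate_succ_apply,
          ← iterate_add_apply]
      have tF : ∀ s, quadIter t (y i) (s + 1 + κ) = quadIter t (y j') (s + 1 + l) := by
        intro s
        rw [quadIter_add, hl, quadIter_neg _ _ (by simp), ← quadIter_add]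
      have mem_of_le : ∀ b, κ ≤ b → (next G)^[b] (P i) ∈ before G P i := by
        intro b hb
        rw [← Nat.sub_add_cancel hb, iterate_add_apply]
        exact iterate_mem_before hκmem _
      -- From time `κ` on, the orbit of `i` follows that of `j'`: up to sign at time `κ` and exactly
      -- afterwards. The induction hypothesis therefore applies, through `isNeg_iff_quadIter_eq_neg`
      -- when `a = κ`.
      have c1 : ∀ j < i, ∀ a b, κ ≤ a →
          ((next G)^[a] (P i) = (next G)^[b] (P j) ↔ quadIter t (y i) a = quadIter t (y j) b) := by
        intro j hj a b ha
        rcases ha.eq_or_lt with rfl | ha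
        · rw [hl, eq_comm (a := (next G)^[κ] (P i)), ← hG.isNeg_left_iff hneg,
            isNeg_iff_quadIter_eq_neg ht (ih' j' hj' j hj l b) (ih' j' hj' j hj (l + 1) (b + 1))
              (hy.quadIter_ne_zero ht hG hP j' l), eq_comm]
        · obtain ⟨s, rfl⟩ := Nat.exists_eq_add_of_lt ha
          rw [show κ + s + 1 = s + 1 + κ by ring, tv, tF, ih' j' hj' j hj]
      have c2 : ∀ a b, κ ≤ a → κ ≤ b →
          ((next G)^[a] (P i) = (next G)^[b] (P i) ↔ quadIter t (y i) a = quadIter t (y i) b) := by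
        intro a b ha hb
        rcases hb.eq_or_lt with rfl | hb
        · rcases ha.eq_or_lt with rfl | ha
          · simp
          · obtain ⟨s, rfl⟩ := Nat.exists_eq_add_of_lt ha
            rw [show κ + s + 1 = s + 1 + κ by ring, tv, tF, eq_comm, c1 j' hj' _ _ le_rfl, eq_comm]
        · obtain ⟨s, rfl⟩ := Nat.exists_eq_add_of_lt hb
          rw [show κ + s + 1 = s + 1 + κ by ring, tv, tF, c1 j' hj' _ _ ha]
      obtain ⟨κ₀, hκ₀⟩ := Nat.exists_eq_succ_of_ne_zero hκ.ne'
      have notMem : ∀ k < κ, (next G)^[k] (P i) ∉ before G P i := fun k hk =>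
        notMem_before_of_lt_kappa hk
      -- A meeting before time `κ` persists to time `κ`, where `c1` transfers it to the graph. Since
      -- `κ - a` is positive, one step can be undone on both sides; then `f^{κ-1}(P i)` has the same
      -- image as an earlier vertex and is itself earlier, against the minimality of `κ`.
      have c3 : ∀ j < i, ∀ a b, a < κ → quadIter t (y i) a ≠ quadIter t (y j) b := by
        intro j hj a b ha h
        have h1 : quadIter t (y i) κ = quadIter t (y j) (κ - a + b) := by
          rw [quadIter_add, ← h, ← quadIter_add, Nat.sub_add_cancel ha.le]
        rw [← c1 j hj _ _ le_rfl, hκ₀, show κ₀.succ - a + b = κ₀ - a + b + 1 by omega,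
          iterate_succ_apply', iterate_succ_apply'] at h1
        exact notMem κ₀ (by omega)
          (hG.mem_before_of_next_eq ⟨j, hj, iterate_mem_fullOrbit (P j) _⟩ h1)
      have c4 : ∀ a b, a < κ → κ ≤ b → quadIter t (y i) a ≠ quadIter t (y i) b := by
        intro a b ha hb h
        have h1 : quadIter t (y i) κ = quadIter t (y i) (κ - a + b) := by
          rw [quadIter_add, ← h, ← quadIter_add, Nat.sub_add_cancel ha.le]
        rw [← c2 _ _ le_rfl (by omega), hκ₀, show κ₀.succ - a + b = κ₀ - a + b + 1 by omega,
          iterate_succ_apply', iterate_succ_apply'] at h1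
        exact notMem κ₀ (by omega) (hG.mem_before_of_next_eq (mem_of_le _ (by omega)) h1)
      have c5 : ∀ a b, a < b → b < κ → ((next G)^[a] (P i) = (next G)^[b] (P i) ↔
          quadIter t (y i) a = quadIter t (y i) b) := by
        intro a b hab hb
        refine iff_of_false (fun h => ?_) fun h => ?_
        · refine notMem (κ - b + a) (by omega) ?_
          rw [iterate_add_apply, h, ← iterate_add_apply, Nat.sub_add_cancel hb.le]
          exact hκmem
        -- Moving both times forward by `κ - b` turns the repetition into one between a time before
        -- `κ` and `κ` itself.
        · refine c4 (κ - b + a) κ (by omega) le_rfl ?_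
          rw [quadIter_add, h, ← quadIter_add, Nat.sub_add_cancel hb.le]
      intro j hji a b
      rcases hji.eq_or_lt with rfl | hji
      · rcases lt_or_ge a κ with ha | ha <;> rcases lt_or_ge b κ with hb | hb
        · rcases lt_trichotomy a b with hab | rfl | hab
          · exact c5 a b hab hb
          · simp
          · rw [eq_comm, c5 b a hab ha, eq_comm]
        · exact iff_of_false (fun h => notMem a ha (h ▸ mem_of_le b hb)) (c4 a b ha hb)
        · exact iff_of_false (fun h => notMem b hb (h ▸ mem_of_le a ha)) (c4 b a hb ha).symm
        · exact c2 a b ha hb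
      · rcases lt_or_ge a κ with ha | ha
        · exact iff_of_false (fun h => notMem a ha ⟨j, hji, h ▸ iterate_mem_fullOrbit (P j) b⟩)
            (c3 j hji a b ha)
        · exact c1 j hji a b ha

/-- Every solution comes from an embedding of the graph. -/
lemma IsSolution.exists_isEmb (hy : IsSolution G P t y) (ht : Transcendental ℤ t)
    (hG : IsAdmissible G) (hP : MinGenerates G P) : ∃ φ : V → L, IsEmb G t φ ∧ φ ∘ P = y := by
  have hE := hy.iterate_eq_iff ht hG hP
  have hS : ∀ i j a b, IsNeg G ((next G)^[a] (P i)) ((next G)^[b] (P j)) ↔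
      quadIter t (y j) b = -quadIter t (y i) a := fun i j a b =>
    isNeg_iff_quadIter_eq_neg ht (hE i j a b) (hE i j _ _) (hy.quadIter_ne_zero ht hG hP i a)
  -- The graph of the embedding, generated by sending `±f^k(P i)` to `±f^k(y i)`. The claim `hΓ`
  -- says that it is single-valued and injective at once.
  let Γ : V → L → Prop := fun p a => ∃ i k, (p = (next G)^[k] (P i) ∧ a = quadIter t (y i) k) ∨
    (IsNeg G ((next G)^[k] (P i)) p ∧ a = -quadIter t (y i) k)
  have hΓ : ∀ p q a b, Γ p a → Γ q b → (p = q ↔ a = b) := by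
    rintro p q a b ⟨i, k, ⟨rfl, rfl⟩ | ⟨hp, rfl⟩⟩ ⟨j, l, ⟨rfl, rfl⟩ | ⟨hq, rfl⟩⟩
    · exact hE i j k l
    · rw [← hS, ← hG.isNeg_left_iff hq.symm]
    · rw [eq_comm, eq_comm (a := -_), ← hS, ← hG.isNeg_left_iff hp.symm]
    · rw [neg_inj, ← hE i j k l]
      constructor
      · rintro rfl
        exact hG.isNeg_unique hp.symm hq.symm
      · intro h
        rw [h] at hp
        exact hG.isNeg_unique hp hq
  have htot : ∀ p, ∃ a, Γ p a := by
    intro p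
    obtain ⟨i, k, h | h⟩ := hP.1 p
    · exact ⟨_, i, k, Or.inl ⟨h, rfl⟩⟩
    · exact ⟨_, i, k, Or.inr ⟨h, rfl⟩⟩
  choose φ hφ using htot
  refine ⟨φ, ⟨fun p q h => (hΓ p q _ _ (hφ p) (hφ q)).mpr h, fun p => ?_⟩, funext fun i => ?_⟩
  · refine (hΓ _ _ _ _ (hφ _) ?_).mp rfl
    obtain ⟨i, k, ⟨h, h'⟩ | ⟨h, h'⟩⟩ := hφ p
    · refine ⟨i, k + 1, Or.inl ⟨?_, ?_⟩⟩
      · rw [iterate_succ_apply', ← h]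
      · rw [quadIter_succ, ← h']
    · refine ⟨i, k + 1, Or.inl ⟨?_, ?_⟩⟩
      · rw [iterate_succ_apply', h.2]
      · rw [quadIter_succ, h', neg_sq]
  · exact (hΓ _ _ _ _ (hφ _) ⟨i, 0, Or.inl ⟨rfl, rfl⟩⟩).mp rfl

end Solution

end Embeddings

end DynMod
end

noncomputable section

namespace DynMod

open Function

universe u v

/-! ### Triangular systems of monic equations -/

section Triangular

open Polynomial

variable {A : Type u} [CommRing A] {n : ℕ}

/-- A triangular system of monic equations has a universal solution in a flat algebra. -/
lemma exists_flat_universal_solution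
    (p : ∀ (R : Type u) [CommRing R] [Algebra A R], (Fin n → R) → Fin n → R[X])
    (monic : ∀ (R : Type u) [CommRing R] [Algebra A R] (x : Fin n → R) (i), (p R x i).Monic)
    (map_eq : ∀ (R F : Type u) [CommRing R] [Algebra A R] [CommRing F] [Algebra A F]
      (h : R →ₐ[A] F) (x : Fin n → R) (i), (p R x i).map (h : R →+* F) = p F (h ∘ x) i)
    (congr : ∀ (R : Type u) [CommRing R] [Algebra A R] (x x' : Fin n → R) (i),
      (∀ j < i, x j = x' j) → p R x i = p R x' i) (k : ℕ) (hk : k ≤ n) :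
    ∃ (R : Type u) (_ : CommRing R) (_ : Algebra A R) (x : Fin n → R), Module.Flat A R ∧
      (∀ i : Fin n, i.val < k → (p R x i).eval (x i) = 0) ∧
      ∀ (F : Type u) [CommRing F] [Algebra A F] (y : Fin n → F),
        (∀ i : Fin n, i.val < k → (p F y i).eval (y i) = 0) →
        ∃ h : R →ₐ[A] F, ∀ i : Fin n, i.val < k → h (x i) = y i := by
  induction k with
  | zero =>
    exact ⟨A, inferInstance, inferInstance, 0, inferInstance, fun i hi => absurd hi (by simp),
      fun F _ _ y _ => ⟨Algebra.ofId A F, fun i hi => absurd hi (by simp)⟩⟩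
  | succ k ih =>
    obtain ⟨R, _, _, x, hflat, hx, huniv⟩ := ih (by omega)
    let i₀ : Fin n := ⟨k, by omega⟩
    let q := p R x i₀
    have hq : q.Monic := monic R x i₀
    let ofA : R →ₐ[A] AdjoinRoot q := IsScalarTower.toAlgHom A R (AdjoinRoot q)
    have hlt : ∀ i : Fin n, i.val < k + 1 → i.val < k ∨ i = i₀ := by
      intro i hi
      rcases Nat.lt_succ_iff_lt_or_eq.mp hi with h | h
      · exact Or.inl h
      · exact Or.inr (Fin.ext h)
    have hne : ∀ i : Fin n, i.val < k → i ≠ i₀ := fun i hi h => by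
      rw [h] at hi; exact absurd hi (lt_irrefl _)
    -- The new root becomes coordinate `k`. The values at later indices are irrelevant, because the
    -- polynomials treated so far only involve earlier coordinates.
    let x' : Fin n → AdjoinRoot q := Function.update (ofA ∘ x) i₀ (AdjoinRoot.root q)
    have hx' : ∀ i : Fin n, i.val ≤ k → p (AdjoinRoot q) x' i = (p R x i).map (AdjoinRoot.of q) := by
      intro i hi
      refine (congr _ _ (ofA ∘ x) i fun j hj => ?_).trans (map_eq R _ ofA x i).symm
      exact Function.update_of_ne (hne j (by have : j.val < i.val := hj; omega)) _ _
    refine ⟨AdjoinRoot q, inferInstance, inferInstance, x', ?_, fun i hi => ?_,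
      fun F _ _ y hy => ?_⟩
    · have : Module.Free R (AdjoinRoot q) := .of_basis (AdjoinRoot.powerBasis' hq).basis
      exact Module.Flat.trans A R (AdjoinRoot q)
    · rcases hlt i hi with h | rfl
      · rw [hx' i h.le, show x' i = AdjoinRoot.of q (x i) from
          Function.update_of_ne (hne i h) _ _, Polynomial.eval_map, eval₂_at_apply, hx i h, map_zero]
      · rw [hx' i₀ le_rfl, show x' i₀ = AdjoinRoot.root q from Function.update_self _ _ _,
          Polynomial.eval_map]
        exact AdjoinRoot.eval₂_root q
    · obtain ⟨h, hh⟩ := huniv F y fun i hi => hy i (by omega)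
      have hroot : q.eval₂ (h : R →+* F) (y i₀) = 0 := by
        rw [← Polynomial.eval_map, map_eq R F h x i₀, congr F (h ∘ x) y i₀ fun j hj => hh j hj]
        exact hy i₀ (Nat.lt_succ_self k)
      refine ⟨AdjoinRoot.liftAlgHom q h (y i₀) hroot, fun i hi => ?_⟩
      rcases hlt i hi with h' | rfl
      · rw [show x' i = AdjoinRoot.of q (x i) from Function.update_of_ne (hne i h') _ _,
          AdjoinRoot.liftAlgHom_of, hh i h']
      · rw [show x' i₀ = AdjoinRoot.root q from Function.update_self _ _ _,
          AdjoinRoot.liftAlgHom_root]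

end Triangular

/-! ### The ideal of the affine curve -/

section Equations

open Polynomial

variable {V : Type v} (G : Digraph V) {n : ℕ} (P : Fin n → V)

open Classical in
/-- The index `j` with `f^{κ_i}(P_i)` a new vertex of the `j`-th orbit. -/
def attachIdx (i : Fin n) : Fin n :=
  if h : ∃ j, (next G)^[kappa G P i] (P i) ∈ newVertices G P j then h.choose else i

variable {G P}

lemma attachIdx_spec {i : Fin n} (hi : i ∉ disjointIdx G P) :
    (next G)^[kappa G P i] (P i) ∈ newVertices G P (attachIdx G P i) := by
  obtain ⟨j, -, hj⟩ := exists_mem_newVertices (kappa_mem hi)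
  have h : ∃ j, (next G)^[kappa G P i] (P i) ∈ newVertices G P j := ⟨j, hj⟩
  rw [attachIdx, dif_pos h]
  exact h.choose_spec

lemma attachIdx_lt {i : Fin n} (hi : i ∉ disjointIdx G P) : attachIdx G P i < i :=
  lt_of_mem_newVertices (kappa_mem hi) (attachIdx_spec hi)

variable (G P)

open Classical in
/-- The `i`-th equation, as a polynomial in `x_i` over a ring containing the other coordinates. -/
def eqnPoly {R : Type*} [CommRing R] (t : R) (x : Fin n → R) (i : Fin n) : R[X] :=
  if i ∈ disjointIdx G P then (genDynatomic (preperiod G (P i)) (eventualPeriod G (P i))).map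
    (eval₂RingHom (Int.castRingHom R) t)
  else quadIter (C t) X (kappa G P i) + C (quadIter t (x (attachIdx G P i))
    (lam G P i (attachIdx G P i)))

variable {G P}

lemma eqnPoly_monic (hG : IsAdmissible G) {R : Type*} [CommRing R] (t : R) (x : Fin n → R)
    (i : Fin n) : (eqnPoly G P t x i).Monic := by
  nontriviality R
  rw [eqnPoly]
  split_ifs
  · exact (genDynatomic_monic (hG.eventualPeriod_pos (P i)).ne' _).map _
  · refine (quadIter_C_X_monic t _).add_of_left (degree_lt_degree ?_)
    rw [natDegree_C, natDegree_quadIter_C_X]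
    positivity

lemma map_eqnPoly {R F : Type*} [CommRing R] [CommRing F] (h : R →+* F) (t : R) (x : Fin n → R)
    (i : Fin n) : (eqnPoly G P t x i).map h = eqnPoly G P (h t) (h ∘ x) i := by
  rw [eqnPoly, eqnPoly]
  split_ifs
  · rw [Polynomial.map_map]
    congr 1
    ext <;> simp
  · rw [Polynomial.map_add, map_C, map_quadIter, ← coe_mapRingHom, map_quadIter]
    simp

lemma eqnPoly_congr {R : Type*} [CommRing R] (t : R) (x x' : Fin n → R)
    (i : Fin n) (h : ∀ j < i, x j = x' j) : eqnPoly G P t x i = eqnPoly G P t x' i := by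
  rw [eqnPoly, eqnPoly]
  split_ifs with hi
  · rfl
  · rw [h _ (attachIdx_lt hi)]

lemma eqnPoly_eval_of_mem {R : Type*} [CommRing R] (t : R) (x : Fin n → R)
    {i : Fin n} (hi : i ∈ disjointIdx G P) : (eqnPoly G P t x i).eval (x i) =
      evalDynatomic (preperiod G (P i)) (eventualPeriod G (P i)) (x i) t := by
  rw [eqnPoly, if_pos hi, Polynomial.eval_map, evalDynatomic]

lemma eqnPoly_eval_of_notMem {R : Type*} [CommRing R] (t : R) (x : Fin n → R)
    {i : Fin n} (hi : i ∉ disjointIdx G P) : (eqnPoly G P t x i).eval (x i) =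
      quadIter t (x i) (kappa G P i) + quadIter t (x (attachIdx G P i))
        (lam G P i (attachIdx G P i)) := by
  rw [eqnPoly, if_neg hi, eval_add, eval_C, eval_quadIter_C_X]

variable {K : Type u} [Field K]

lemma equations_eq : equations K G P =
    Set.range fun i => (eqnPoly G P (tvar K n) (xvar K) i).eval (xvar K i) := by
  ext q
  constructor
  · rintro (⟨i, hi, rfl⟩ | ⟨i, hi, j, hj, rfl⟩)
    · exact ⟨i, eqnPoly_eval_of_mem _ _ hi⟩
    · refine ⟨i, ?_⟩
      rw [eq_of_mem_newVertices hj (attachIdx_spec hi)]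
      exact eqnPoly_eval_of_notMem _ _ hi
  · rintro ⟨i, rfl⟩
    by_cases hi : i ∈ disjointIdx G P
    · exact Or.inl ⟨i, hi, eqnPoly_eval_of_mem _ _ hi⟩
    · exact Or.inr ⟨i, hi, _, attachIdx_spec hi, eqnPoly_eval_of_notMem _ _ hi⟩

lemma map_eqnPoly_eval {R F : Type*} [CommRing R] [CommRing F] (h : R →+* F) (t : R)
    (x : Fin n → R) (i : Fin n) : h ((eqnPoly G P t x i).eval (x i)) =
      (eqnPoly G P (h t) (h ∘ x) i).eval ((h ∘ x) i) := by
  rw [← map_eqnPoly, comp_apply, eval_map_apply]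

lemma map_equations_eq_zero_iff {F : Type*} [CommRing F] (h : CoordRing K n →+* F) :
    (∀ q ∈ equations K G P, h q = 0) ↔
      ∀ i, (eqnPoly G P (h (tvar K n)) (h ∘ xvar K) i).eval ((h ∘ xvar K) i) = 0 := by
  rw [equations_eq, Set.forall_mem_range]
  simp only [map_eqnPoly_eval]

lemma isSolution_iff {L : Type*} [Field L] (h : CoordRing K n →+* L) :
    IsSolution G P (h (tvar K n)) (h ∘ xvar K) ↔
      (∀ q ∈ equations K G P, h q = 0) ∧ ∀ q ∈ inequations K G P, h q ≠ 0 := by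
  constructor
  · intro H
    refine ⟨?_, ?_⟩
    · rintro q (⟨i, hi, rfl⟩ | ⟨i, hi, j, hj, rfl⟩)
      · rw [map_evalDynatomic]
        exact H.dynatomic_eq i hi
      · rw [map_add, map_quadIter, map_quadIter]
        exact H.attach_eq i hi j hj
    · rintro q ⟨i, hi, j, hj, hji, hN, k, hk, rfl⟩
      rw [map_sub, map_quadIter, map_quadIter]
      exact H.cycle_ne i hi j hj hji hN k hk
  · rintro ⟨H1, H2⟩
    refine ⟨fun i hi => ?_, fun i hi j hj => ?_, fun i hi j hj hji hN k hk => ?_⟩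
    · rw [comp_apply, ← map_evalDynatomic]
      exact H1 _ (Or.inl ⟨i, hi, rfl⟩)
    · rw [comp_apply, comp_apply, ← map_quadIter, ← map_quadIter, ← map_add]
      exact H1 _ (Or.inr ⟨i, hi, j, hj, rfl⟩)
    · rw [comp_apply, comp_apply, ← map_quadIter, ← map_quadIter, ← map_sub]
      exact H2 _ ⟨i, hi, j, hj, hji, hN, k, hk, rfl⟩

lemma mem_openLocus_ker {L : Type*} [Field L] (h : CoordRing K n →+* L) :
    (⟨RingHom.ker h, RingHom.ker_isPrime h⟩ : PrimeSpectrum (CoordRing K n)) ∈ openLocus K G P ↔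
      IsSolution G P (h (tvar K n)) (h ∘ xvar K) := by
  rw [isSolution_iff]
  rfl

end Equations

/-! ### The parameter line -/

section Param

/-- The coordinate ring `K[t]` of the parameter line. -/
abbrev ParamRing (K : Type u) [Field K] : Type u := MvPolynomial Unit K

variable (K : Type u) [Field K] (n : ℕ)

instance paramAlgebra : Algebra (ParamRing K) (CoordRing K n) :=
  (MvPolynomial.rename (R := K) (fun _ : Unit => (none : Option (Fin n)))).toRingHom.toAlgebra

lemma algebraMap_paramRing : algebraMap (ParamRing K) (CoordRing K n) =
    (MvPolynomial.rename (R := K) (fun _ : Unit => (none : Option (Fin n)))).toRingHom := rfl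

instance : IsScalarTower K (ParamRing K) (CoordRing K n) :=
  .of_algebraMap_eq' (by ext; simp [algebraMap_paramRing])

@[simp] lemma algebraMap_paramRing_X :
    algebraMap (ParamRing K) (CoordRing K n) (MvPolynomial.X ()) = tvar K n := by
  simp [algebraMap_paramRing]

variable {K n}

lemma transcendental_iff_injective_paramRing {R : Type*} [CommRing R] [Algebra K R]
    (h : ParamRing K →ₐ[K] R) : Transcendental K (h (MvPolynomial.X ())) ↔ Injective h := by
  rw [← algebraicIndependent_unique_type_iff (ι := Unit) (x := fun _ => h (MvPolynomial.X ())),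
    AlgebraicIndependent]
  congr! 2
  ext
  simp

end Param

end DynMod
end

noncomputable section

namespace DynMod

open Function

universe u v

/-! ### The ideal of the affine curve and its finiteness over the parameter line -/

section Ideal

variable {K : Type u} [Field K] {V : Type v} {G : Digraph V} {n : ℕ} {P : Fin n → V}

lemma transcendental_int [CharZero K] {L : Type*} [Field L] [Algebra K L] {t : L}
    (ht : Transcendental K t) : Transcendental ℤ t :=
  ht.restrictScalars (R := ℤ) (RingHom.injective_int (algebraMap ℤ K))

/-- Every point of the open locus has a generization there that dominates the parameter line. -/
lemma exists_generization (hG : IsAdmissible G) {p : PrimeSpectrum (CoordRing K n)}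
    (hp : p ∈ openLocus K G P) : ∃ p' ∈ openLocus K G P, p'.asIdeal ≤ p.asIdeal ∧
      Injective (algebraMap (ParamRing K) (CoordRing K n ⧸ p'.asIdeal)) := by
  let A := ParamRing K
  obtain ⟨R, _, _, x, hflat, hx, huniv⟩ := exists_flat_universal_solution (A := A) (n := n)
    (fun R _ _ x i => eqnPoly G P (algebraMap A R (MvPolynomial.X ())) x i)
    (fun R _ _ x i => eqnPoly_monic hG _ x i)
    (fun R F _ _ _ _ h x i => by
      rw [map_eqnPoly]
      congr 1
      exact h.commutes _)
    (fun R _ _ x x' i h => eqnPoly_congr _ x x' i h) n le_rfl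
  let F := CoordRing K n ⧸ p.asIdeal
  have hzero : ∀ q ∈ equations K G P, Ideal.Quotient.mk p.asIdeal q = 0 := fun q hq =>
    Ideal.Quotient.eq_zero_iff_mem.mpr (hp.1 hq)
  obtain ⟨h, hh⟩ := huniv F (Ideal.Quotient.mk p.asIdeal ∘ xvar K) fun i _ => by
    have := (map_equations_eq_zero_iff _).mp hzero i
    rwa [← algebraMap_paramRing_X] at this
  have hh' : ∀ i, h (x i) = Ideal.Quotient.mk p.asIdeal (xvar K i) := fun i => hh i i.2
  let σ : CoordRing K n →+* R := MvPolynomial.eval₂Hom ((algebraMap A R).comp MvPolynomial.C)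
    fun o => o.elim (algebraMap A R (MvPolynomial.X ())) x
  have hσt : σ (tvar K n) = algebraMap A R (MvPolynomial.X ()) := by simp [σ]
  have hσx : ⇑σ ∘ xvar K = x := by ext i; simp [σ]
  have hσA : ∀ a : A, σ (algebraMap A (CoordRing K n) a) = algebraMap A R a := by
    intro a
    have : σ.comp (algebraMap A (CoordRing K n)) = algebraMap A R := by
      refine MvPolynomial.ringHom_ext (fun c => ?_) fun i => ?_
      · simp [σ, A, algebraMap_paramRing]
      · rw [RingHom.comp_apply, algebraMap_paramRing_X, hσt]
    exact congr($this a)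
  have hcomp : (h : R →+* F).comp σ = Ideal.Quotient.mk p.asIdeal := by
    refine MvPolynomial.ringHom_ext (fun c => ?_) fun o => ?_
    · have h1 : (MvPolynomial.C c : CoordRing K n) =
          algebraMap A (CoordRing K n) (MvPolynomial.C c) := by simp [A, algebraMap_paramRing]
      rw [h1, RingHom.comp_apply, hσA, RingHom.coe_coe, h.commutes]
      rfl
    · cases o with
      | none =>
        rw [RingHom.comp_apply, hσt, RingHom.coe_coe, h.commutes]
        exact congrArg (Ideal.Quotient.mk p.asIdeal) (algebraMap_paramRing_X K n)
      | some i =>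
        rw [RingHom.comp_apply, ← hh' i, ← hσx]
        rfl
  have hprime : (RingHom.ker h).IsPrime := RingHom.ker_isPrime h
  -- Going-down for the flat algebra `R` over `K[t]`: below the prime of the given point there is
  -- one that contracts to zero. The inequations survive, because passing to a smaller prime only
  -- removes elements.
  obtain ⟨Q, hQ, hQp, hQb⟩ := Ideal.exists_ideal_le_liesOver_of_le (R := A) (S := R) (p := ⊥)
    (q := (RingHom.ker h).under A) (RingHom.ker h) bot_le
  have hle : Q.comap σ ≤ p.asIdeal := by
    intro s hs
    have h1 : h (σ s) = 0 := hQ hs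
    rw [← Ideal.Quotient.eq_zero_iff_mem, ← hcomp]
    exact h1
  refine ⟨⟨Q.comap σ, inferInstance⟩, ⟨fun q hq => ?_, fun q hq hmem => hp.2 q hq (hle hmem)⟩,
    hle, ?_⟩
  · change σ q ∈ Q
    have := (map_equations_eq_zero_iff (G := G) (P := P) σ).mpr (fun i => by
      rw [hσx, hσt]; exact hx i i.2) q hq
    rw [this]
    exact Q.zero_mem
  · rw [injective_iff_map_eq_zero]
    intro a ha
    have h1 : algebraMap A (CoordRing K n) a ∈ Q.comap σ := Ideal.Quotient.eq_zero_iff_mem.mp ha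
    rw [Ideal.mem_comap, hσA] at h1
    have h2 : a ∈ Q.under A := h1
    rw [← Ideal.over_def Q (⊥ : Ideal A)] at h2
    exact h2

variable (K G P) in
/-- The ideal of the affine curve `Y_1(G)`. -/
abbrev Y1Ideal : Ideal (CoordRing K n) := PrimeSpectrum.vanishingIdeal (closure (openLocus K G P))

lemma mem_Y1Ideal {s : CoordRing K n} :
    s ∈ Y1Ideal K G P ↔ ∀ p ∈ openLocus K G P, s ∈ p.asIdeal := by
  rw [Y1Ideal, PrimeSpectrum.vanishingIdeal_closure, PrimeSpectrum.mem_vanishingIdeal]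

/-- Evaluation of polynomials at a point `(y, t)`. -/
abbrev evalPt {L : Type*} [CommRing L] [Algebra K L] (t : L) (y : Fin n → L) :
    CoordRing K n →ₐ[K] L := MvPolynomial.aeval fun o => o.elim t y

@[simp] lemma evalPt_tvar {L : Type*} [CommRing L] [Algebra K L] (t : L) (y : Fin n → L) :
    evalPt t y (tvar K n) = t := by simp [evalPt]

@[simp] lemma evalPt_comp_xvar {L : Type*} [CommRing L] [Algebra K L] (t : L) (y : Fin n → L) :
    evalPt t y ∘ xvar K = y := by ext; simp [evalPt]

lemma evalPt_eta {L : Type*} [CommRing L] [Algebra K L] (h : CoordRing K n →ₐ[K] L) :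
    evalPt (h (tvar K n)) (h ∘ xvar K) = h := by
  ext o
  cases o <;> simp [evalPt]

instance isReduced_Y1Ring : IsReduced (Y1Ring K G P) :=
  (Ideal.isRadical_iff_quotient_reduced _).mp (PrimeSpectrum.isRadical_vanishingIdeal _)

lemma evalPt_algebraMap_ne_zero {L : Type*} [Field L] [Algebra K L] {t : L}
    (ht : Transcendental K t) (y : Fin n → L) {a : ParamRing K} (ha : a ≠ 0) :
    evalPt t y (algebraMap (ParamRing K) (CoordRing K n) a) ≠ 0 := by
  have h := (transcendental_iff_injective_paramRing
    ((evalPt t y).comp (IsScalarTower.toAlgHom K (ParamRing K) (CoordRing K n)))).mp (by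
      simpa using ht)
  exact (map_ne_zero_iff _ h).mpr ha

variable [CharZero K]

/-- The ideal of `Y_1(G)` consists of the polynomials vanishing at all embeddings of `G`, over all
fields with a transcendental parameter. -/
lemma mem_Y1Ideal_iff (hG : IsAdmissible G) (hP : MinGenerates G P) {s : CoordRing K n} :
    s ∈ Y1Ideal K G P ↔ ∀ (L : Type u) [Field L] [Algebra K L] (t : L), Transcendental K t →
      ∀ φ : V → L, IsEmb G t φ → evalPt t (φ ∘ P) s = 0 := by
  rw [mem_Y1Ideal]
  constructor
  · intro h L _ _ t ht φ hφ
    refine h ⟨RingHom.ker (evalPt t (φ ∘ P)).toRingHom, RingHom.ker_isPrime _⟩ ?_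
    rw [mem_openLocus_ker]
    have := hφ.isSolution (transcendental_int ht) hG hP
    simpa using this
  · intro h p hp
    obtain ⟨p', hp', hle, hinj⟩ := exists_generization hG hp
    refine hle ?_
    -- The residue field of the generization. Its tautological point solves the system with
    -- transcendental parameter, so it comes from an embedding.
    let L := FractionRing (CoordRing K n ⧸ p'.asIdeal)
    let ψ : CoordRing K n →ₐ[K] L := (IsScalarTower.toAlgHom K (CoordRing K n ⧸ p'.asIdeal) L).comp
      (Ideal.Quotient.mkₐ K p'.asIdeal)
    have hker : RingHom.ker ψ.toRingHom = p'.asIdeal := by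
      ext s
      change algebraMap (CoordRing K n ⧸ p'.asIdeal) L _ = 0 ↔ _
      rw [FaithfulSMul.algebraMap_eq_zero_iff]
      exact Ideal.Quotient.eq_zero_iff_mem
    have ht : Transcendental K (ψ (tvar K n)) := by
      rw [← algebraMap_paramRing_X]
      refine (transcendental_iff_injective_paramRing
        (ψ.comp (IsScalarTower.toAlgHom K (ParamRing K) (CoordRing K n)))).mpr ?_
      exact (FaithfulSMul.algebraMap_injective (CoordRing K n ⧸ p'.asIdeal) L).comp hinj
    have hsol : IsSolution G P (ψ (tvar K n)) (ψ ∘ xvar K) := by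
      refine (mem_openLocus_ker ψ.toRingHom).mp ?_
      convert hp'
    obtain ⟨φ, hφ, hφP⟩ := hsol.exists_isEmb (transcendental_int ht) hG hP
    have := h L _ ht φ hφ
    rw [hφP, evalPt_eta] at this
    rw [← hker]
    exact this

/-- Each generator is preperiodic, with the same relation at every embedding. As the relation is
monic in `x_i`, it yields integrality over `K[t]`, and in homogenized form it controls the points at
infinity. -/
lemma exists_quadIter_sub_mem (hG : IsAdmissible G) (hP : MinGenerates G P) (i : Fin n) :
    ∃ a b, a < b ∧ quadIter (tvar K n) (xvar K i) b - quadIter (tvar K n) (xvar K i) a ∈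
      Y1Ideal K G P := by
  obtain ⟨d, hd, h⟩ := hG.iterate_preperiod_mem (P i)
  refine ⟨preperiod G (P i), d + preperiod G (P i), by omega, ?_⟩
  rw [mem_Y1Ideal_iff hG hP]
  intro L _ _ t ht φ hφ
  rw [map_sub, ← AlgHom.coe_toRingHom, map_quadIter, map_quadIter]
  have hx : ∀ i, evalPt t (φ ∘ P) (xvar K i) = φ (P i) := fun i => by simp [evalPt]
  simp only [AlgHom.coe_toRingHom, hx, evalPt_tvar, ← hφ.map_iterate]
  rw [iterate_add_apply, show (next G)^[d] _ = _ from h, sub_self]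

/-- The coordinate ring of `Y_1(G)` is integral over the parameter line. -/
lemma isIntegral_Y1Ring (hG : IsAdmissible G) (hP : MinGenerates G P) :
    Algebra.IsIntegral (ParamRing K) (Y1Ring K G P) := by
  have hx : ∀ i, IsIntegral (ParamRing K) (Ideal.Quotient.mk (Y1Ideal K G P) (xvar K i)) := by
    intro i
    obtain ⟨a, b, hab, h⟩ := exists_quadIter_sub_mem (K := K) hG hP i
    let T : ParamRing K := MvPolynomial.X ()
    refine ⟨quadIter (Polynomial.C T) Polynomial.X b - quadIter (Polynomial.C T) Polynomial.X a,
      ?_, ?_⟩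
    · refine (quadIter_C_X_monic _ b).sub_of_left (Polynomial.degree_lt_degree ?_)
      rw [natDegree_quadIter_C_X, natDegree_quadIter_C_X]
      exact Nat.pow_lt_pow_right one_lt_two hab
    · rw [Polynomial.eval₂_sub, ← Polynomial.coe_eval₂RingHom, map_quadIter, map_quadIter,
        ← Ideal.Quotient.eq_zero_iff_mem.mpr h, map_sub, map_quadIter, map_quadIter]
      simp only [Polynomial.coe_eval₂RingHom, Polynomial.eval₂_C, Polynomial.eval₂_X,
        ← algebraMap_paramRing_X]
      rfl
  refine ⟨fun b => ?_⟩
  obtain ⟨s, rfl⟩ := Ideal.Quotient.mk_surjective b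
  induction s using MvPolynomial.induction_on with
  | C c =>
    have h : (MvPolynomial.C c : CoordRing K n) =
      algebraMap (ParamRing K) (CoordRing K n) (MvPolynomial.C c) := by simp [algebraMap_paramRing]
    rw [h]
    exact isIntegral_algebraMap
  | add p q hp hq => rw [map_add]; exact hp.add hq
  | mul_X p o hp =>
    rw [map_mul]
    refine hp.mul ?_
    cases o with
    | none =>
      have h : (MvPolynomial.X none : CoordRing K n) =
        algebraMap (ParamRing K) (CoordRing K n) (MvPolynomial.X ()) :=
        (algebraMap_paramRing_X K n).symm
      rw [h]
      exact isIntegral_algebraMap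
    | some i => exact hx i

lemma finite_Y1Ring (hG : IsAdmissible G) (hP : MinGenerates G P) :
    Module.Finite (ParamRing K) (Y1Ring K G P) := by
  have := isIntegral_Y1Ring (K := K) hG hP
  have : Algebra.FiniteType K (Y1Ring K G P) := inferInstance
  have : Algebra.FiniteType (ParamRing K) (Y1Ring K G P) :=
    .of_restrictScalars_finiteType K _ _
  exact Algebra.IsIntegral.finite

/-- The embeddings that detect the ideal all have transcendental parameter, so a nonzero polynomial
in `t` vanishes at none of them. -/
lemma algebraMap_mem_nonZeroDivisors (hG : IsAdmissible G) (hP : MinGenerates G P)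
    {a : ParamRing K} (ha : a ≠ 0) :
    algebraMap (ParamRing K) (Y1Ring K G P) a ∈ nonZeroDivisors (Y1Ring K G P) := by
  rw [mem_nonZeroDivisors_iff_right]
  intro b hb
  obtain ⟨s, rfl⟩ := Ideal.Quotient.mk_surjective b
  have h : s * algebraMap (ParamRing K) (CoordRing K n) a ∈ Y1Ideal K G P :=
    Ideal.Quotient.eq_zero_iff_mem.mp hb
  rw [Ideal.Quotient.eq_zero_iff_mem]
  rw [mem_Y1Ideal_iff hG hP] at h ⊢
  intro L _ _ t ht φ hφ
  have := h L t ht φ hφ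
  rw [map_mul] at this
  exact (mul_eq_zero.mp this).resolve_right (evalPt_algebraMap_ne_zero ht _ ha)

/-- A point of `Y_1(G)` with transcendental parameter comes from an embedding of `G`. -/
lemma exists_isEmb_of_Y1Ideal_le (hG : IsAdmissible G) (hP : MinGenerates G P) {L : Type*}
    [Field L] [Algebra K L] (ψ : CoordRing K n →ₐ[K] L) (ht : Transcendental K (ψ (tvar K n)))
    (hψ : ∀ s ∈ Y1Ideal K G P, ψ s = 0) :
    ∃ φ : V → L, IsEmb G (ψ (tvar K n)) φ ∧ φ ∘ P = ψ ∘ xvar K := by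
  refine IsSolution.exists_isEmb ?_ (transcendental_int ht) hG hP
  refine (isSolution_iff ψ.toRingHom).mpr ⟨fun q hq => ?_, fun q hq h0 => ?_⟩
  · exact hψ q (mem_Y1Ideal.mpr fun p hp => hp.1 hq)
  · have := isIntegral_Y1Ring (K := K) hG hP
    -- An inequation vanishes at no point of the open locus, and that locus determines the ideal.
    have hq0 : Ideal.Quotient.mk (Y1Ideal K G P) q ∈ nonZeroDivisors (Y1Ring K G P) := by
      rw [mem_nonZeroDivisors_iff_right]
      intro b hb
      obtain ⟨s, rfl⟩ := Ideal.Quotient.mk_surjective b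
      rw [← map_mul, Ideal.Quotient.eq_zero_iff_mem, mem_Y1Ideal] at hb
      rw [Ideal.Quotient.eq_zero_iff_mem, mem_Y1Ideal]
      exact fun p hp => (p.2.mem_or_mem (hb p hp)).resolve_right (hp.2 q hq)
    -- An integral nonzerodivisor divides a nonzero element of `K[t]`. If the inequation vanished at
    -- the point, so would that element, contradicting the transcendence of the parameter.
    obtain ⟨a, ha, hdvd⟩ := (Algebra.IsIntegral.isIntegral (R := ParamRing K)
      (Ideal.Quotient.mk (Y1Ideal K G P) q)).isAlgebraic.exists_nonzero_dvd hq0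
    let ψ' : Y1Ring K G P →ₐ[K] L := Ideal.Quotient.liftₐ _ ψ hψ
    have h1 := map_dvd ψ' hdvd
    have h2 : ψ' (Ideal.Quotient.mk (Y1Ideal K G P) q) = 0 := h0
    rw [h2, zero_dvd_iff] at h1
    have h3 : ψ (algebraMap (ParamRing K) (CoordRing K n) a) = 0 := h1
    rw [← evalPt_eta ψ] at h3
    exact evalPt_algebraMap_ne_zero ht _ ha h3

end Ideal

end DynMod
end

noncomputable section

namespace DynMod

open Function

universe u v

/-! ### The universal embedding -/

section Universal

variable {K : Type u} [Field K] {V : Type v} {G : Digraph V} {n : ℕ} {P : Fin n → V}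

/-- Every vertex is `±f^k(P i)`, so the same polynomial `±f_t^k(x_i)` computes its image under all
embeddings. -/
lemma exists_vertexPoly (K : Type u) [Field K] (hP : Generates G P) (p : V) :
    ∃ s : CoordRing K n, ∀ (L : Type u) [Field L] [Algebra K L] (t : L) (φ : V → L),
      IsEmb G t φ → evalPt t (φ ∘ P) s = φ p := by
  obtain ⟨i, k, h⟩ := hP p
  have key : ∀ (L : Type u) [Field L] [Algebra K L] (t : L) (φ : V → L), IsEmb G t φ →
      evalPt t (φ ∘ P) (quadIter (tvar K n) (xvar K i) k) = φ ((next G)^[k] (P i)) := by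
    intro L _ _ t φ hφ
    rw [← AlgHom.coe_toRingHom, map_quadIter, hφ.map_iterate]
    congr 1 <;> simp [evalPt]
  rcases h with rfl | h
  · exact ⟨_, key⟩
  · refine ⟨-quadIter (tvar K n) (xvar K i) k, fun L _ _ t φ hφ => ?_⟩
    rw [map_neg, key L t φ hφ, hφ.map_isNeg h]

lemma algebraMap_Y1Ring_X : algebraMap (ParamRing K) (Y1Ring K G P) (MvPolynomial.X ()) =
    Ideal.Quotient.mk _ (tvar K n) :=
  congrArg (Ideal.Quotient.mk _) (algebraMap_paramRing_X K n)

variable [CharZero K]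

/-- The value of a vertex under the universal embedding. -/
def vtx (K : Type u) [Field K] (hP : Generates G P) (p : V) : Y1Ring K G P :=
  Ideal.Quotient.mk _ (exists_vertexPoly K hP p).choose

section Eval

variable {L : Type u} [Field L] [Algebra K L] {t : L}

/-- The point of `Y_1(G)` given by an embedding of `G`. -/
def evalEmb (hG : IsAdmissible G) (hP : MinGenerates G P) (ht : Transcendental K t) {φ : V → L}
    (hφ : IsEmb G t φ) : Y1Ring K G P →ₐ[K] L :=
  Ideal.Quotient.liftₐ _ (evalPt t (φ ∘ P)) fun _ hs => (mem_Y1Ideal_iff hG hP).mp hs L t ht φ hφ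

variable (hG : IsAdmissible G) (hP : MinGenerates G P) (ht : Transcendental K t) {φ : V → L}
  (hφ : IsEmb G t φ)

lemma evalEmb_mk (s : CoordRing K n) :
    evalEmb hG hP ht hφ (Ideal.Quotient.mk _ s) = evalPt t (φ ∘ P) s := rfl

lemma evalEmb_vtx (p : V) : evalEmb hG hP ht hφ (vtx K hP.1 p) = φ p :=
  (exists_vertexPoly K hP.1 p).choose_spec L t φ hφ

lemma evalEmb_tvar : evalEmb hG hP ht hφ (Ideal.Quotient.mk _ (tvar K n)) = t := by
  rw [evalEmb_mk]
  simp [evalPt]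

end Eval

/-- Embeddings separate the elements of the coordinate ring, so identities in it can be checked on
the values of vertices in fields. -/
lemma Y1Ring_ext (hG : IsAdmissible G) (hP : MinGenerates G P) {b b' : Y1Ring K G P}
    (h : ∀ (L : Type u) [Field L] [Algebra K L] (t : L) (ht : Transcendental K t) (φ : V → L)
      (hφ : IsEmb G t φ), evalEmb hG hP ht hφ b = evalEmb hG hP ht hφ b') : b = b' := by
  obtain ⟨s, rfl⟩ := Ideal.Quotient.mk_surjective b
  obtain ⟨s', rfl⟩ := Ideal.Quotient.mk_surjective b'
  rw [Ideal.Quotient.eq, mem_Y1Ideal_iff hG hP]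
  intro L _ _ t ht φ hφ
  rw [map_sub, sub_eq_zero]
  exact h L t ht φ hφ

lemma vtx_generator (hG : IsAdmissible G) (hP : MinGenerates G P) (i : Fin n) :
    vtx K hP.1 (P i) = Ideal.Quotient.mk _ (xvar K i) := by
  refine Y1Ring_ext hG hP fun L _ _ t ht φ hφ => ?_
  rw [evalEmb_vtx, evalEmb_mk]
  simp [evalPt]

/-- A point of `Y_1(G)` with transcendental parameter is given by an embedding of `G`. -/
lemma exists_eq_evalEmb (hG : IsAdmissible G) (hP : MinGenerates G P) {L : Type u} [Field L]
    [Algebra K L] (h : Y1Ring K G P →ₐ[K] L) {t : L}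
    (hht : h (algebraMap (ParamRing K) _ (MvPolynomial.X ())) = t) (ht : Transcendental K t) :
    ∃ (φ : V → L) (hφ : IsEmb G t φ), h = evalEmb hG hP ht hφ := by
  subst hht
  have htt : h (algebraMap (ParamRing K) _ (MvPolynomial.X ())) =
      (h.comp (Ideal.Quotient.mkₐ K (Y1Ideal K G P))) (tvar K n) := by
    rw [algebraMap_Y1Ring_X]; rfl
  obtain ⟨φ, hφ, hφP⟩ := exists_isEmb_of_Y1Ideal_le hG hP
    (h.comp (Ideal.Quotient.mkₐ K (Y1Ideal K G P))) (htt ▸ ht) fun s hs => by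
      have : Ideal.Quotient.mkₐ K (Y1Ideal K G P) s = 0 := Ideal.Quotient.eq_zero_iff_mem.mpr hs
      rw [AlgHom.comp_apply, this, map_zero]
  rw [← htt] at hφ
  refine ⟨φ, hφ, ?_⟩
  refine Ideal.Quotient.algHom_ext K ?_
  rw [← evalPt_eta (h.comp (Ideal.Quotient.mkₐ K (Y1Ideal K G P))), ← hφP, ← htt]
  rfl

/-! ### Restriction of embeddings along a map of graphs -/

section Restriction

variable {V' : Type*} {G' : Digraph V'} {n' : ℕ} {P' : Fin n' → V'}

/-- The morphism of coordinate rings given by restricting embeddings along a map of graphs. -/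
def resHom (hG : IsAdmissible G) (hP : MinGenerates G P) (hG' : IsAdmissible G')
    (hP' : MinGenerates G' P') (ι : V' → V)
    (hι : ∀ (L : Type u) [Field L] (t : L) (φ : V → L), IsEmb G t φ → IsEmb G' t (φ ∘ ι)) :
    Y1Ring K G' P' →ₐ[K] Y1Ring K G P :=
  Ideal.Quotient.liftₐ _ (evalPt (Ideal.Quotient.mk _ (tvar K n)) (vtx K hP.1 ∘ ι ∘ P')) fun s hs => by
    refine Y1Ring_ext hG hP fun L _ _ t ht φ hφ => ?_
    have h := (mem_Y1Ideal_iff hG' hP').mp hs L t ht (φ ∘ ι) (hι L t φ hφ)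
    rw [map_zero, ← h, ← AlgHom.comp_apply]
    congr 1
    ext o
    cases o with
    | none => simpa [evalPt] using evalEmb_tvar hG hP ht hφ
    | some i => simp [evalPt, evalEmb_vtx]

variable (hG : IsAdmissible G) (hP : MinGenerates G P) (hG' : IsAdmissible G')
    (hP' : MinGenerates G' P') (ι : V' → V)
    (hι : ∀ (L : Type u) [Field L] (t : L) (φ : V → L), IsEmb G t φ → IsEmb G' t (φ ∘ ι))

lemma evalEmb_comp_resHom {L : Type u} [Field L] [Algebra K L] {t : L} (ht : Transcendental K t)
    {φ : V → L} (hφ : IsEmb G t φ) :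
    (evalEmb hG hP ht hφ).comp (resHom hG hP hG' hP' ι hι) =
      evalEmb hG' hP' ht (hι L t φ hφ) := by
  refine Ideal.Quotient.algHom_ext K (MvPolynomial.algHom_ext fun o => ?_)
  change evalEmb hG hP ht hφ (evalPt _ _ _) = evalPt _ _ _
  cases o with
  | none => simpa [evalPt] using evalEmb_tvar hG hP ht hφ
  | some i => simp [evalPt, evalEmb_vtx]

lemma resHom_vtx (p : V') : resHom hG hP hG' hP' ι hι (vtx K hP'.1 p) = vtx K hP.1 (ι p) := by
  refine Y1Ring_ext hG hP fun L _ _ t ht φ hφ => ?_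
  rw [← AlgHom.comp_apply, evalEmb_comp_resHom, evalEmb_vtx, evalEmb_vtx]
  rfl

lemma resHom_algebraMap (a : ParamRing K) : resHom hG hP hG' hP' ι hι (algebraMap _ _ a) =
    algebraMap (ParamRing K) (Y1Ring K G P) a := by
  have : (resHom hG hP hG' hP' ι hι).comp (IsScalarTower.toAlgHom K (ParamRing K) _) =
      IsScalarTower.toAlgHom K (ParamRing K) (Y1Ring K G P) := by
    refine MvPolynomial.algHom_ext fun ⟨⟩ => ?_
    have h := algebraMap_Y1Ring_X (K := K) (G := G) (P := P)
    have h' := algebraMap_Y1Ring_X (K := K) (G := G') (P := P')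
    rw [AlgHom.comp_apply, IsScalarTower.coe_toAlgHom', IsScalarTower.coe_toAlgHom']
    refine ((congrArg _ h').trans ?_).trans h.symm
    change evalPt _ _ _ = _
    simp [evalPt]
  exact congr($this a)

end Restriction

end Universal

/-! ### Disjoint unions -/

section DisjointUnion

variable {V : Type v} {G : Digraph V} {m : ℕ} {S : Fin m → Set V}

lemma coe_next_inducedSubgraph (hG : IsAdmissible G) {i : Fin m}
    (hadm : IsAdmissible (inducedSubgraph G (S i))) (p : S i) :
    ((next (inducedSubgraph G (S i)) p : S i) : V) = next G p :=
  (hG.adj_iff.mp (hadm.adj_next p)).symm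

lemma IsEmb.restrict {L : Type*} [Field L] {t : L} {φ : V → L} (hφ : IsEmb G t φ)
    (hG : IsAdmissible G) {i : Fin m} (hadm : IsAdmissible (inducedSubgraph G (S i))) :
    IsEmb (inducedSubgraph G (S i)) t (φ ∘ Subtype.val) where
  injective := hφ.injective.comp Subtype.val_injective
  map_next p := by
    rw [comp_apply, coe_next_inducedSubgraph hG hadm, hφ.map_next]
    rfl

lemma eventualPeriod_mem_cycleLengths (hG : IsAdmissible G) (p : V) :
    eventualPeriod G p ∈ cycleLengths G :=
  ⟨_, _, hG.iterate_preperiod_mem p, rfl, rfl⟩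

lemma IsEmb.minimalPeriod_quadIter {L : Type*} [Field L] {t : L} {φ : V → L} (hφ : IsEmb G t φ)
    (hG : IsAdmissible G) (p : V) {k : ℕ} (hk : preperiod G p ≤ k) :
    minimalPeriod (fun y : L => y ^ 2 + t) (quadIter t (φ p) k) = eventualPeriod G p := by
  rw [← hφ.map_iterate, hφ.minimalPeriod_map, ← Nat.sub_add_cancel hk, iterate_add_apply,
    minimalPeriod_apply_iterate (hG.iterate_preperiod_mem p)]
  rfl

/-- Far enough along the orbit, the period of the value in the field is the eventual period of the
vertex, so the value alone determines it. -/
lemma IsEmb.eventualPeriod_eq {V' : Type*} {G' : Digraph V'} {L : Type*} [Field L] {t : L}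
    {φ : V → L} (hφ : IsEmb G t φ) {φ' : V' → L} (hφ' : IsEmb G' t φ') (hG : IsAdmissible G)
    (hG' : IsAdmissible G') {p : V} {p' : V'} (h : φ p = φ' p') :
    eventualPeriod G p = eventualPeriod G' p' := by
  rw [← hφ.minimalPeriod_quadIter hG p (k := preperiod G p + preperiod G' p') (by omega), h,
    hφ'.minimalPeriod_quadIter hG' p' (by omega)]

/-- Embeddings of the parts of a disjoint union without common cycle lengths glue. -/
lemma exists_isEmb_of_forall (hG : IsAdmissible G) (hS : IsDisjointUnion G S)
    (hadm : ∀ i, IsAdmissible (inducedSubgraph G (S i)))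
    (hcyc : Pairwise fun i j => Disjoint (cycleLengths (inducedSubgraph G (S i)))
      (cycleLengths (inducedSubgraph G (S j))))
    {L : Type*} [Field L] {t : L} {φ : ∀ i, S i → L}
    (hφ : ∀ i, IsEmb (inducedSubgraph G (S i)) t (φ i)) :
    ∃ ψ : V → L, IsEmb G t ψ ∧ ∀ i, ψ ∘ Subtype.val = φ i := by
  have hcov : ∀ p, ∃ i, p ∈ S i := fun p => by
    have : p ∈ ⋃ i, S i := hS.cover ▸ Set.mem_univ p
    simpa using this
  choose idx hidx using hcov
  have heq : ∀ i (p : V) (hp : p ∈ S i), φ (idx p) ⟨p, hidx p⟩ = φ i ⟨p, hp⟩ := by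
    intro i p hp
    have : idx p = i := by
      by_contra hne
      exact Set.disjoint_left.mp (hS.disjoint hne) (hidx p) hp
    subst this
    rfl
  refine ⟨fun p => φ (idx p) ⟨p, hidx p⟩, ⟨fun p q h => ?_, fun p => ?_⟩, fun i => ?_⟩
  · by_cases hne : idx p = idx q
    · rw [heq (idx q) p (hne ▸ hidx p)] at h
      exact congrArg Subtype.val ((hφ _).injective h)
    -- Equal values in two different parts would give the parts a common cycle length.
    · have := (hφ _).eventualPeriod_eq (hφ _) (hadm _) (hadm _) h
      have hp := eventualPeriod_mem_cycleLengths (hadm (idx p)) ⟨p, hidx p⟩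
      have hq := eventualPeriod_mem_cycleLengths (hadm (idx q)) ⟨q, hidx q⟩
      exact absurd (this ▸ hq) (Set.disjoint_left.mp (hcyc hne) hp)
  · have hmem : next G p ∈ S (idx p) := hS.noEdge _ _ _ (hidx p) (hG.adj_next p)
    rw [heq (idx p) _ hmem, ← (hφ _).map_next]
    congr 1
    exact Subtype.ext (coe_next_inducedSubgraph hG (hadm (idx p)) ⟨p, hidx p⟩).symm
  · ext p
    exact heq i p p.2

end DisjointUnion

end DynMod
end

noncomputable section

namespace DynMod

open Function

/-! ### Generic étaleness -/

section GenericEtale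

variable {A B : Type*} [CommRing A] [IsDomain A] [CharZero A] [CommRing B] [Algebra A B]

/-- By integrality a prime over the generic point is minimal, so in a reduced ring its localization
is a field. It is algebraic over `Frac A`, hence separable in characteristic zero, and `Frac A` is a
localization of `A`. -/
lemma isEtaleAt_of_comap_eq_bot [Algebra.IsIntegral A B] [IsReduced B] (q : Ideal B) [q.IsPrime]
    (hq : q.comap (algebraMap A B) = ⊥) : Algebra.IsEtaleAt A q := by
  have hmin : q ∈ minimalPrimes B := by
    refine ⟨⟨‹_›, bot_le⟩, fun p ⟨hp, _⟩ hpq => ?_⟩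
    by_contra hne
    have := Ideal.IsIntegral.comap_lt_comap (R := A) (lt_of_le_not_ge hpq hne)
    rw [hq] at this
    exact not_lt_bot this
  have : Ring.KrullDimLE 0 (Localization.AtPrime q) := .of_isLocalization _ hmin _
  let : Field (Localization.AtPrime q) := Ring.KrullDimLE.isField_of_isReduced.toField
  let L := Localization.AtPrime q
  let F := FractionRing A
  have hne : ∀ b ∉ q, algebraMap B L b ≠ 0 := fun b hb h0 =>
    not_isUnit_zero (h0 ▸ IsLocalization.map_units L (⟨b, hb⟩ : q.primeCompl))
  have hinj : Injective (algebraMap A L) := by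
    rw [injective_iff_map_eq_zero]
    intro a ha
    by_contra h
    have h1 : algebraMap A B a ∈ q := by
      by_contra hb
      exact hne _ hb (by rwa [IsScalarTower.algebraMap_apply A B L] at ha)
    have h2 : a ∈ (⊥ : Ideal A) := hq ▸ h1
    exact h (by simpa using h2)
  have : FaithfulSMul A L := (faithfulSMul_iff_algebraMap_injective A L).mpr hinj
  let : Algebra F L := FractionRing.liftAlgebra A L
  have : IsScalarTower A F L := inferInstance
  have : Algebra.IsAlgebraic F L := by
    refine ⟨fun x => ?_⟩
    have hB : ∀ b, IsAlgebraic F (algebraMap B L b) := fun b =>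
      (((Algebra.IsIntegral.isIntegral (R := A) b).algebraMap).tower_top (A := F)).isAlgebraic
    obtain ⟨b, s, rfl⟩ := IsLocalization.exists_mk'_eq q.primeCompl x
    have : IsLocalization.mk' L b s = algebraMap B L b * (algebraMap B L s)⁻¹ := by
      rw [IsLocalization.mk'_eq_iff_eq_mul, mul_assoc, inv_mul_cancel₀ (hne _ s.2), mul_one]
    rw [this]
    exact (hB b).mul (hB s).inv
  have : CharZero F := charZero_of_injective_algebraMap (IsFractionRing.injective A F)
  have : Algebra.FormallyEtale A F := .of_isLocalization (nonZeroDivisors A)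
  have : Algebra.FormallyEtale F L := .of_isSeparable F L
  exact Algebra.FormallyEtale.comp A F L

/-- The complement of the étale locus is closed, say `V(J)`. If `J` met `A` only in zero, lying over
would produce a point of `V(J)` above the generic point, where étaleness is known. -/
lemma exists_basicOpen_subset_etaleLocus [IsNoetherianRing A] [Module.Finite A B] [IsReduced B] :
    ∃ g : A, g ≠ 0 ∧ (PrimeSpectrum.basicOpen (algebraMap A B g) : Set (PrimeSpectrum B)) ⊆
      Algebra.etaleLocus A B := by
  have : Algebra.FinitePresentation A B :=
    (Algebra.FinitePresentation.of_finiteType).mp inferInstance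
  obtain ⟨J, hJ⟩ := (PrimeSpectrum.isClosed_iff_zeroLocus_ideal _).mp
    (Algebra.isOpen_etaleLocus (R := A) (A := B)).isClosed_compl
  have hJ0 : J.comap (algebraMap A B) ≠ ⊥ := by
    intro h0
    obtain ⟨q, hq, hqp, hq0⟩ := Ideal.exists_ideal_over_prime_of_isIntegral (⊥ : Ideal A) J h0.le
    have : (⟨q, hqp⟩ : PrimeSpectrum B) ∈ (Algebra.etaleLocus A B)ᶜ := hJ ▸ hq
    exact this (isEtaleAt_of_comap_eq_bot q hq0)
  obtain ⟨g, hg, hg0⟩ := Submodule.exists_mem_ne_zero_of_ne_bot hJ0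
  refine ⟨g, hg0, fun p hp => ?_⟩
  by_contra hpe
  have : p ∈ PrimeSpectrum.zeroLocus J := hJ ▸ hpe
  exact hp (this hg)

/-- A finite reduced algebra becomes étale after inverting a suitable element. -/
lemma exists_forall_etale {A B : Type*} [CommRing A] [IsDomain A] [CharZero A] [IsNoetherianRing A]
    [CommRing B] [Algebra A B] [Module.Finite A B] [IsReduced B] :
    ∃ g : A, g ≠ 0 ∧ ∀ g', g ∣ g' → Algebra.Etale A (Localization.Away (algebraMap A B g')) := by
  obtain ⟨g, hg0, hg⟩ := exists_basicOpen_subset_etaleLocus (A := A) (B := B)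
  refine ⟨g, hg0, fun g' hg' => ?_⟩
  have : Algebra.FinitePresentation A B :=
    (Algebra.FinitePresentation.of_finiteType).mp inferInstance
  rw [← Algebra.basicOpen_subset_etaleLocus_iff_etale]
  refine subset_trans ?_ hg
  exact PrimeSpectrum.basicOpen_le_basicOpen_iff _ _ |>.mpr
    (Ideal.le_radical (Ideal.mem_span_singleton.mpr (map_dvd _ hg')))

end GenericEtale

end DynMod
end

noncomputable section

namespace DynMod

open Function HomogeneousLocalization

universe u v

/-! ### Standard charts of projective space -/

lemma aeval_mul_of_isHomogeneous {σ R S : Type*} [CommRing R] [CommRing S] [Algebra R S]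
    {x : MvPolynomial σ R} {n : ℕ} (hx : x.IsHomogeneous n) (c : S) (y : σ → S) :
    MvPolynomial.aeval (fun j => c * y j) x = c ^ n * MvPolynomial.aeval y x := by
  rw [MvPolynomial.aeval_def, MvPolynomial.aeval_def, MvPolynomial.eval₂_eq, MvPolynomial.eval₂_eq,
    Finset.mul_sum]
  refine Finset.sum_congr rfl fun d hd => ?_
  simp only [mul_pow, Finset.prod_mul_distrib, Finset.prod_pow_eq_pow_sum]
  have : ∑ i ∈ d.support, d i = n := by
    simpa [Finsupp.weight_apply, Finsupp.sum] using hx (MvPolynomial.mem_support_iff.mp hd)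
  rw [this]
  ring

section Charts

variable {σ : Type} {K : Type u} [Field K]

lemma X_mem_homogeneousSubmodule (o : Option σ) :
    (MvPolynomial.X o : MvPolynomial (Option σ) K) ∈
      MvPolynomial.homogeneousSubmodule (Option σ) K 1 :=
  MvPolynomial.isHomogeneous_X K o

/-- The fraction `X_j / X_o`. -/
def coordFrac (o j : Option σ) :
    Away (MvPolynomial.homogeneousSubmodule (Option σ) K) (MvPolynomial.X o) :=
  Away.mk _ (X_mem_homogeneousSubmodule o) 1 (MvPolynomial.X j) (X_mem_homogeneousSubmodule j)

/-- The constants in the coordinate ring of a standard chart. -/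
def awayConst (f : MvPolynomial (Option σ) K) :
    K →+* Away (MvPolynomial.homogeneousSubmodule (Option σ) K) f :=
  (fromZeroRingHom _ _).comp (algebraMap K (MvPolynomial.homogeneousSubmodule (Option σ) K 0))

variable (σ K) in
/-- The evaluation `X_j ↦ X_j / X_o`. -/
def toChart (o : Option σ) : MvPolynomial (Option σ) K →+*
    Away (MvPolynomial.homogeneousSubmodule (Option σ) K) (MvPolynomial.X o) :=
  MvPolynomial.eval₂Hom (awayConst _) (coordFrac o)

lemma val_toChart (o : Option σ) (x : MvPolynomial (Option σ) K) : (toChart σ K o x).val =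
    MvPolynomial.aeval (fun j => (coordFrac (K := K) o j).val) x := by
  have : (algebraMap _ (Localization.Away (MvPolynomial.X (R := K) o))).comp (toChart σ K o) =
      (MvPolynomial.aeval (fun j => (coordFrac (K := K) o j).val)).toRingHom := by
    refine MvPolynomial.ringHom_ext (fun c => ?_) fun j => ?_
    · simp [toChart, awayConst]
      rfl
    · simp [toChart]
  exact congr($this x)

lemma toChart_of_isHomogeneous (o : Option σ) {n : ℕ} {x : MvPolynomial (Option σ) K}
    (hx : x ∈ MvPolynomial.homogeneousSubmodule (Option σ) K (n • 1)) :
    toChart σ K o x = Away.mk _ (X_mem_homogeneousSubmodule o) n x hx := by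
  apply val_injective
  rw [val_toChart, Away.val_mk]
  have hX : ∀ j, algebraMap (MvPolynomial (Option σ) K)
      (Localization.Away (MvPolynomial.X (R := K) o)) (MvPolynomial.X o) * (coordFrac (K := K) o j).val =
        algebraMap (MvPolynomial (Option σ) K) _ (MvPolynomial.X j) := by
    intro j
    rw [coordFrac, Away.val_mk, ← Localization.mk_one_eq_algebraMap,
      ← Localization.mk_one_eq_algebraMap, Localization.mk_mul, Localization.mk_eq_mk_iff,
      Localization.r_iff_exists]
    exact ⟨1, by simp⟩
  have h := aeval_mul_of_isHomogeneous ((MvPolynomial.mem_homogeneousSubmodule _ _).mp hx)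
    (algebraMap (MvPolynomial (Option σ) K) (Localization.Away (MvPolynomial.X (R := K) o))
      (MvPolynomial.X o))
    (fun j => (coordFrac (K := K) o j).val)
  have hid : MvPolynomial.aeval (fun j => algebraMap (MvPolynomial (Option σ) K)
      (Localization.Away (MvPolynomial.X (R := K) o)) (MvPolynomial.X j)) x =
        algebraMap _ _ x := by
    refine (MvPolynomial.aeval_algebraMap_apply _ MvPolynomial.X x).trans ?_
    rw [MvPolynomial.aeval_X_left_apply]
  simp only [hX, hid, smul_eq_mul, mul_one] at h
  rw [Localization.mk_eq_mk', eq_comm, IsLocalization.mk'_eq_iff_eq_mul, h, mul_comm, map_pow]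

lemma toChart_surjective (o : Option σ) : Surjective (toChart σ K o) := by
  intro z
  obtain ⟨n, x, hx, rfl⟩ := Away.mk_surjective _ (X_mem_homogeneousSubmodule o) z
  exact ⟨x, toChart_of_isHomogeneous o hx⟩

lemma coordFrac_self (o : Option σ) : coordFrac (K := K) o o = 1 := by
  apply val_injective
  rw [coordFrac, Away.val_mk, val_one, ← Localization.mk_one, Localization.mk_eq_mk_iff,
    Localization.r_iff_exists]
  exact ⟨1, by simp⟩

lemma dehom_mk {n : ℕ} {x : MvPolynomial (Option σ) K}
    (hx : x ∈ MvPolynomial.homogeneousSubmodule (Option σ) K (n • 1)) :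
    dehom σ K (Away.mk _ (X_mem_homogeneousSubmodule none) n x hx) = dehomPoly σ K x := by
  rw [dehom, RingHom.comp_apply, HomogeneousLocalization.algebraMap_apply, Away.val_mk, Localization.mk_eq_mk',
    IsLocalization.Away.lift, IsLocalization.lift_mk'_spec]
  simp [dehomPoly]

lemma dehom_toChart (x : MvPolynomial (Option σ) K) :
    dehom σ K (toChart σ K none x) = dehomPoly σ K x := by
  have : (dehom σ K).comp (toChart σ K none) = dehomPoly σ K := by
    refine MvPolynomial.ringHom_ext (fun c => ?_) fun j => ?_
    · rw [RingHom.comp_apply, toChart_of_isHomogeneous none (n := 0)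
        ((MvPolynomial.mem_homogeneousSubmodule _ _).mpr (MvPolynomial.isHomogeneous_C _ _)), dehom_mk]
    · rw [RingHom.comp_apply, toChart_of_isHomogeneous none (n := 1)
        (X_mem_homogeneousSubmodule j), dehom_mk]
  exact congr($this x)

variable (σ K)

/-- The inverse sends `x_i` to `X_i / X_none`. It suffices to compare on polynomials, since
`toChart` is surjective. -/
lemma dehom_bijective : Bijective (dehom σ K) := by
  have h1 : (((toChart σ K none).comp
      (MvPolynomial.rename some : MvPolynomial σ K →ₐ[K] _).toRingHom).comp (dehomPoly σ K)) =
        toChart σ K none := by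
    refine MvPolynomial.ringHom_ext (fun c => ?_) fun j => ?_
    · simp [dehomPoly]
    · cases j <;> simp [dehomPoly, toChart, coordFrac_self]
  refine ⟨LeftInverse.injective (g := (toChart σ K none).comp
    (MvPolynomial.rename some : MvPolynomial σ K →ₐ[K] _).toRingHom) fun z => ?_, fun p => ?_⟩
  · obtain ⟨x, rfl⟩ := toChart_surjective none z
    rw [dehom_toChart]
    exact congr($h1 x)
  · refine ⟨toChart σ K none (MvPolynomial.rename some p), ?_⟩
    rw [dehom_toChart]
    change MvPolynomial.aeval _ (MvPolynomial.rename some p) = p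
    rw [MvPolynomial.aeval_rename]
    exact MvPolynomial.aeval_X_left_apply p

instance isOpenImmersion_chart : IsOpenImmersion (chart σ K) := by
  have : IsIso (CommRingCat.ofHom (dehom σ K)) :=
    (ConcreteCategory.isIso_iff_bijective _).mpr (dehom_bijective σ K)
  exact IsOpenImmersion.comp _ (Proj.awayι _ _ (X_mem_homogeneousSubmodule none) Nat.one_pos)

/-- Each chart of the line is a quotient of `K[X]`, with `X` mapping to the ratio of the two
coordinates. -/
lemma isPrincipalIdealRing_chart (o : Option Unit) : IsPrincipalIdealRing
    (Away (MvPolynomial.homogeneousSubmodule (Option Unit) K) (MvPolynomial.X o)) := by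
  obtain ⟨o', ho'⟩ : ∃ o' : Option Unit, ∀ j, j = o ∨ j = o' := by
    cases o with
    | none => exact ⟨some (), fun j => by rcases j with _ | ⟨⟩ <;> simp⟩
    | some => exact ⟨none, fun j => by rcases j with _ | ⟨⟩ <;> simp⟩
  refine IsPrincipalIdealRing.of_surjective
    (Polynomial.eval₂RingHom (awayConst (MvPolynomial.X o)) (coordFrac (K := K) o o')) fun z => ?_
  obtain ⟨x, rfl⟩ := toChart_surjective o z
  refine ⟨MvPolynomial.eval₂Hom Polynomial.C
    (fun j => if j = o then 1 else Polynomial.X) x, ?_⟩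
  rw [← RingHom.comp_apply]
  congr 1
  refine MvPolynomial.ringHom_ext (fun c => ?_) fun j => ?_
  · simp [toChart]
  · rcases eq_or_ne j o with rfl | hj
    · simp [toChart, coordFrac_self]
    · have : j = o' := (ho' j).resolve_left hj
      subst this
      simp [toChart, hj]

instance isDomain_away (o : Option σ) : IsDomain
    (Away (MvPolynomial.homogeneousSubmodule (Option σ) K) (MvPolynomial.X o)) := by
  have : IsDomain (Localization.Away (MvPolynomial.X (R := K) o)) :=
    IsLocalization.isDomain_localization
      (powers_le_nonZeroDivisors_of_noZeroDivisors (MvPolynomial.X_ne_zero o))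
  exact (val_injective _).isDomain (algebraMap _ (Localization.Away (MvPolynomial.X (R := K) o)))

lemma iSup_basicOpen_X_eq_top : ⨆ o : Option σ, Proj.basicOpen
    (MvPolynomial.homogeneousSubmodule (Option σ) K) (MvPolynomial.X o) = ⊤ :=
  Proj.iSup_basicOpen_eq_top' _ (fun o : Option σ => (MvPolynomial.X o : MvPolynomial _ K))
    (fun o => ⟨1, X_mem_homogeneousSubmodule o⟩) (by
      rw [← top_le_iff]
      intro x _
      have hx : x ∈ Algebra.adjoin K (Set.range MvPolynomial.X) :=
        MvPolynomial.adjoin_range_X (R := K) ▸ trivial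
      exact Algebra.adjoin_induction (fun x hx => Algebra.subset_adjoin hx)
        (fun r => Subalgebra.algebraMap_mem _ (algebraMap K
          (MvPolynomial.homogeneousSubmodule (Option σ) K 0) r))
        (fun _ _ _ _ => add_mem) (fun _ _ _ _ => mul_mem) hx)

/-- The cover of projective space by its standard charts. -/
def standardCover : (PrSpace σ K).AffineOpenCover where
  I₀ := Option σ
  X o := .of (Away (MvPolynomial.homogeneousSubmodule (Option σ) K) (MvPolynomial.X o))
  f o := Proj.awayι _ _ (X_mem_homogeneousSubmodule o) Nat.one_pos
  idx x := (TopologicalSpace.Opens.mem_iSup.mp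
    ((iSup_basicOpen_X_eq_top σ K).ge (Set.mem_univ x))).choose
  covers x := by
    change x ∈ (Proj.awayι _ _ _ _).opensRange
    rw [Proj.opensRange_awayι]
    exact (TopologicalSpace.Opens.mem_iSup.mp
      ((iSup_basicOpen_X_eq_top σ K).ge (Set.mem_univ x))).choose_spec

instance irreducibleSpace_prSpace : IrreducibleSpace (PrSpace σ K) := by
  -- The zero ideal is a point of `Proj`, as it does not contain `X_none`, and its closure is
  -- everything.
  let ξ : ProjectiveSpectrum (MvPolynomial.homogeneousSubmodule (Option σ) K) :=
    { asHomogeneousIdeal := ⊥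
      isPrime := by
        rw [HomogeneousIdeal.toIdeal_bot]
        exact Ideal.isPrime_bot
      not_irrelevant_le := fun h => MvPolynomial.X_ne_zero (R := K) (none : Option σ)
        (h (HomogeneousIdeal.mem_irrelevant_of_mem _ Nat.one_pos
          (X_mem_homogeneousSubmodule none))) }
  have hξ : closure {ξ} = Set.univ := Set.eq_univ_of_forall fun x =>
    (ProjectiveSpectrum.le_iff_mem_closure _ ξ x).mp
      (show (⊥ : HomogeneousIdeal _) ≤ x.asHomogeneousIdeal from bot_le)
  have hirr : IsIrreducible (closure {ξ}) := isIrreducible_singleton.closure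
  rw [hξ] at hirr
  exact (irreducibleSpace_def _).mpr hirr

end Charts

end DynMod
end

noncomputable section

namespace DynMod

open Function HomogeneousLocalization

universe u v

/-! ### Linear projections -/

section GradedGlue

variable {A B : Type u} [CommRing A] [CommRing B] {σ τ : Type*} [SetLike σ A] [AddSubgroupClass σ A]
  [SetLike τ B] [AddSubgroupClass τ B] {𝒜 : ℕ → σ} {ℬ : ℕ → τ} [GradedRing 𝒜] [GradedRing ℬ]

/-- The map of homogeneous localizations induced by a graded ring homomorphism. -/
def awayHom (g : 𝒜 →+*ᵍ ℬ) {f : A} {f' : B} (h : g f = f') : Away 𝒜 f →+* Away ℬ f' :=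
  HomogeneousLocalization.map g (by rintro _ ⟨n, rfl⟩; exact ⟨n, by simp [h]⟩)

lemma awayHom_mk (g : 𝒜 →+*ᵍ ℬ) {f : A} {f' : B} (h : g f = f') {d : ℕ} (hf : f ∈ 𝒜 d)
    (n : ℕ) (x : A) (hx : x ∈ 𝒜 (n • d)) :
    awayHom g h (Away.mk 𝒜 hf n x hx) =
      Away.mk ℬ (h ▸ g.map_mem hf) n (g x) (g.map_mem hx) := by
  subst h
  exact Away.map_mk ..

/-- On the overlap of two basic open sets, both composites are the map induced by `g` after
inverting the product `f₁ * f₂`. -/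
lemma awayι_awayHom_glue (g : 𝒜 →+*ᵍ ℬ) {f₁ f₂ : A} {f₁' f₂' : B} (h₁ : g f₁ = f₁')
    (h₂ : g f₂ = f₂') {d₁ d₂ : ℕ} (hf₁ : f₁ ∈ 𝒜 d₁) (hf₂ : f₂ ∈ 𝒜 d₂) (hf₁' : f₁' ∈ ℬ d₁)
    (hf₂' : f₂' ∈ ℬ d₂) (hd₁ : 0 < d₁) (hd₂ : 0 < d₂) :
    pullback.fst (Proj.awayι ℬ f₁' hf₁' hd₁) (Proj.awayι ℬ f₂' hf₂' hd₂) ≫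
        Spec.map (CommRingCat.ofHom (awayHom g h₁)) ≫ Proj.awayι 𝒜 f₁ hf₁ hd₁ =
      pullback.snd (Proj.awayι ℬ f₁' hf₁' hd₁) (Proj.awayι ℬ f₂' hf₂' hd₂) ≫
        Spec.map (CommRingCat.ofHom (awayHom g h₂)) ≫ Proj.awayι 𝒜 f₂ hf₂ hd₂ := by
  have h₁₂ : g (f₁ * f₂) = f₁' * f₂' := by rw [map_mul, h₁, h₂]
  have e₁ : (awayMap ℬ hf₂' (rfl : f₁' * f₂' = _)).comp (awayHom g h₁) =
      (awayHom g h₁₂).comp (awayMap 𝒜 hf₂ (rfl : f₁ * f₂ = _)) := by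
    ext z
    obtain ⟨n, x, hx, rfl⟩ := Away.mk_surjective _ hf₁ z
    simp only [RingHom.comp_apply, awayHom_mk, awayMap_mk, map_mul, map_pow, h₂]
  have e₂ : (awayMap ℬ hf₁' (mul_comm f₁' f₂')).comp (awayHom g h₂) =
      (awayHom g h₁₂).comp (awayMap 𝒜 hf₁ (mul_comm f₁ f₂)) := by
    ext z
    obtain ⟨n, x, hx, rfl⟩ := Away.mk_surjective _ hf₂ z
    simp only [RingHom.comp_apply, awayHom_mk, awayMap_mk, map_mul, map_pow, h₁]
  rw [← Proj.pullbackAwayιIso_hom_SpecMap_awayMap_left ℬ hf₁' hd₁ hf₂' hd₂ rfl,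
    ← Proj.pullbackAwayιIso_hom_SpecMap_awayMap_right ℬ hf₁' hd₁ hf₂' hd₂ rfl]
  simp only [Category.assoc, ← Spec.map_comp_assoc, ← CommRingCat.ofHom_comp]
  rw [e₁, e₂]
  simp only [CommRingCat.ofHom_comp, Spec.map_comp, Category.assoc]
  rw [Proj.SpecMap_awayMap_awayι, Proj.SpecMap_awayMap_awayι 𝒜 hf₂ hd₂ hf₁ (mul_comm f₁ f₂)]
  rfl

/-- A morphism to `Proj` factors, over the locus where the images of given elements of positive
degree do not all vanish, through a graded ring homomorphism. -/
lemma exists_lift_proj (g : 𝒜 →+*ᵍ ℬ) {ι : Type*} (f : ι → A) (f' : ι → B)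
    (h : ∀ i, g (f i) = f' i) {d : ι → ℕ} (hf : ∀ i, f i ∈ 𝒜 (d i)) (hf' : ∀ i, f' i ∈ ℬ (d i))
    (hd : ∀ i, 0 < d i) {X : Scheme.{u}} (p : X ⟶ Proj ℬ)
    (hp : ∀ x, ∃ i, p x ∈ Proj.basicOpen ℬ (f' i)) :
    ∃ ρ : X ⟶ Proj 𝒜, ∀ {T : Scheme.{u}} (i : ι) (a : T ⟶ X) (b : T ⟶ Spec (.of (Away ℬ (f' i)))),
      a ≫ p = b ≫ Proj.awayι ℬ (f' i) (hf' i) (hd i) →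
        a ≫ ρ = b ≫ Spec.map (CommRingCat.ofHom (awayHom g (h i))) ≫
          Proj.awayι 𝒜 (f i) (hf i) (hd i) := by
  let 𝒰 : X.OpenCover := Scheme.Cover.mkOfCovers ι
    (fun i => pullback p (Proj.awayι ℬ (f' i) (hf' i) (hd i))) (fun i => pullback.fst _ _)
    (fun x => by
      obtain ⟨i, hi⟩ := hp x
      refine ⟨i, ?_⟩
      rw [← Proj.opensRange_awayι ℬ (f' i) (hf' i) (hd i)] at hi
      have : x ∈ Set.range (pullback.fst p (Proj.awayι ℬ (f' i) (hf' i) (hd i))) := by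
        rw [IsOpenImmersion.range_pullbackFst]
        exact hi
      exact this)
    (fun i => inferInstance)
  let m (i : ι) : pullback p (Proj.awayι ℬ (f' i) (hf' i) (hd i)) ⟶ Proj 𝒜 := pullback.snd _ _ ≫
    Spec.map (CommRingCat.ofHom (awayHom g (h i))) ≫ Proj.awayι 𝒜 (f i) (hf i) (hd i)
  have hm : ∀ i j : ι, pullback.fst (pullback.fst p (Proj.awayι ℬ (f' i) (hf' i) (hd i)))
      (pullback.fst p (Proj.awayι ℬ (f' j) (hf' j) (hd j))) ≫ m i = pullback.snd _ _ ≫ m j := by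
    intro i j
    let q : pullback (pullback.fst p (Proj.awayι ℬ (f' i) (hf' i) (hd i)))
        (pullback.fst p (Proj.awayι ℬ (f' j) (hf' j) (hd j))) ⟶
        pullback (Proj.awayι ℬ (f' i) (hf' i) (hd i)) (Proj.awayι ℬ (f' j) (hf' j) (hd j)) :=
      pullback.lift (pullback.fst _ _ ≫ pullback.snd p _) (pullback.snd _ _ ≫ pullback.snd p _) (by
          rw [Category.assoc, Category.assoc, ← pullback.condition, ← pullback.condition]
          exact pullback.condition_assoc p)
    have := congr(q ≫ $(awayι_awayHom_glue g (h i) (h j) (hf i) (hf j) (hf' i) (hf' j)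
      (hd i) (hd j)))
    rw [pullback.lift_fst_assoc, pullback.lift_snd_assoc, Category.assoc, Category.assoc] at this
    exact this
  refine ⟨𝒰.glueMorphisms m hm, fun {T} i a b hab => ?_⟩
  have h1 : pullback.fst p (Proj.awayι ℬ (f' i) (hf' i) (hd i)) ≫ 𝒰.glueMorphisms m hm = m i :=
    𝒰.ι_glueMorphisms m hm i
  have h2 := pullback.lift_fst a b hab
  conv_lhs => rw [← h2]
  rw [Category.assoc, h1, pullback.lift_snd_assoc]

end GradedGlue

end DynMod
end

noncomputable section

namespace DynMod

open Function HomogeneousLocalization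

universe u v

/-! ### The projection of `X_1(G)` to the projective line -/

section Projection

variable (K : Type u) [Field K] {V : Type v} {G : Digraph V} {n : ℕ} {P : Fin n → V}

/-- The homogenization of `f_t^k(x_i)`. -/
def homogIter (i : Fin n) : ℕ → MvPolynomial (Option (Option (Fin n))) K
  | 0 => MvPolynomial.X (some (some i))
  | k + 1 => homogIter i k ^ 2 +
      MvPolynomial.X (some none) * MvPolynomial.X none ^ (2 ^ (k + 1) - 1)

lemma homogIter_isHomogeneous (i : Fin n) (k : ℕ) : (homogIter K i k).IsHomogeneous (2 ^ k) := by
  induction k with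
  | zero => exact MvPolynomial.isHomogeneous_X _ _
  | succ k ih =>
    refine .add ?_ ?_
    · simpa [pow_succ] using ih.pow 2
    · have h := (MvPolynomial.isHomogeneous_X K (some none : Option (Option (Fin n)))).mul
        ((MvPolynomial.isHomogeneous_X K (none : Option (Option (Fin n)))).pow (2 ^ (k + 1) - 1))
      have hk : 1 + 1 * (2 ^ (k + 1) - 1) = 2 ^ (k + 1) := by
        have := Nat.one_le_two_pow (n := k + 1)
        omega
      rwa [hk] at h

lemma dehomPoly_homogIter (i : Fin n) (k : ℕ) : dehomPoly _ K (homogIter K i k) =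
    quadIter (tvar K n) (xvar K i) k := by
  induction k with
  | zero => simp [homogIter, dehomPoly, quadIter_zero]
  | succ k ih =>
    rw [homogIter, map_add, map_pow, ih, quadIter_succ]
    simp [dehomPoly]

/-- Modulo the hyperplane at infinity the correction terms vanish and `homogIter` is a pure power of
`X_i`. -/
lemma X_mem_of_homogIter_mem {p : Ideal (MvPolynomial (Option (Option (Fin n))) K)} [p.IsPrime]
    (h0 : MvPolynomial.X none ∈ p) {i : Fin n} {k : ℕ} (hk : homogIter K i k ∈ p) :
    MvPolynomial.X (some (some i)) ∈ p := by
  induction k with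
  | zero => exact hk
  | succ k ih =>
    refine ih (Ideal.IsPrime.mem_of_pow_mem ‹_› 2 ?_)
    refine (Ideal.add_mem_iff_left p ?_).mp hk
    exact Ideal.mul_mem_left _ _ (Ideal.pow_mem_of_mem _ h0 _
      (Nat.sub_pos_of_lt (Nat.one_lt_two_pow k.succ_ne_zero)))

variable {K}

lemma Y1toPr_preimage_basicOpen {h : MvPolynomial (Option (Option (Fin n))) K} {d : ℕ}
    (hh : h ∈ MvPolynomial.homogeneousSubmodule _ K d) (hd : 0 < d)
    (h0 : dehomPoly _ K h ∈ Y1Ideal K G P) (y : Y1 K G P) :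
    Y1toPr K G P y ∉ Proj.basicOpen (MvPolynomial.homogeneousSubmodule _ K) h := by
  intro hy
  have hy' : (Y1ι K G P ≫ Spec.map (CommRingCat.ofHom (dehom (Option (Fin n)) K))) y ∈
      Proj.awayι (MvPolynomial.homogeneousSubmodule _ K) (MvPolynomial.X none)
        (X_mem_homogeneousSubmodule none) Nat.one_pos ⁻¹ᵁ Proj.basicOpen _ h := hy
  rw [Proj.awayι_preimage_basicOpen (hm' := hd) (g_deg := hh)] at hy'
  apply hy'
  rw [Y1ι, ← Spec.map_comp, ← CommRingCat.ofHom_comp]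
  change Ideal.Quotient.mk _ (dehom _ K _) ∈ y.asIdeal
  rw [Away.isLocalizationElem, dehom_mk]
  have : Ideal.Quotient.mk (PrimeSpectrum.vanishingIdeal (closure (openLocus K G P)))
      (dehomPoly _ K (h ^ 1)) = 0 := by
    rw [pow_one]
    exact Ideal.Quotient.eq_zero_iff_mem.mpr h0
  rw [this]
  exact zero_mem _

/-- The linear inclusion of coordinates that defines the projection to the projective line. -/
def lineHom (K : Type u) [Field K] (n : ℕ) : MvPolynomial.homogeneousSubmodule (Option Unit) K →+*ᵍ
    MvPolynomial.homogeneousSubmodule (Option (Option (Fin n))) K where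
  toRingHom := (MvPolynomial.rename (R := K)
    (Option.map fun _ : Unit => (none : Option (Fin n)))).toRingHom
  map_mem hx := MvPolynomial.IsHomogeneous.rename_isHomogeneous hx

lemma lineHom_X (o : Option Unit) : lineHom K n (MvPolynomial.X o) =
    MvPolynomial.X (o.map fun _ => none) :=
  MvPolynomial.rename_X _ _

/-- The closure misses the center of the linear projection, where the homogenizing coordinate and
that of `t` both vanish: there the preperiodicity relation makes every `x_i`-coordinate vanish too,
so no homogeneous coordinate would be left. -/
lemma exists_mem_basicOpen_of_mem_projClosure [CharZero K] (hG : IsAdmissible G)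
    (hP : MinGenerates G P) (c : projClosure K G P) :
    ∃ o : Option Unit, (Y1toPr K G P).imageι c ∈ Proj.basicOpen
      (MvPolynomial.homogeneousSubmodule _ K) (MvPolynomial.X (o.map fun _ => none)) := by
  by_contra! H
  set p := (Y1toPr K G P).imageι c
  have hp : (p : PrSpace (Option (Fin n)) K) ∈ closure (Set.range (Y1toPr K G P)) := by
    have : p ∈ Set.range (Y1toPr K G P).imageι := ⟨c, rfl⟩
    rwa [Scheme.IdealSheafData.range_subschemeι, Scheme.Hom.support_ker] at this
  have h0 : (MvPolynomial.X none : MvPolynomial (Option (Option (Fin n))) K) ∈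
      p.asHomogeneousIdeal := not_not.mp (H none)
  have ht : (MvPolynomial.X (some none) : MvPolynomial (Option (Option (Fin n))) K) ∈
      p.asHomogeneousIdeal := not_not.mp (H (some ()))
  have hprime : p.asHomogeneousIdeal.toIdeal.IsPrime := p.isPrime
  have hx : ∀ i : Fin n, (MvPolynomial.X (some (some i)) :
      MvPolynomial (Option (Option (Fin n))) K) ∈ p.asHomogeneousIdeal.toIdeal := by
    intro i
    obtain ⟨a, b, hab, hmem⟩ := exists_quadIter_sub_mem (K := K) hG hP i
    have hlt : 2 ^ a < 2 ^ b := Nat.pow_lt_pow_right one_lt_two hab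
    -- The homogenization of `f_t^b(x_i) - f_t^a(x_i)`; the power of `X_none` equalizes the degrees
    -- `2 ^ b` and `2 ^ a`.
    set h := homogIter K i b - homogIter K i a * MvPolynomial.X none ^ (2 ^ b - 2 ^ a)
    have hh : h.IsHomogeneous (2 ^ b) := by
      refine (homogIter_isHomogeneous K i b).sub ?_
      have := (homogIter_isHomogeneous K i a).mul ((MvPolynomial.isHomogeneous_X K
        (none : Option (Option (Fin n)))).pow (2 ^ b - 2 ^ a))
      rwa [one_mul, Nat.add_sub_cancel' hlt.le] at this
    have hd : dehomPoly _ K h ∈ Y1Ideal K G P := by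
      rw [map_sub, map_mul, dehomPoly_homogIter, dehomPoly_homogIter, map_pow]
      simpa [dehomPoly] using hmem
    have hph : h ∈ p.asHomogeneousIdeal.toIdeal := by
      by_contra hn
      obtain ⟨_, hq, y, rfl⟩ := mem_closure_iff.mp hp (Proj.basicOpen _ h).1
        (Proj.basicOpen _ h).2 hn
      exact Y1toPr_preimage_basicOpen hh (by positivity) hd y hq
    refine X_mem_of_homogIter_mem K h0 (k := b) ((Submodule.sub_mem_iff_left _ ?_).mp hph)
    exact Ideal.mul_mem_left _ _ (Ideal.pow_mem_of_mem _ h0 _ (Nat.sub_pos_of_lt hlt))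
  have hall : ∀ o, (MvPolynomial.X o : MvPolynomial (Option (Option (Fin n))) K) ∈
      p.asHomogeneousIdeal.toIdeal := by
    rintro (_ | _ | i)
    exacts [h0, ht, hx i]
  have hpt : p ∈ (⊤ : (PrSpace (Option (Fin n)) K).Opens) := trivial
  rw [← iSup_basicOpen_X_eq_top (Option (Fin n)) K, TopologicalSpace.Opens.mem_iSup] at hpt
  obtain ⟨o, ho⟩ := hpt
  exact ho (hall o)

lemma exists_closureProjection [CharZero K] (hG : IsAdmissible G) (hP : MinGenerates G P) :
    ∃ ρ : projClosure K G P ⟶ PrLine K, Y1toClosure K G P ≫ ρ = Y1toPrLine K G P := by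
  obtain ⟨ρ, hρ⟩ := exists_lift_proj (lineHom K n) (fun o : Option Unit => MvPolynomial.X o)
    (fun o => MvPolynomial.X (o.map fun _ => none)) lineHom_X (d := fun _ => 1)
    X_mem_homogeneousSubmodule (fun o => X_mem_homogeneousSubmodule _) (fun _ => Nat.one_pos)
    (Y1toPr K G P).imageι (exists_mem_basicOpen_of_mem_projClosure hG hP)
  refine ⟨ρ, ?_⟩
  rw [hρ none (Y1toClosure K G P) (Y1ι K G P ≫ Spec.map (CommRingCat.ofHom (dehom _ K))) (by
    rw [Scheme.Hom.toImage_imageι, Category.assoc]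
    rfl), Y1toPrLine, Category.assoc]
  congr 1
  rw [chart, ← Spec.map_comp_assoc, ← Spec.map_comp_assoc, ← CommRingCat.ofHom_comp,
    ← CommRingCat.ofHom_comp]
  congr 3
  refine RingHom.ext fun z => ?_
  obtain ⟨k, x, hx, rfl⟩ := Away.mk_surjective _ (X_mem_homogeneousSubmodule none) z
  rw [RingHom.comp_apply, RingHom.comp_apply, awayHom_mk]
  refine (dehom_mk (K := K) ((lineHom K n).map_mem hx)).trans
    (Eq.trans ?_ (congrArg _ (dehom_mk hx)).symm)
  have : (dehomPoly (Option (Fin n)) K).comp (lineHom K n).toRingHom =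
      (MvPolynomial.rename (R := K) (fun _ : Unit => (none : Option (Fin n)))).toRingHom.comp
        (dehomPoly Unit K) := by
    refine MvPolynomial.ringHom_ext (fun c => ?_) fun o => ?_
    · simp [lineHom, dehomPoly]
    · cases o <;> simp [lineHom, dehomPoly]
  exact congr($this x)

/-- The projection exists. -/
lemma exists_isProjection [CharZero K] (hG : IsAdmissible G) (hP : MinGenerates G P) :
    ∃ π, IsProjection K G P π := by
  obtain ⟨ρ, hρ⟩ := exists_closureProjection (K := K) hG hP
  refine ⟨X1toClosure K G P ≫ ρ, ?_⟩
  rw [IsProjection, pullback.condition_assoc, hρ]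

variable (K G P) in
/-- The map from the generic points to `X_1(G)`. -/
def genericToX1 : Spec (.of (FractionRing (Y1Ring K G P))) ⟶ X1 K G P :=
  (genericPoints K G P).toNormalization

instance : IsDominant (genericToX1 K G P) :=
  inferInstanceAs (IsDominant (genericPoints K G P).toNormalization)

instance isReduced_X1 : IsReduced (X1 K G P) :=
  inferInstanceAs (IsReduced (genericPoints K G P).normalization)

lemma genericToX1_X1toClosure : genericToX1 K G P ≫ X1toClosure K G P = genericPoints K G P :=
  (genericPoints K G P).toNormalization_fromNormalization

lemma IsProjection.genericToX1_comp {π : X1 K G P ⟶ PrLine K} (hπ : IsProjection K G P π) :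
    genericToX1 K G P ≫ π = Spec.map (CommRingCat.ofHom (algebraMap (Y1Ring K G P)
      (FractionRing (Y1Ring K G P)))) ≫ Y1toPrLine K G P := by
  have := congr(pullback.lift (genericToX1 K G P) (Spec.map (CommRingCat.ofHom
    (algebraMap (Y1Ring K G P) (FractionRing (Y1Ring K G P))))) genericToX1_X1toClosure ≫ $hπ)
  rwa [pullback.lift_fst_assoc, pullback.lift_snd_assoc] at this

/-- The condition fixes the morphism on the generic points, which are dense in the reduced scheme
`X1`, and the target is separated. -/
lemma IsProjection.unique {π π' : X1 K G P ⟶ PrLine K} (hπ : IsProjection K G P π)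
    (hπ' : IsProjection K G P π') : π = π' :=
  ext_of_isDominant (genericToX1 K G P) (by rw [hπ.genericToX1_comp, hπ'.genericToX1_comp])

end Projection

end DynMod
end

noncomputable section

namespace DynMod

open Function

universe u v

/-! ### Smooth algebras over normal domains -/

section Normal

open scoped nonZeroDivisors TensorProduct

/-- Integral closure commutes with smooth base change, and `A` is its own integral closure in `Frac
A`. Hence `S` is integrally closed in `S ⊗ Frac A`, which is `Q`. -/
lemma exists_algebraMap_eq_of_isIntegral_of_smooth {A S Q : Type*} [CommRing A] [IsDomain A]
    [IsIntegrallyClosed A] [CommRing S] [Algebra A S] [Algebra.Smooth A S] [CommRing Q]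
    [Algebra S Q] [IsLocalization (Algebra.algebraMapSubmonoid S A⁰) Q] {x : Q}
    (hx : IsIntegral S x) : ∃ s, algebraMap S Q s = x := by
  let F := FractionRing A
  let e : Q ≃ₐ[S] S ⊗[A] F := IsLocalization.algEquiv (Algebra.algebraMapSubmonoid S A⁰) _ _
  have hex : IsIntegral S (e x) := hx.map e
  obtain ⟨z, hz⟩ := (TensorProduct.toIntegralClosure_bijective_of_smooth (R := A) (S := S)
    (B := F)).2 ⟨e x, hex⟩
  have key : ∀ z : S ⊗[A] integralClosure A F, ∃ s, algebraMap S (S ⊗[A] F) s =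
      TensorProduct.toIntegralClosure A S F z := by
    intro z
    induction z with
    | zero => exact ⟨0, by simp⟩
    | add y z hy hz =>
      obtain ⟨a, ha⟩ := hy
      obtain ⟨b, hb⟩ := hz
      exact ⟨a + b, by rw [map_add, map_add, ha, hb]; rfl⟩
    | tmul s f =>
      obtain ⟨f, hf⟩ := f
      obtain ⟨a, rfl⟩ := IsIntegrallyClosed.isIntegral_iff.mp hf
      refine ⟨a • s, ?_⟩
      rw [Algebra.TensorProduct.algebraMap_apply, TensorProduct.toIntegralClosure]
      simp [Algebra.algebraMap_eq_smul_one, TensorProduct.smul_tmul']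
  obtain ⟨s, hs⟩ := key z
  refine ⟨s, e.injective ?_⟩
  rw [e.commutes, hs, hz]

/-- Every nonzerodivisor of `B` divides a nonzero element of `A` by integrality, so inverting the
latter elements already gives the total ring of fractions. -/
lemma isLocalization_fractionRing {A B : Type*} [CommRing A] [IsDomain A] [CommRing B]
    [Algebra A B] [Algebra.IsIntegral A B] (hB : ∀ a : A, a ≠ 0 → algebraMap A B a ∈ B⁰) :
    IsLocalization (Algebra.algebraMapSubmonoid B A⁰) (FractionRing B) := by
  have hle : Algebra.algebraMapSubmonoid B A⁰ ≤ B⁰ := by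
    rintro _ ⟨a, ha, rfl⟩
    exact hB a (nonZeroDivisors.ne_zero ha)
  refine (IsLocalization.iff_of_le_of_exists_dvd _ B⁰ hle fun b hb => ?_).mpr inferInstance
  obtain ⟨a, ha, h⟩ := (Algebra.IsIntegral.isIntegral (R := A) b).isAlgebraic.exists_nonzero_dvd hb
  exact ⟨_, ⟨a, mem_nonZeroDivisors_of_ne_zero ha, rfl⟩, h⟩

lemma exists_algebraMap_eq_of_isIntegral_away {A B : Type*} [CommRing A] [IsDomain A]
    [IsIntegrallyClosed A] [CommRing B] [Algebra A B] [Algebra.IsIntegral A B]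
    (hB : ∀ a : A, a ≠ 0 → algebraMap A B a ∈ B⁰) {g : A} (hg : g ≠ 0)
    [Algebra.Etale A (Localization.Away (algebraMap A B g))]
    [Algebra (Localization.Away (algebraMap A B g)) (FractionRing B)]
    [IsScalarTower B (Localization.Away (algebraMap A B g)) (FractionRing B)] {x : FractionRing B}
    (hx : IsIntegral (Localization.Away (algebraMap A B g)) x) :
    ∃ s, algebraMap (Localization.Away (algebraMap A B g)) (FractionRing B) s = x := by
  have := isLocalization_fractionRing hB
  have h := IsLocalization.isLocalization_of_submonoid_le
    (Localization.Away (algebraMap A B g)) (FractionRing B)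
    (Submonoid.powers (algebraMap A B g)) (Algebra.algebraMapSubmonoid B A⁰)
    (Submonoid.powers_le.mpr ⟨g, mem_nonZeroDivisors_of_ne_zero hg, rfl⟩)
  have e : (Algebra.algebraMapSubmonoid B A⁰).map
      (algebraMap B (Localization.Away (algebraMap A B g))) =
        Algebra.algebraMapSubmonoid (Localization.Away (algebraMap A B g)) A⁰ := by
    ext y
    simp [Algebra.algebraMapSubmonoid, IsScalarTower.algebraMap_apply A B
      (Localization.Away (algebraMap A B g))]
  rw [e] at h
  exact exists_algebraMap_eq_of_isIntegral_of_smooth (A := A) hx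

end Normal

/-! ### Normalization -/

section Normalization

/-- The normalization of an affine scheme is affine, and its sections embed in `Q` and are integral
over `R`; if `R` is integrally closed in `Q`, nothing new appears. The isomorphism `i` allows a
source that is only isomorphic to `Spec Q`, such as one obtained by base change. -/
lemma isIso_fromNormalization {R Q : CommRingCat.{u}} (f : R ⟶ Q) {X : Scheme.{u}}
    (i : X ⟶ Spec Q) [IsIso i] (hf : Injective f)
    (h : ∀ x : Q, f.hom.IsIntegralElem x → ∃ r, f r = x) (d : X ⟶ Spec R) [QuasiCompact d]
    [QuasiSeparated d] (hd : d = i ≫ Spec.map f) : IsIso d.fromNormalization := by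
  subst hd
  have : IsAffine (i ≫ Spec.map f).normalization :=
    isAffine_of_isAffineHom (i ≫ Spec.map f).fromNormalization
  set F := (i ≫ Spec.map f).fromNormalization
  set T := (i ≫ Spec.map f).toNormalization
  have : IsIso i.appTop := inferInstanceAs (IsIso (i.app ⊤))
  let J : Γ(X, ⊤) ≅ Q := (asIso i.appTop).symm.trans (Scheme.ΓSpecIso Q)
  have hT : Injective T.appTop.hom := by
    rw [RingHom.injective_iff_ker_eq_bot]
    have := congr(($((i ≫ Spec.map f).ker_toNormalization)).ideal ⟨⊤, isAffineOpen_top _⟩)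
    rwa [Scheme.Hom.ker_apply] at this
  have hcomp : ∀ r, T.appTop.hom (F.appTop.hom ((Scheme.ΓSpecIso R).inv.hom r)) =
      J.inv.hom (f.hom r) := by
    intro r
    have h1 := congr(i.appTop.hom (($(Scheme.ΓSpecIso_inv_naturality f)).hom r))
    have h2 : F.appTop ≫ T.appTop = (Spec.map f).appTop ≫ i.appTop := by
      rw [← Scheme.Hom.comp_appTop, ← Scheme.Hom.comp_appTop,
        (i ≫ Spec.map f).toNormalization_fromNormalization]
    exact congr(($h2).hom ((Scheme.ΓSpecIso R).inv.hom r)).trans h1.symm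
  have hQ : ∀ y, J.inv.hom (J.hom.hom y) = y := fun y => congr(($(J.hom_inv_id)).hom y)
  have hQ' : ∀ y, J.hom.hom (J.inv.hom y) = y := fun y => congr(($(J.inv_hom_id)).hom y)
  have hR : ∀ y, (Scheme.ΓSpecIso R).inv.hom ((Scheme.ΓSpecIso R).hom.hom y) = y := fun y =>
    congr(($((Scheme.ΓSpecIso R).hom_inv_id)).hom y)
  have hbij : Bijective F.appTop.hom := by
    constructor
    · intro a b hab
      rw [← hR a, ← hR b] at hab ⊢
      have := congrArg (fun z => J.hom.hom (T.appTop.hom z)) hab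
      simp only [hcomp, hQ'] at this
      rw [hf this]
    · intro y
      obtain ⟨p, hp, hpy⟩ := IsIntegralHom.isIntegral_app F ⊤ (isAffineOpen_top _) y
      obtain ⟨r, hr⟩ := h (J.hom.hom (T.appTop.hom y)) (by
        refine ⟨p.map (Scheme.ΓSpecIso R).hom.hom, hp.map _, ?_⟩
        have : Polynomial.eval₂ ((J.hom.hom.comp T.appTop.hom).comp F.appTop.hom)
            ((J.hom.hom.comp T.appTop.hom) y) p = 0 := by
          rw [← Polynomial.hom_eval₂]
          exact (congrArg _ hpy).trans (map_zero _)
        rw [Polynomial.eval₂_map, ← this, RingHom.comp_apply]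
        congr 1
        ext z
        have := hcomp ((Scheme.ΓSpecIso R).hom.hom z)
        rw [hR] at this
        exact (hQ' _).symm.trans (congrArg _ this.symm))
      refine ⟨(Scheme.ΓSpecIso R).inv.hom r, hT ?_⟩
      rw [hcomp]
      exact (congrArg _ hr).trans (hQ _)
  have : IsIso F.appTop := (ConcreteCategory.isIso_iff_bijective _).mpr hbij
  have : IsIso (Spec.map F.appTop) := inferInstance
  exact ((MorphismProperty.isomorphisms Scheme.{u}).arrow_mk_iso_iff
    (arrowIsoSpecΓOfIsAffine F)).mpr this

/-- An open subscheme that is integrally closed in the source lifts to the normalization. -/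
lemma exists_lift_normalization {R Q : CommRingCat.{u}} (f : R ⟶ Q) (hf : Injective f)
    (h : ∀ x : Q, f.hom.IsIntegralElem x → ∃ r, f r = x) {Y : Scheme.{u}} (e : Spec R ⟶ Y)
    [IsOpenImmersion e] (d : Spec Q ⟶ Y) [QuasiCompact d] [QuasiSeparated d]
    (hd : Spec.map f ≫ e = d) :
    ∃ u : Spec R ⟶ d.normalization, IsOpenImmersion u ∧ u ≫ d.fromNormalization = e ∧
      Spec.map f ≫ u = d.toNormalization := by
  have hfst : IsIso (pullback.fst d e) :=
    ⟨pullback.lift (𝟙 _) (Spec.map f) (by rw [Category.id_comp, hd]), by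
      rw [← cancel_mono (pullback.fst d e), Category.assoc, pullback.lift_fst, Category.comp_id,
        Category.id_comp], pullback.lift_fst _ _ _⟩
  have hsnd : pullback.snd d e = pullback.fst d e ≫ Spec.map f := by
    rw [← cancel_mono e, Category.assoc, hd, pullback.condition]
  -- Normalization commutes with restriction to the open subscheme `Spec R`, where it is trivial by
  -- `isIso_fromNormalization`.
  have h1 : IsIso (pullback.snd d.fromNormalization e) := by
    have h2 : IsIso (d.normalizationPullback e ≫ pullback.snd d.fromNormalization e) := by
      rw [d.normalizationPullback_snd e]
      exact isIso_fromNormalization f (pullback.fst d e) hf h _ hsnd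
    exact IsIso.of_isIso_comp_left (d.normalizationPullback e) _
  refine ⟨inv (pullback.snd d.fromNormalization e) ≫ pullback.fst _ _, inferInstance, ?_, ?_⟩
  · rw [Category.assoc, pullback.condition, IsIso.inv_hom_id_assoc]
  · have : pullback.lift d.toNormalization (Spec.map f) (by simp [hd]) ≫
        pullback.snd d.fromNormalization e = Spec.map f := pullback.lift_snd _ _ _
    rw [← this, Category.assoc, IsIso.hom_inv_id_assoc, pullback.lift_fst]

end Normalization

end DynMod
end

noncomputable section

namespace DynMod

open Function

universe u v

/-! ### Wide pullbacks of schemes -/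

section WidePullback

lemma widePullback_base_mem (P : MorphismProperty Scheme.{u}) [P.IsMultiplicative]
    [P.IsStableUnderBaseChange] {S : Scheme.{u}} {m : ℕ} (X : Fin m → Scheme.{u})
    (f : ∀ i, X i ⟶ S) (hf : ∀ i, P (f i)) : P (WidePullback.base f) := by
  induction m with
  | zero =>
    have : IsIso (WidePullback.base f) :=
      ⟨WidePullback.lift (𝟙 S) (fun i => i.elim0) fun i => i.elim0,
        WidePullback.hom_ext _ _ _ (fun i => i.elim0) (by
          rw [Category.assoc, WidePullback.lift_base, Category.comp_id, Category.id_comp]),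
        WidePullback.lift_base _ _ _ _⟩
    exact P.of_isIso _
  | succ m ih =>
    -- A fiber product of `m + 1` schemes is that of the last `m` with the first, so the base map is
    -- a base change followed by `f 0`.
    have h : IsPullback (WidePullback.lift (WidePullback.base f)
        (fun i : Fin m => WidePullback.π f i.succ) (fun i => WidePullback.π_arrow f _))
        (WidePullback.π f 0) (WidePullback.base fun i : Fin m => f i.succ) (f 0) := by
      refine IsPullback.mk' (by rw [WidePullback.lift_base, WidePullback.π_arrow]) ?_ ?_
      · intro T a b h1 h2
        refine WidePullback.hom_ext _ _ _ (fun i => ?_) ?_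
        · refine Fin.cases h2 (fun i => ?_) i
          have := congr($h1 ≫ WidePullback.π (fun i : Fin m => f i.succ) i)
          simpa only [Category.assoc, WidePullback.lift_π] using this
        · simpa only [Category.assoc, WidePullback.π_arrow] using congr($h2 ≫ f 0)
      · intro T a b hab
        refine ⟨WidePullback.lift (b ≫ f 0) (fun i => Fin.cases b (fun i => a ≫
          WidePullback.π (fun i : Fin m => f i.succ) i) i) fun i => ?_, ?_, ?_⟩
        · refine Fin.cases rfl (fun i => ?_) i
          rw [← hab]
          simp only [Fin.cases_succ, Category.assoc]
          rw [WidePullback.π_arrow]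
        · refine WidePullback.hom_ext _ _ _ (fun i => ?_) ?_
          · rw [Category.assoc, WidePullback.lift_π, WidePullback.lift_π]
            rfl
          · rw [Category.assoc, WidePullback.lift_base, WidePullback.lift_base, hab]
        · rw [WidePullback.lift_π]
          rfl
    rw [← WidePullback.π_arrow f 0]
    exact P.comp_mem _ _ (P.of_isPullback h (ih _ _ fun i => hf _)) (hf 0)

variable {S S' : Scheme.{u}} {m : ℕ} {X U : Fin m → Scheme.{u}} {π : ∀ i, X i ⟶ S}
  {q : ∀ i, U i ⟶ S'} {j : S' ⟶ S} {u : ∀ i, U i ⟶ X i}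

lemma isPullback_widePullback (h : ∀ i, IsPullback (u i) (q i) (π i) j) :
    IsPullback (WidePullback.lift (WidePullback.base q ≫ j) (fun i => WidePullback.π q i ≫ u i)
        (fun i => by rw [Category.assoc, (h i).w, WidePullback.π_arrow_assoc]))
      (WidePullback.base q) (WidePullback.base π) j := by
  refine IsPullback.mk' (by rw [WidePullback.lift_base]) ?_ ?_
  · intro T a b h1 h2
    refine WidePullback.hom_ext _ _ _ (fun i => ?_) h2
    refine (h i).hom_ext ?_ ?_
    · have := congr($h1 ≫ WidePullback.π π i)
      simpa only [Category.assoc, WidePullback.lift_π] using this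
    · simpa only [Category.assoc, WidePullback.π_arrow] using h2
  · intro T a b hab
    refine ⟨WidePullback.lift b (fun i => (h i).lift (a ≫ WidePullback.π π i) b
      (by rw [Category.assoc, WidePullback.π_arrow, hab])) fun i => (h i).lift_snd _ _ _, ?_, ?_⟩
    · refine WidePullback.hom_ext _ _ _ (fun i => ?_) ?_
      · rw [Category.assoc, WidePullback.lift_π, WidePullback.lift_π_assoc, (h i).lift_fst]
      · rw [Category.assoc, WidePullback.lift_base, WidePullback.lift_base_assoc, hab]
    · rw [WidePullback.lift_base]

end WidePullback

/-! ### Flatness and density -/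

section Density

/-- The comparison map `U ⟶ X ×_S S'` is an open immersion with dense image, and it is integral
because `q` is. Its image is therefore closed as well, so it is everything. -/
lemma isPullback_of_isIntegralHom {X U S S' : Scheme.{u}} {u : U ⟶ X} {q : U ⟶ S'} {π : X ⟶ S}
    {j : S' ⟶ S} [IsOpenImmersion u] [IsDominant u] [IsIntegralHom q] [IsSeparated π]
    [IsOpenImmersion j] (h : u ≫ π = q ≫ j) : IsPullback u q π j := by
  let l := pullback.lift u q h
  have h1 : l ≫ pullback.fst π j = u := pullback.lift_fst _ _ _
  have h2 : l ≫ pullback.snd π j = q := pullback.lift_snd _ _ _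
  have : IsOpenImmersion (l ≫ pullback.fst π j) := h1 ▸ inferInstance
  have : IsOpenImmersion l := IsOpenImmersion.of_comp l (pullback.fst π j)
  have : IsIntegralHom (l ≫ pullback.snd π j) := h2 ▸ inferInstance
  have : IsIntegralHom l := IsIntegralHom.of_comp l (pullback.snd π j)
  have hclosed : IsClosed (Set.range l) := l.isClosedMap.isClosed_range
  have hdense : Dense (Set.range l) := by
    have hu : Dense (Set.range u) := u.denseRange
    have := hu.preimage (pullback.fst π j).isOpenEmbedding.isOpenMap
    refine this.mono ?_
    rintro x ⟨y, hy⟩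
    refine ⟨y, (pullback.fst π j).isOpenEmbedding.injective ?_⟩
    rw [← hy, ← h1]
    rfl
  have : AlgebraicGeometry.Surjective l :=
    ⟨Set.range_eq_univ.mp (by rw [← hclosed.closure_eq, hdense.closure_eq])⟩
  have : IsIso l := (isIso_iff_isOpenImmersion_and_surjective l).mpr ⟨inferInstance, inferInstance⟩
  exact IsPullback.of_iso_pullback ⟨h⟩ (asIso l) h1 h2

/-- Flat maps lift generizations, so every point of `X` specializes from one over the generic point
of `S`, which lies in `S'`. -/
lemma isDominant_of_isPullback {X X' S S' : Scheme.{u}} {u : X' ⟶ X} {q : X' ⟶ S'} {π : X ⟶ S}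
    {j : S' ⟶ S} [Flat π] [IsOpenImmersion j] [IrreducibleSpace S] [Nonempty S']
    (h : IsPullback u q π j) : IsDominant u := by
  refine ⟨fun x => ?_⟩
  have hη : genericPoint S ⤳ π x := genericPoint_specializes _
  obtain ⟨y, hy, hyη⟩ := Flat.generalizingMap π hη
  have hmem : genericPoint S ∈ j.opensRange :=
    ((genericPoint_spec S).mem_open_set_iff j.opensRange.2).mpr
      ⟨_, trivial, ⟨Classical.arbitrary S', rfl⟩⟩
  have hyr : y ∈ Set.range u := by
    have : y ∈ Set.range (pullback.fst π j) := by
      rw [IsOpenImmersion.range_pullbackFst]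
      exact Set.mem_preimage.mpr (show π y ∈ j.opensRange by rwa [hyη])
    obtain ⟨z, rfl⟩ := this
    refine ⟨h.isoPullback.inv z, ?_⟩
    rw [← Scheme.Hom.comp_apply, h.isoPullback_inv_fst]
  exact hy.mem_closed isClosed_closure (subset_closure hyr)

/-- Over a principal ideal domain flat means torsion-free. An element killed by `r` vanishes on the
dense open set where `r` is invertible, and in a reduced ring it is then zero. -/
lemma flat_of_forall_dense_basicOpen {R T : Type*} [CommRing R] [IsDomain R]
    [IsPrincipalIdealRing R] [CommRing T] [IsReduced T] [Algebra R T]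
    (h : ∀ r : R, r ≠ 0 → Dense (PrimeSpectrum.basicOpen (algebraMap R T r) :
      Set (PrimeSpectrum T))) : Module.Flat R T := by
  rw [Module.Flat.flat_iff_torsion_eq_bot_of_isBezout, eq_bot_iff]
  rintro s ⟨⟨r, hr⟩, hrs⟩
  have hrs' : algebraMap R T r * s = 0 := by rwa [← Algebra.smul_def]
  have hs : PrimeSpectrum.basicOpen s = ⊥ := by
    by_contra hne
    obtain ⟨p, hp⟩ := (TopologicalSpace.Opens.ne_bot_iff_nonempty _).mp hne
    obtain ⟨q, hq, hq'⟩ := (h r (nonZeroDivisors.ne_zero hr)).inter_open_nonempty _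
      (PrimeSpectrum.basicOpen s).2 ⟨p, hp⟩
    have : q ∈ PrimeSpectrum.basicOpen (algebraMap R T r * s) := by
      rw [PrimeSpectrum.basicOpen_mul]
      exact ⟨hq', hq⟩
    rw [hrs', PrimeSpectrum.basicOpen_zero] at this
    exact this
  exact (PrimeSpectrum.basicOpen_eq_bot_iff s).mp hs |>.eq_zero

lemma flat_specMap_of_forall_dense {X S : Scheme.{u}} {π : X ⟶ S} [IsReduced X]
    {R T : CommRingCat.{u}} [IsDomain R] [IsPrincipalIdealRing R] (j : Spec R ⟶ S)
    [IsOpenImmersion j] (κ : Spec T ⟶ X) [IsOpenImmersion κ] (φ : R ⟶ T)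
    (hκ : κ ≫ π = Spec.map φ ≫ j)
    (h : ∀ O : S.Opens, (O : Set S).Nonempty → Dense (π ⁻¹' O)) : Flat (Spec.map φ) := by
  have hred := (affine_isReduced_iff _).mp (isReduced_of_isOpenImmersion κ)
  refine Flat.SpecMap_iff.mpr ?_
  algebraize [φ.hom]
  refine flat_of_forall_dense_basicOpen fun r hr => ?_
  have hne : ((j ''ᵁ PrimeSpectrum.basicOpen r : S.Opens) : Set S).Nonempty :=
    ⟨_, _, show (⟨⊥, Ideal.isPrime_bot⟩ : PrimeSpectrum R) ∈ PrimeSpectrum.basicOpen r from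
      fun hmem => hr hmem, rfl⟩
  refine ((h _ hne).preimage κ.isOpenEmbedding.isOpenMap).mono ?_
  rintro p ⟨y, hy, hyp⟩
  have hp : (κ ≫ π) p = j y := hyp.symm
  rw [hκ, Scheme.Hom.comp_apply] at hp
  have hy' : y ∈ PrimeSpectrum.basicOpen r := hy
  rw [← j.isOpenEmbedding.injective hp] at hy'
  exact hy'

lemma flat_pullbackSnd_of_forall_dense {X S : Scheme.{u}} (π : X ⟶ S) [IsReduced X]
    {R : CommRingCat.{u}} [IsDomain R] [IsPrincipalIdealRing R] (j : Spec R ⟶ S)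
    [IsOpenImmersion j] (h : ∀ O : S.Opens, (O : Set S).Nonempty → Dense (π ⁻¹' O)) :
    Flat (pullback.snd π j) := by
  have : IsZariskiLocalAtSource @Flat.{u} :=
    HasRingHomProperty.instIsZariskiLocalAtSource (Q := RingHom.Flat)
  have key : ∀ {T : CommRingCat.{u}} (k : Spec T ⟶ pullback π j) [IsOpenImmersion k],
      Flat (k ≫ pullback.snd π j) := by
    intro T k _
    obtain ⟨φ, hφ⟩ := Spec.map_surjective (k ≫ pullback.snd π j)
    rw [← hφ]
    refine flat_specMap_of_forall_dense j (k ≫ pullback.fst π j) φ ?_ h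
    rw [hφ, Category.assoc, Category.assoc, pullback.condition]
  exact (IsZariskiLocalAtSource.iff_of_openCover (P := @Flat.{u}) (Scheme.affineCover _)).mpr
    fun k => @key _ _ ((pullback π j).affineCover.map_prop k)

/-- A morphism from a reduced scheme to a scheme covered by spectra of principal ideal domains is
flat if the preimages of nonempty open sets are dense. -/
lemma flat_of_forall_dense {X S : Scheme.{u}} (π : X ⟶ S) [IsReduced X] (𝒰 : S.AffineOpenCover)
    (h𝒰 : ∀ i, IsDomain (𝒰.X i) ∧ IsPrincipalIdealRing (𝒰.X i))
    (h : ∀ O : S.Opens, (O : Set S).Nonempty → Dense (π ⁻¹' O)) : Flat π := by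
  have : IsZariskiLocalAtSource @Flat.{u} :=
    HasRingHomProperty.instIsZariskiLocalAtSource (Q := RingHom.Flat)
  refine (IsZariskiLocalAtSource.iff_of_openCover (P := @Flat.{u})
    (𝒰.openCover.pullback₁ π)).mpr fun i => ?_
  have key : ∀ i, Flat (pullback.fst π (𝒰.f i) ≫ π) := fun i => by
    obtain ⟨_, _⟩ := h𝒰 i
    have := flat_pullbackSnd_of_forall_dense π (𝒰.f i) h
    rw [pullback.condition]
    infer_instance
  exact key i

end Density

end DynMod
end

noncomputable section

namespace DynMod

open Function

universe u v

/-! ### Localizing an algebra at an element of the base -/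

section LocHom

variable {A B C : Type u} [CommRing A] [CommRing B] [CommRing C] [Algebra A B] [Algebra A C]

variable (A B) in
/-- The algebra `B` with an element of the base ring `A` inverted. -/
abbrev LocRing (g : A) : Type u := Localization.Away (algebraMap A B g)

variable (A B) in
/-- The structure map of `LocRing A B g` over the localization of `A`. -/
def locHom (g : A) : Localization.Away g →+* LocRing A B g :=
  IsLocalization.Away.lift g (g := (algebraMap B (LocRing A B g)).comp (algebraMap A B))
    (IsLocalization.Away.algebraMap_isUnit (algebraMap A B g))

lemma locHom_algebraMap (g a : A) : locHom A B g (algebraMap A _ a) =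
    algebraMap B _ (algebraMap A B a) :=
  IsLocalization.Away.lift_eq _ _ _

variable (A) in
/-- The localization of a homomorphism of algebras. -/
def locMap (h : B →ₐ[A] C) (g : A) : LocRing A B g →+* LocRing A C g :=
  IsLocalization.Away.lift (algebraMap A B g) (g := (algebraMap C (LocRing A C g)).comp h.toRingHom)
    (by
      rw [RingHom.comp_apply, show h.toRingHom (algebraMap A B g) = _ from h.commutes g]
      exact IsLocalization.Away.algebraMap_isUnit (algebraMap A C g))

lemma locMap_algebraMap (h : B →ₐ[A] C) (g : A) (b : B) :
    locMap A h g (algebraMap B _ b) = algebraMap C _ (h b) :=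
  IsLocalization.Away.lift_eq _ _ _

lemma locMap_comp_locHom (h : B →ₐ[A] C) (g : A) :
    (locMap A h g).comp (locHom A B g) = locHom A C g := by
  refine IsLocalization.ringHom_ext (Submonoid.powers g) (RingHom.ext fun a => ?_)
  simp only [RingHom.comp_apply, locHom_algebraMap, locMap_algebraMap, AlgHom.commutes]

lemma locHom_isIntegral [Algebra.IsIntegral A B] (g : A) : (locHom A B g).IsIntegral := by
  have : IsLocalization (Algebra.algebraMapSubmonoid B (Submonoid.powers g)) (LocRing A B g) := by
    rw [Algebra.algebraMapSubmonoid_powers]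
    infer_instance
  have h : locHom A B g = IsLocalization.map (LocRing A B g) (algebraMap A B)
      (Submonoid.le_comap_map (Submonoid.powers g)) := by
    refine IsLocalization.ringHom_ext (Submonoid.powers g) (RingHom.ext fun a => ?_)
    rw [RingHom.comp_apply, locHom_algebraMap, RingHom.comp_apply]
    exact (IsLocalization.map_eq _ _).symm
  rw [h]
  exact isIntegral_localization

lemma isIntegralHom_locHom [Algebra.IsIntegral A B] (g : A) :
    IsIntegralHom (Spec.map (CommRingCat.ofHom (locHom A B g))) :=
  IsIntegralHom.SpecMap_iff.mpr (locHom_isIntegral g)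

/-- Étaleness over `A` descends to étaleness over the localization, since `Spec A_g ⟶ Spec A` is an
open immersion and can be cancelled. -/
lemma etale_locHom (g : A) [Algebra.Etale A (LocRing A B g)] :
    Etale (Spec.map (CommRingCat.ofHom (locHom A B g))) := by
  have h : Spec.map (CommRingCat.ofHom (locHom A B g)) ≫
      Spec.map (CommRingCat.ofHom (algebraMap A (Localization.Away g))) =
      Spec.map (CommRingCat.ofHom (algebraMap A (LocRing A B g))) := by
    rw [← Spec.map_comp, ← CommRingCat.ofHom_comp]
    congr 2
    refine RingHom.ext fun a => ?_
    rw [RingHom.comp_apply, locHom_algebraMap, ← IsScalarTower.algebraMap_apply]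
  have : Etale (Spec.map (CommRingCat.ofHom (algebraMap A (LocRing A B g)))) := by
    rw [HasRingHomProperty.Spec_iff (P := @Etale)]
    exact RingHom.etale_algebraMap.mpr inferInstance
  have : Etale (Spec.map (CommRingCat.ofHom (locHom A B g)) ≫
      Spec.map (CommRingCat.ofHom (algebraMap A (Localization.Away g)))) := h ▸ this
  have : IsOpenImmersion (Spec.map (CommRingCat.ofHom (algebraMap A (Localization.Away g)))) :=
    inferInstance
  exact Etale.of_comp _ (Spec.map (CommRingCat.ofHom (algebraMap A (Localization.Away g))))

end LocHom

/-! ### The étale locus of the curve -/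

section Curve

variable {K : Type u} [Field K] {V : Type v} {G : Digraph V} {n : ℕ} {P : Fin n → V}

-- A closed subscheme of an open chart is a quasi-compact immersion, and the source of such a map is
-- open in its scheme-theoretic image.
variable (K G P) in
lemma isOpenImmersion_Y1toClosure : IsOpenImmersion (Y1toClosure K G P) := by
  have : IsClosedImmersion (Y1ι K G P) :=
    IsClosedImmersion.spec_of_surjective _ Ideal.Quotient.mk_surjective
  have : IsImmersion (Y1toPr K G P) := inferInstance
  have : QuasiCompact (Y1toPr K G P) := inferInstance
  exact inferInstance

lemma Y1toPrLine_eq : Y1toPrLine K G P = Spec.map (CommRingCat.ofHom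
    (algebraMap (ParamRing K) (Y1Ring K G P))) ≫ chart Unit K := by
  rw [Y1toPrLine, Y1ι, ← Spec.map_comp_assoc]
  rfl

lemma comap_algebraMap_fractionRing [CharZero K] (hG : IsAdmissible G) (hP : MinGenerates G P)
    (x : PrimeSpectrum (FractionRing (Y1Ring K G P))) :
    x.asIdeal.comap ((algebraMap (Y1Ring K G P) (FractionRing (Y1Ring K G P))).comp
      (algebraMap (ParamRing K) (Y1Ring K G P))) = ⊥ := by
  rw [eq_bot_iff]
  intro r hr
  by_contra h0
  exact x.2.ne_top (Ideal.eq_top_of_isUnit_mem _ hr (IsLocalization.map_units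
    (FractionRing (Y1Ring K G P)) ⟨_, algebraMap_mem_nonZeroDivisors hG hP h0⟩))

/-- The generic points are dense in `X1` and all map to the generic point of the line, since nonzero
polynomials in `t` are nonzerodivisors on `Y1`. -/
lemma IsProjection.dense_preimage [CharZero K] (hG : IsAdmissible G) (hP : MinGenerates G P)
    {π : X1 K G P ⟶ PrLine K} (hπ : IsProjection K G P π) (O : (PrLine K).Opens)
    (hO : (O : Set (PrLine K)).Nonempty) : Dense (π ⁻¹' O) := by
  have hd : Dense (Set.range (genericToX1 K G P)) := (genericToX1 K G P).denseRange
  refine hd.mono ?_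
  rintro _ ⟨x, rfl⟩
  change (genericToX1 K G P ≫ π) x ∈ O
  rw [hπ.genericToX1_comp, Y1toPrLine_eq, ← Spec.map_comp_assoc, ← CommRingCat.ofHom_comp]
  obtain ⟨_, ha, a, rfl⟩ := nonempty_preirreducible_inter O.2 (chart Unit K).opensRange.2 hO
    ⟨_, (⟨⊥, Ideal.isPrime_bot⟩ : PrimeSpectrum (ParamRing K)), rfl⟩
  refine Specializes.mem_open (x := PrimeSpectrum.comap _ x) (y := a) ?_
    (chart Unit K ⁻¹ᵁ O).2 ha
  refine (PrimeSpectrum.le_iff_specializes _ a).mp ?_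
  exact (comap_algebraMap_fractionRing hG hP x).trans_le bot_le

lemma IsProjection.flat [CharZero K] (hG : IsAdmissible G) (hP : MinGenerates G P)
    {π : X1 K G P ⟶ PrLine K} (hπ : IsProjection K G P π) : Flat π :=
  flat_of_forall_dense π (standardCover Unit K)
    (fun o => ⟨isDomain_away Unit K o, isPrincipalIdealRing_chart K o⟩) (hπ.dense_preimage hG hP)

variable (K) in
/-- The inclusion of a basic open set of the affine line into the projective line. -/
def lineOpen (g : ParamRing K) : Spec (.of (Localization.Away g)) ⟶ PrLine K :=
  Spec.map (CommRingCat.ofHom (algebraMap (ParamRing K) (Localization.Away g))) ≫ chart Unit K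

instance (g : ParamRing K) : IsOpenImmersion (lineOpen K g) := by
  unfold lineOpen
  infer_instance

variable (K G P) in
/-- The basic open subscheme of `Y_1(G)` given by an element of `K[t]`. -/
abbrev basicY1 (g : ParamRing K) : Scheme.{u} :=
  Spec (.of (LocRing (ParamRing K) (Y1Ring K G P) g))

variable (K G P) in
/-- The projection `(x, t) ↦ t`. -/
abbrev basicY1Proj (g : ParamRing K) : basicY1 K G P g ⟶ Spec (.of (Localization.Away g)) :=
  Spec.map (CommRingCat.ofHom (locHom (ParamRing K) (Y1Ring K G P) g))

/-- Over `D(g)` the curve is étale over a normal base, hence integrally closed in its ring of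
rational functions, and so unchanged by normalization. It is dense in `X1` because the generic
points factor through it. -/
lemma exists_basicY1_toX1 [CharZero K] (hG : IsAdmissible G) (hP : MinGenerates G P)
    {g : ParamRing K} (hg : g ≠ 0)
    [Algebra.Etale (ParamRing K) (LocRing (ParamRing K) (Y1Ring K G P) g)]
    {π : X1 K G P ⟶ PrLine K} (hπ : IsProjection K G P π) :
    ∃ u : basicY1 K G P g ⟶ X1 K G P, IsOpenImmersion u ∧ IsDominant u ∧
      u ≫ π = basicY1Proj K G P g ≫ lineOpen K g := by
  have := isIntegral_Y1Ring (K := K) hG hP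
  have hnzd := algebraMap_mem_nonZeroDivisors (K := K) hG hP hg
  let B := Y1Ring K G P
  let Bg := LocRing (ParamRing K) B g
  let f : Bg →+* FractionRing B := IsLocalization.Away.lift (algebraMap (ParamRing K) B g)
    (g := algebraMap B (FractionRing B)) (IsLocalization.map_units _ ⟨_, hnzd⟩)
  have hf : ∀ b, f (algebraMap B Bg b) = algebraMap B (FractionRing B) b :=
    fun b => IsLocalization.Away.lift_eq _ _ _
  let := f.toAlgebra
  have : IsScalarTower B Bg (FractionRing B) := .of_algebraMap_eq fun b => (hf b).symm
  have hinj : Injective f := by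
    rw [injective_iff_map_eq_zero]
    intro x hx
    obtain ⟨b, s, rfl⟩ := IsLocalization.exists_mk'_eq
      (Submonoid.powers (algebraMap (ParamRing K) B g)) x
    have hb : algebraMap B (FractionRing B) b = 0 := by
      rw [← hf, ← IsLocalization.mk'_spec Bg b s, map_mul, hx, zero_mul]
    rw [(IsLocalization.to_map_eq_zero_iff _ le_rfl).mp hb, IsLocalization.mk'_zero]
  have he : IsOpenImmersion (Spec.map (CommRingCat.ofHom (algebraMap B Bg)) ≫
      Y1toClosure K G P) := by
    have h1 : IsOpenImmersion (Spec.map (CommRingCat.ofHom (algebraMap B Bg))) :=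
      IsOpenImmersion.of_isLocalization (algebraMap (ParamRing K) B g)
    have h2 := isOpenImmersion_Y1toClosure K G P
    exact IsOpenImmersion.comp _ _
  obtain ⟨u, hu, hue, hud⟩ := exists_lift_normalization (CommRingCat.ofHom f) hinj
    (fun x hx => exists_algebraMap_eq_of_isIntegral_away
      (fun a ha => algebraMap_mem_nonZeroDivisors hG hP ha) hg hx)
    (Spec.map (CommRingCat.ofHom (algebraMap B Bg)) ≫ Y1toClosure K G P) (genericPoints K G P) (by
      rw [← Spec.map_comp_assoc, ← CommRingCat.ofHom_comp]
      congr 3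
      exact RingHom.ext hf)
  let u' : basicY1 K G P g ⟶ X1 K G P := u
  have hue' : u' ≫ X1toClosure K G P =
    Spec.map (CommRingCat.ofHom (algebraMap B Bg)) ≫ Y1toClosure K G P := hue
  have hud' : Spec.map (CommRingCat.ofHom f) ≫ u' = genericToX1 K G P := hud
  refine ⟨u', hu, ?_, ?_⟩
  · have : IsDominant (Spec.map (CommRingCat.ofHom f) ≫ u') := hud' ▸ inferInstance
    exact IsDominant.of_comp (Spec.map (CommRingCat.ofHom f)) u'
  · have := congr(pullback.lift u' _ hue' ≫ $hπ)
    rw [pullback.lift_fst_assoc, pullback.lift_snd_assoc] at this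
    rw [this, Y1toPrLine_eq, lineOpen, ← Spec.map_comp_assoc, ← Spec.map_comp_assoc,
      ← CommRingCat.ofHom_comp, ← CommRingCat.ofHom_comp]
    congr 3
    exact RingHom.ext fun a => (locHom_algebraMap g a).symm

end Curve

end DynMod
end

noncomputable section

namespace DynMod

open Function

universe u v

/-! ### Fiber products of étale covers of a domain -/

section EtaleCover

lemma comp_appTop_eq_of_comp_specMap {T : Scheme.{u}} {R S : CommRingCat.{u}} (φ : R ⟶ S)
    {a b : T ⟶ Spec S} (h : a ≫ Spec.map φ = b ≫ Spec.map φ) :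
    φ ≫ (Scheme.ΓSpecIso S).inv ≫ a.appTop = φ ≫ (Scheme.ΓSpecIso S).inv ≫ b.appTop := by
  rw [Scheme.ΓSpecIso_inv_naturality_assoc, Scheme.ΓSpecIso_inv_naturality_assoc,
    ← Scheme.Hom.comp_appTop, ← Scheme.Hom.comp_appTop, h]

variable {R S : CommRingCat.{u}} {m : ℕ} {T : Fin m → CommRingCat.{u}} {f : ∀ i, R ⟶ T i}
  {s : R ⟶ S} {φ : ∀ i, T i ⟶ S}

/-- The morphism to the fiber product given by compatible homomorphisms of algebras. -/
def specLift (h : ∀ i, f i ≫ φ i = s) :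
    Spec S ⟶ widePullback (Spec R) (fun i => Spec (T i)) fun i => Spec.map (f i) :=
  WidePullback.lift (Spec.map s) (fun i => Spec.map (φ i)) fun i => by rw [← Spec.map_comp, h]

/-- A morphism to `Spec S` is a homomorphism from `S` to global sections, and by hypothesis such a
homomorphism is determined by its restrictions to `R` and the `T i`. -/
lemma mono_specLift (h : ∀ i, f i ≫ φ i = s)
    (hepi : ∀ (X : CommRingCat.{u}) (α β : S ⟶ X), s ≫ α = s ≫ β →
      (∀ i, φ i ≫ α = φ i ≫ β) → α = β) : Mono (specLift h) := by
  refine ⟨fun {X} a b hab => ?_⟩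
  have hα : (Scheme.ΓSpecIso S).inv ≫ a.appTop = (Scheme.ΓSpecIso S).inv ≫ b.appTop := by
    refine hepi _ _ _ (comp_appTop_eq_of_comp_specMap s ?_) fun i =>
      comp_appTop_eq_of_comp_specMap (φ i) ?_
    · have := congr($hab ≫ WidePullback.base _)
      simpa only [Category.assoc, specLift, WidePullback.lift_base] using this
    · have := congr($hab ≫ WidePullback.π _ i)
      simpa only [Category.assoc, specLift, WidePullback.lift_π] using this
  exact ext_of_isAffine ((cancel_epi _).mp hα)

/-- The image is closed by integrality. By flatness every point of the fiber product specializes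
from one over the generic point of `Spec R`, and the residue field there is a field to which the
lifting hypothesis applies. -/
lemma surjective_specLift [IsDomain R] (h : ∀ i, f i ≫ φ i = s)
    [Flat (WidePullback.base fun i => Spec.map (f i))] [IsIntegralHom (specLift h)]
    (hpt : ∀ (L : Type u) [Field L] (a : R ⟶ .of L) (_ : Injective a) (ψ : ∀ i, T i ⟶ .of L)
      (_ : ∀ i, f i ≫ ψ i = a), ∃ χ : S ⟶ .of L, s ≫ χ = a ∧ ∀ i, φ i ≫ χ = ψ i) :
    AlgebraicGeometry.Surjective (specLift h) := by
  refine ⟨fun z => ?_⟩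
  have hη : (⟨⊥, Ideal.isPrime_bot⟩ : PrimeSpectrum R) ⤳
      (WidePullback.base fun i => Spec.map (f i)) z :=
    (PrimeSpectrum.le_iff_specializes _ _).mp
      (show (⊥ : Ideal R) ≤ _ from bot_le)
  obtain ⟨y, hy, hyη⟩ := Flat.generalizingMap (WidePullback.base fun i => Spec.map (f i)) hη
  refine hy.mem_closed (specLift h).isClosedMap.isClosed_range ?_
  let Z := widePullback (Spec R) (fun i => Spec (T i)) fun i => Spec.map (f i)
  let L := Z.residueField y
  let ι : Spec L ⟶ Z := Z.fromSpecResidueField y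
  obtain ⟨a, ha⟩ := Spec.map_surjective (ι ≫ WidePullback.base _)
  choose ψ hψ using fun i => Spec.map_surjective (ι ≫ WidePullback.π _ i)
  have hψa : ∀ i, f i ≫ ψ i = a := fun i => Spec.map_injective (by
    rw [Spec.map_comp, hψ, ha, Category.assoc, WidePullback.π_arrow])
  let o : Spec L := IsLocalRing.closedPoint L
  have hιo : ι o = y := Z.fromSpecResidueField_apply y o
  have hinj : Injective a := by
    rw [injective_iff_map_eq_zero]
    intro r hr
    have : r ∈ (Spec.map a o).asIdeal := by
      change a r ∈ o.asIdeal
      rw [hr]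
      exact zero_mem _
    rw [ha, Scheme.Hom.comp_apply, hιo, hyη] at this
    exact this
  obtain ⟨χ, hχ, hχ'⟩ := hpt L a hinj ψ hψa
  refine ⟨Spec.map χ o, ?_⟩
  have hι : Spec.map χ ≫ specLift h = ι := by
    refine WidePullback.hom_ext _ _ _ (fun i => ?_) ?_
    · rw [Category.assoc, specLift, WidePullback.lift_π, ← Spec.map_comp, hχ', hψ]
    · rw [Category.assoc, specLift, WidePullback.lift_base, ← Spec.map_comp, hχ, ha]
  rw [← Scheme.Hom.comp_apply, hι]
  exact hιo

/-- Compatible étale covers of a domain present one of them as the fiber product of the others,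
if this holds for generic points and the homomorphisms are jointly epimorphic. -/
lemma isIso_specLift [IsDomain R] (h : ∀ i, f i ≫ φ i = s)
    (hf : ∀ i, Etale (Spec.map (f i))) (hf' : ∀ i, IsIntegralHom (Spec.map (f i)))
    [Etale (Spec.map s)] [IsIntegralHom (Spec.map s)]
    (hepi : ∀ (X : CommRingCat.{u}) (α β : S ⟶ X), s ≫ α = s ≫ β →
      (∀ i, φ i ≫ α = φ i ≫ β) → α = β)
    (hpt : ∀ (L : Type u) [Field L] (a : R ⟶ .of L) (_ : Injective a) (ψ : ∀ i, T i ⟶ .of L)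
      (_ : ∀ i, f i ≫ ψ i = a), ∃ χ : S ⟶ .of L, s ≫ χ = a ∧ ∀ i, φ i ≫ χ = ψ i) :
    IsIso (specLift h) := by
  have h1 : Etale (WidePullback.base fun i => Spec.map (f i)) :=
    widePullback_base_mem @Etale _ _ hf
  have h2 : IsIntegralHom (WidePullback.base fun i => Spec.map (f i)) :=
    widePullback_base_mem @IsIntegralHom _ _ hf'
  have hcomp : specLift h ≫ WidePullback.base _ = Spec.map s := WidePullback.lift_base _ _ _ _
  have h3 : Etale (specLift h ≫ WidePullback.base _) := hcomp ▸ inferInstance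
  have h4 : IsIntegralHom (specLift h ≫ WidePullback.base _) := hcomp ▸ inferInstance
  have h5 : Etale (specLift h) := Etale.of_comp _ (WidePullback.base fun i => Spec.map (f i))
  have h6 : IsIntegralHom (specLift h) :=
    IsIntegralHom.of_comp _ (WidePullback.base fun i => Spec.map (f i))
  have h7 := mono_specLift h hepi
  have h8 := surjective_specLift h hpt
  -- A flat, surjective, quasi-compact monomorphism is an isomorphism.
  exact Flat.isIso_of_surjective_of_mono _

end EtaleCover

end DynMod
end

noncomputable section

namespace DynMod

open Function

universe u v

/-! ### Decomposition of the curve of a disjoint union -/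

section Decomposition

variable {K : Type u} [Field K] {V : Type v} {G : Digraph V} {n : ℕ} {P : Fin n → V}

lemma isSeparated_of_X1 (π : X1 K G P ⟶ PrLine K) : IsSeparated π := by
  have h1 : IsSeparated (X1toClosure K G P) :=
    inferInstanceAs (IsSeparated (genericPoints K G P).fromNormalization)
  have h2 : IsSeparated (X1toClosure K G P ≫ (Y1toPr K G P).imageι) := inferInstance
  have h3 : (PrSpace (Option (Fin n)) K).IsSeparated := inferInstance
  have h4 : (X1 K G P).IsSeparated := ⟨by
    rw [terminal.hom_ext (terminal.from (X1 K G P))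
      ((X1toClosure K G P ≫ (Y1toPr K G P).imageι) ≫ terminal.from _)]
    infer_instance⟩
  infer_instance

/-- The étale locus of `X_1(G)` as a fiber product. -/
lemma exists_isPullback_basicY1 [CharZero K] (hG : IsAdmissible G) (hP : MinGenerates G P)
    {g : ParamRing K} (hg : g ≠ 0)
    [Algebra.Etale (ParamRing K) (LocRing (ParamRing K) (Y1Ring K G P) g)]
    {π : X1 K G P ⟶ PrLine K} (hπ : IsProjection K G P π) :
    ∃ u : basicY1 K G P g ⟶ X1 K G P, IsOpenImmersion u ∧ IsDominant u ∧
      IsPullback u (basicY1Proj K G P g) π (lineOpen K g) := by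
  obtain ⟨u, h1, h2, hu⟩ := exists_basicY1_toX1 hG hP hg hπ
  have := isIntegral_Y1Ring (K := K) hG hP
  have := isIntegralHom_locHom (B := Y1Ring K G P) g
  have := isSeparated_of_X1 π
  exact ⟨u, h1, h2, isPullback_of_isIntegralHom hu⟩

variable [CharZero K] {m : ℕ} {S : Fin m → Set V} {r : Fin m → ℕ} {Q : ∀ i, Fin (r i) → S i}

/-- Restriction of embeddings to a part of the graph. -/
def partHom (hG : IsAdmissible G) (hP : MinGenerates G P)
    (hadm : ∀ i, IsAdmissible (inducedSubgraph G (S i)))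
    (hQ : ∀ i, MinGenerates (inducedSubgraph G (S i)) (Q i)) (i : Fin m) :
    Y1Ring K (inducedSubgraph G (S i)) (Q i) →ₐ[ParamRing K] Y1Ring K G P :=
  { resHom hG hP (hadm i) (hQ i) Subtype.val fun _ _ _ _ hφ => hφ.restrict hG (hadm i) with
    commutes' := resHom_algebraMap _ _ _ _ _ _ }

variable (hG : IsAdmissible G) (hP : MinGenerates G P)
    (hadm : ∀ i, IsAdmissible (inducedSubgraph G (S i)))
    (hQ : ∀ i, MinGenerates (inducedSubgraph G (S i)) (Q i))

lemma partHom_vtx (i : Fin m) (p : S i) :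
    partHom hG hP hadm hQ i (vtx K (hQ i).1 p) = vtx K hP.1 p :=
  resHom_vtx hG hP (hadm i) (hQ i) Subtype.val (fun _ _ _ _ hφ => hφ.restrict hG (hadm i)) p

lemma partHom_comp (g : ParamRing K) (i : Fin m) :
    CommRingCat.ofHom (locHom (ParamRing K) (Y1Ring K (inducedSubgraph G (S i)) (Q i)) g) ≫
      CommRingCat.ofHom (locMap (ParamRing K) (partHom hG hP hadm hQ i) g) =
    CommRingCat.ofHom (locHom (ParamRing K) (Y1Ring K G P) g) := by
  rw [← CommRingCat.ofHom_comp, locMap_comp_locHom]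

/-- The coordinate ring is generated by `K[t]` and the values of the generators, and each generator
is a vertex of some part. -/
lemma Y1Ring_ringHom_ext (hcov : ⋃ i, S i = Set.univ) {X : Type*} [CommRing X]
    {α β : Y1Ring K G P →+* X}
    (h : α.comp (algebraMap (ParamRing K) _) = β.comp (algebraMap (ParamRing K) _))
    (h' : ∀ i, α.comp (partHom hG hP hadm hQ i).toRingHom =
      β.comp (partHom hG hP hadm hQ i).toRingHom) : α = β := by
  refine Ideal.Quotient.ringHom_ext (MvPolynomial.ringHom_ext (fun c => ?_) fun o => ?_)
  · have := congr($h (MvPolynomial.C c))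
    simp only [RingHom.comp_apply] at this ⊢
    have hc : algebraMap (ParamRing K) (Y1Ring K G P) (MvPolynomial.C c) =
        Ideal.Quotient.mk _ (MvPolynomial.C c) :=
      congrArg (Ideal.Quotient.mk _) (by simp [algebraMap_paramRing])
    rwa [hc] at this
  · cases o with
    | none =>
      have := congr($h (MvPolynomial.X ()))
      simp only [RingHom.comp_apply] at this ⊢
      rwa [algebraMap_Y1Ring_X] at this
    | some k =>
      have hk : P k ∈ ⋃ i, S i := hcov ▸ Set.mem_univ _
      obtain ⟨i, hi⟩ := Set.mem_iUnion.mp hk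
      have : α (partHom hG hP hadm hQ i (vtx K (hQ i).1 ⟨P k, hi⟩)) =
        β (partHom hG hP hadm hQ i (vtx K (hQ i).1 ⟨P k, hi⟩)) := congr($(h' i) _)
      rwa [partHom_vtx, vtx_generator hG hP] at this

/-- Injectivity of `a` makes the parameter transcendental, so each `ψ i` is evaluation at an
embedding of a part; the glued embedding gives `χ`. -/
lemma exists_ringHom_of_forall (hS : IsDisjointUnion G S)
    (hcyc : Pairwise fun i j => Disjoint (cycleLengths (inducedSubgraph G (S i)))
      (cycleLengths (inducedSubgraph G (S j))))
    {L : Type u} [Field L] {a : ParamRing K →+* L} (ha : Injective a)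
    {ψ : ∀ i, Y1Ring K (inducedSubgraph G (S i)) (Q i) →+* L}
    (hψ : ∀ i, (ψ i).comp (algebraMap (ParamRing K) _) = a) :
    ∃ χ : Y1Ring K G P →+* L, χ.comp (algebraMap (ParamRing K) _) = a ∧
      ∀ i, χ.comp (partHom hG hP hadm hQ i).toRingHom = ψ i := by
  let := (a.comp MvPolynomial.C).toAlgebra
  let a' : ParamRing K →ₐ[K] L := { a with commutes' := fun _ => rfl }
  have ht : Transcendental K (a (MvPolynomial.X ())) :=
    (transcendental_iff_injective_paramRing a').mpr ha
  have hc : ∀ i c, ψ i (algebraMap K _ c) = algebraMap K L c := fun i c => by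
    have := congr($(hψ i) (algebraMap K (ParamRing K) c))
    rw [RingHom.comp_apply, ← IsScalarTower.algebraMap_apply] at this
    exact this
  let ψ' : ∀ i, Y1Ring K (inducedSubgraph G (S i)) (Q i) →ₐ[K] L := fun i =>
    { ψ i with commutes' := hc i }
  choose φ hφ hφ' using fun i => exists_eq_evalEmb (hadm i) (hQ i) (ψ' i)
    (t := a (MvPolynomial.X ())) congr($(hψ i) (MvPolynomial.X ())) ht
  obtain ⟨ψG, hψG, hres⟩ := exists_isEmb_of_forall hG hS hadm hcyc hφ
  refine ⟨(evalEmb hG hP ht hψG).toRingHom, ?_, fun i => ?_⟩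
  · refine MvPolynomial.ringHom_ext (fun c => ?_) fun ⟨⟩ => ?_
    · have : algebraMap (ParamRing K) (Y1Ring K G P) (MvPolynomial.C c) =
        algebraMap K (Y1Ring K G P) c := (IsScalarTower.algebraMap_apply K (ParamRing K) _ c).symm
      rw [RingHom.comp_apply, this]
      exact (evalEmb hG hP ht hψG).commutes c
    · rw [RingHom.comp_apply, algebraMap_Y1Ring_X]
      exact evalEmb_tvar hG hP ht hψG
  · have h1 := evalEmb_comp_resHom hG hP (hadm i) (hQ i) Subtype.val
      (fun _ _ _ _ hφ => hφ.restrict hG (hadm i)) ht hψG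
    have h2 : ψ' i = evalEmb (hadm i) (hQ i) ht (hψG.restrict hG (hadm i)) := by
      rw [hφ' i]
      congr 1
      exact (hres i).symm
    rw [← h2] at h1
    exact congr(($h1).toRingHom)

lemma isIso_specLift_partHom (hS : IsDisjointUnion G S)
    (hcyc : Pairwise fun i j => Disjoint (cycleLengths (inducedSubgraph G (S i)))
      (cycleLengths (inducedSubgraph G (S j))))
    {g : ParamRing K} (hg : g ≠ 0)
    [Algebra.Etale (ParamRing K) (LocRing (ParamRing K) (Y1Ring K G P) g)]
    (het : ∀ i, Algebra.Etale (ParamRing K)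
      (LocRing (ParamRing K) (Y1Ring K (inducedSubgraph G (S i)) (Q i)) g)) :
    IsIso (specLift (partHom_comp hG hP hadm hQ g)) := by
  have := isIntegral_Y1Ring (K := K) hG hP
  have := fun i => isIntegral_Y1Ring (K := K) (hadm i) (hQ i)
  have := isIntegralHom_locHom (B := Y1Ring K G P) g
  have := etale_locHom (B := Y1Ring K G P) g
  have : IsDomain (Localization.Away g) := IsLocalization.isDomain_localization
    (powers_le_nonZeroDivisors_of_noZeroDivisors hg)
  refine isIso_specLift _ (fun i => etale_locHom g) (fun i => isIntegralHom_locHom g) ?_ ?_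
  · intro X α β h h'
    refine CommRingCat.hom_ext (IsLocalization.ringHom_ext
      (Submonoid.powers (algebraMap (ParamRing K) (Y1Ring K G P) g))
      (Y1Ring_ringHom_ext hG hP hadm hQ hS.cover (RingHom.ext fun a => ?_)
        fun i => RingHom.ext fun b => ?_))
    · have := congr($h (algebraMap _ _ a))
      change α.hom (locHom _ _ g _) = β.hom (locHom _ _ g _) at this
      rwa [locHom_algebraMap] at this
    · have := congr($(h' i) (algebraMap _ _ b))
      change α.hom (locMap _ _ g _) = β.hom (locMap _ _ g _) at this
      rwa [locMap_algebraMap] at this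
  · intro L _ a ha ψ hψ
    have ha' : Injective (a.hom.comp (algebraMap (ParamRing K) (Localization.Away g))) :=
      ha.comp (IsLocalization.injective _ (powers_le_nonZeroDivisors_of_noZeroDivisors hg))
    obtain ⟨χ, hχ, hχ'⟩ := exists_ringHom_of_forall hG hP hadm hQ hS hcyc ha'
      (ψ := fun i => (ψ i).hom.comp (algebraMap _ _)) fun i => RingHom.ext fun b => by
        have := congr($(hψ i) (algebraMap _ _ b))
        change (ψ i).hom (locHom _ _ g _) = _ at this
        rw [locHom_algebraMap] at this
        exact this
    have hu : IsUnit (χ (algebraMap (ParamRing K) _ g)) := by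
      rw [← RingHom.comp_apply, hχ, RingHom.comp_apply]
      exact (IsLocalization.Away.algebraMap_isUnit g).map a.hom
    refine ⟨CommRingCat.ofHom (IsLocalization.Away.lift _ hu), CommRingCat.hom_ext
      (IsLocalization.ringHom_ext (Submonoid.powers g) (RingHom.ext fun b => ?_)),
      fun i => CommRingCat.hom_ext (IsLocalization.ringHom_ext
        (Submonoid.powers (algebraMap (ParamRing K) (Y1Ring K (inducedSubgraph G (S i)) (Q i)) g))
        (RingHom.ext fun b => ?_))⟩
    · change IsLocalization.Away.lift _ hu (locHom _ _ g _) = _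
      rw [locHom_algebraMap, IsLocalization.Away.lift_eq]
      exact congr($hχ b)
    · change IsLocalization.Away.lift _ hu (locMap _ (partHom hG hP hadm hQ i) g _) = _
      rw [locMap_algebraMap, IsLocalization.Away.lift_eq]
      exact congr($(hχ' i) b)

/-- The curves of a graph and of its parts are simultaneously étale over an open subset of the
parameter line. -/
lemma exists_etale (hG : IsAdmissible G) (hP : MinGenerates G P)
    (hadm : ∀ i, IsAdmissible (inducedSubgraph G (S i)))
    (hQ : ∀ i, MinGenerates (inducedSubgraph G (S i)) (Q i)) :
    ∃ g : ParamRing K, g ≠ 0 ∧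
      Algebra.Etale (ParamRing K) (LocRing (ParamRing K) (Y1Ring K G P) g) ∧
      ∀ i, Algebra.Etale (ParamRing K)
        (LocRing (ParamRing K) (Y1Ring K (inducedSubgraph G (S i)) (Q i)) g) := by
  have := finite_Y1Ring (K := K) hG hP
  have := fun i => finite_Y1Ring (K := K) (hadm i) (hQ i)
  obtain ⟨g, hg, h⟩ := exists_forall_etale (A := ParamRing K) (B := Y1Ring K G P)
  choose g' hg' h' using fun i => exists_forall_etale (A := ParamRing K)
    (B := Y1Ring K (inducedSubgraph G (S i)) (Q i))
  exact ⟨g * ∏ i, g' i, mul_ne_zero hg (Finset.prod_ne_zero_iff.mpr fun i _ => hg' i),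
    h _ (dvd_mul_right _ _), fun i => h' i _
      ((Finset.dvd_prod_of_mem g' (Finset.mem_univ i)).trans (dvd_mul_left _ _))⟩

/-- The curve of a disjoint union is birational to the fiber product of the curves of the parts. -/
lemma birationalOver_widePullback (hG : IsAdmissible G) (hP : MinGenerates G P)
    (hadm : ∀ i, IsAdmissible (inducedSubgraph G (S i)))
    (hQ : ∀ i, MinGenerates (inducedSubgraph G (S i)) (Q i)) (hS : IsDisjointUnion G S)
    (hcyc : Pairwise fun i j => Disjoint (cycleLengths (inducedSubgraph G (S i)))
      (cycleLengths (inducedSubgraph G (S j))))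
    {πG : X1 K G P ⟶ PrLine K} (hπG : IsProjection K G P πG)
    {π : ∀ i, X1 K (inducedSubgraph G (S i)) (Q i) ⟶ PrLine K}
    (hπ : ∀ i, IsProjection K (inducedSubgraph G (S i)) (Q i) (π i)) :
    Scheme.BirationalOver πG (WidePullback.base π) := by
  obtain ⟨g, hg, hetG, het⟩ := exists_etale (K := K) hG hP hadm hQ
  obtain ⟨u, hu, hu', hpb⟩ := exists_isPullback_basicY1 hG hP hg hπG
  choose v hv hv' hpb' using fun i => exists_isPullback_basicY1 (hadm i) (hQ i) hg (hπ i)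
  have : IsIso (specLift (partHom_comp hG hP hadm hQ g)) :=
    isIso_specLift_partHom hG hP hadm hQ hS hcyc hg het
  -- Flatness supplies density in the fiber product without knowing whether it is irreducible or
  -- reduced.
  have hflat : Flat (WidePullback.base π) :=
    widePullback_base_mem @Flat _ _ fun i => (hπ i).flat (hadm i) (hQ i)
  have hW := isPullback_widePullback hpb'
  have : IsDomain (Localization.Away g) := IsLocalization.isDomain_localization
    (powers_le_nonZeroDivisors_of_noZeroDivisors hg)
  have : Nonempty (Spec (.of (Localization.Away g))) := inferInstance
  have hdom := isDominant_of_isPullback hW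
  have hopen := MorphismProperty.of_isPullback (P := @IsOpenImmersion) hW.flip inferInstance
  -- The étale part of the curve of the union is a common dense open subscheme: directly on one
  -- side, and through the isomorphism `specLift` on the other.
  have h1 : Scheme.BirationalOver (basicY1Proj K G P g ≫ lineOpen K g) πG :=
    Scheme.Hom.birationalOver u _ _ hpb.w
  have h2 : Scheme.BirationalOver (basicY1Proj K G P g ≫ lineOpen K g) (WidePullback.base π) := by
    refine Scheme.Hom.birationalOver (specLift (partHom_comp hG hP hadm hQ g) ≫ _) _ _
      ((Category.assoc _ _ _).trans ((congrArg _ hW.w).trans ?_))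
    rw [← Category.assoc]
    congr 1
    exact WidePullback.lift_base _ _ _ _
  exact h1.symm.trans h2

end Decomposition

end DynMod
end

theorem mainTheorem9 {K : Type*} [Field K] [CharZero K] {V : Type*} (G : Digraph V)
    (hG : DynMod.IsAdmissible G) {m : ℕ} (S : Fin m → Set V)
    (hS : DynMod.IsDisjointUnion G S)
    (hadm : ∀ i, DynMod.IsAdmissible (DynMod.inducedSubgraph G (S i)))
    (hcyc : Pairwise fun i j => Disjoint
      (DynMod.cycleLengths (DynMod.inducedSubgraph G (S i)))
      (DynMod.cycleLengths (DynMod.inducedSubgraph G (S j))))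
    {n : ℕ} (P : Fin n → V) (hP : DynMod.MinGenerates G P)
    (r : Fin m → ℕ) (Q : ∀ i, Fin (r i) → S i)
    (hQ : ∀ i, DynMod.MinGenerates (DynMod.inducedSubgraph G (S i)) (Q i)) :
    (∃! π, DynMod.IsProjection K G P π) ∧
    (∀ i, ∃! π, DynMod.IsProjection K (DynMod.inducedSubgraph G (S i)) (Q i) π) ∧
    ∀ (πG : DynMod.X1 K G P ⟶ DynMod.PrLine K)
      (π : ∀ i, DynMod.X1 K (DynMod.inducedSubgraph G (S i)) (Q i) ⟶ DynMod.PrLine K),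
      DynMod.IsProjection K G P πG →
      (∀ i, DynMod.IsProjection K (DynMod.inducedSubgraph G (S i)) (Q i) (π i)) →
      Scheme.BirationalOver πG (WidePullback.base π) := by
  refine ⟨?_, fun i => ?_, fun πG π hπG hπ =>
    DynMod.birationalOver_widePullback hG hP hadm hQ hS hcyc hπG hπ⟩
  · obtain ⟨π, hπ⟩ := DynMod.exists_isProjection (K := K) hG hP
    exact ⟨π, hπ, fun π' hπ' => hπ'.unique hπ⟩
  · obtain ⟨π, hπ⟩ := DynMod.exists_isProjection (K := K) (hadm i) (hQ i)
    exact ⟨π, hπ, fun π' hπ' => hπ'.unique hπ⟩
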